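/- **Setting.** Let $\Omega=[l_1,l_2]$, $t_1>0$, $\varkappa\in\mathbb R$, $L=\partial_t-\partial_x^2$, $\omega_0=\tanh$, $F(v)=\frac{v^4}{4}-\frac{v^2}{2}+\frac14$, and let $H$ be the Heaviside function. The small parameter $\varepsilon$ ranges over $(0,\varepsilon_0)$. Test functions are elements of $C_0^\infty((l_1,l_2))$. For a function $R(t,\varepsilon)$, $R=O(\varepsilon^\nu)$ means that $|R|\le C\varepsilon^\nu$ for all $t\in[0,t_1]$ and all small $\varepsilon$; a distribution in $x$ depending on $t,\varepsilon$ is $O_{\mathcal D'}(\varepsilon^\nu)$ if its value on every test function is $O(\varepsilon^\nu)$. **Definition.** A pair $(\check u,\check\theta)$, with $\check u$ smooth in $(x,t)\in\Omega\times[0,t_1]$, and $\check\theta$ continuous, absolutely continuous in $x$, and differentiable in $t\in[0,t_1]$ as a distribution in $x$, is a *weak asymptotic solution* of the phase field system $$L\theta=-u_t,\qquad \varepsilon Lu-\frac{u-u^3}{\varepsilon}-\varkappa\theta=0$$ if for all test functions $\zeta,\xi$ and every $\mu\in(0,1/2)$ $$\int_\Omega \check u_t\zeta\,dx+\frac{d}{dt}\int_\Omega\check\theta\zeta\,dx+\int_\Omega\check\theta_x\zeta_x\,dx=O(\varepsilon),$$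 $$\varepsilon\int_\Omega\check u_t\check u_x\xi\,dx+\frac{\varepsilon}{2}\int_\Omega\check u_x^2\xi_x\,dx-\frac1\varepsilon\int_\Omega F(\check u)\xi_x\,dx+\varkappa\int_\Omega\check u\,\partial_x(\check\theta\xi)\,dx=O(\varepsilon^\mu).$$ **Ansatz.** Let $\varphi_{i0}(t)$, $\varphi_{i1}(\tau,t)$ $(i=1,2)$, $\beta(\tau)$, $B(\tau)$ be smooth with $\varphi_{10}(0)<\varphi_{20}(0)$, and put $$\psi_0=\varphi_{20}-\varphi_{10},\quad \tau=\psi_0/\varepsilon,\quad \varphi_i(t,\varepsilon)=\varphi_{i0}+\psi_0\,\varphi_{i1}(\tau,t),\quad \psi=\varphi_2-\varphi_1,\quad \rho=\psi/\varepsilon,\quad \eta=\beta\rho,\quad x^*=\tfrac{\varphi_1+\varphi_2}{2}.$$ Assume, uniformly in $t\in[0,t_1]$: $\varphi_{i1}=O(\tau^{-1})$ as $\tau\to+\infty$; $\varphi_{i1}-\varphi_{i1}^-(t)=O(|\tau|^{-1})$ as $\tau\to-\infty$ for some functions $\varphi_{i1}^-$; $\partial_\tau\varphi_{i1}=O(|\tau|^{-1})$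 as $|\tau|\to\infty$; $\partial_t\varphi_{i1}$ is bounded on $\mathbb R\times[0,t_1]$. Assume $0<\delta_1<\beta<\delta_2$ with constants $\delta_1,\delta_2$, and $\beta_\tau=O(|\tau|^{-1})$ as $|\tau|\to\infty$; and $B\to1$ as $\tau\to+\infty$, $B\to0$ as $\tau\to-\infty$, all derivatives of $B$ being $O(|\tau|^{-N})$ for every $N$ as $|\tau|\to\infty$. For each $\varepsilon$ let $\psi(\cdot,\varepsilon)$ have at most countably many zeros in $[0,t_1]$. Let $\gamma_i^\pm(t)$ be $C^1$, and let $e\in C_0^\infty((l_1,l_2))$ with $e=1$ on the segment between $\varphi_1(t,\varepsilon)$ and $\varphi_2(t,\varepsilon)$ for all $t\in[0,t_1]$ and $\varepsilon$. Put $$\check u=\tfrac12\Big[1+\omega_0\big(\beta\tfrac{\varphi_1-x}{\varepsilon}\big)+\omega_0\big(\beta\tfrac{x-\varphi_2}{\varepsilon}\big)-\omega_0\big(\beta\tfrac{\varphi_1-x}{\varepsilon}\big)\omega_0\big(\beta\tfrac{x-\varphi_2}{\varepsilon}\big)\Big],$$ $$\begin{aligned}\check T={}&\gamma_1^-(\varphi_1-x)H(\varphi_1-x)+\gamma_2^+(x-\varphi_2)H(x-\varphi_2)+\Pi\,B(\tau)\,[H(x-\varphi_1)-H(x-\varphi_2)]\\&+\hat\Pi\,(1-B(\tau))\,[H(x-\varphi_2)-H(x-\varphi_1)]+I,\end{aligned}$$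 $$\Pi=\gamma^-\frac{(\varphi_1-x)(x-\varphi_2)}{\psi},\qquad \hat\Pi=\hat\gamma\,\frac{(\varphi_1-x)(x-\varphi_2)}{\psi},$$ where $\gamma^-,\hat\gamma,I$ are linear in $x$ with $\gamma^-|_{\varphi_1}=\gamma_1^+$, $\gamma^-|_{\varphi_2}=\gamma_2^-$, $\hat\gamma|_{\varphi_1}=\gamma_1^-$, $\hat\gamma|_{\varphi_2}=\gamma_2^+$, $I|_{\varphi_i}=(-1)^{i+1}\varphi_{it}$; more precisely $I=\frac{\varphi_{1t}-\varphi_{2t}}{2}-(x-x^*)\kappa$ with $\kappa(t,\varepsilon)$ continuous in $t$ and $\psi\kappa=\varphi_{1t}+\varphi_{2t}$ (in particular $\varphi_{1t}+\varphi_{2t}=0$ when $\psi=0$). Let $$\check\theta=e\check T+\check q+\hat q,\qquad q=\check q+\hat q,$$ where $\check q(x,t,\varepsilon)$ is $C^1$ in $x$, $\check q$ and $\check q_x$ are bounded, $\check q$ is Lipschitz in $t$ and $\check q_x$ is Lipschitz in $x$, all uniformly in $\varepsilon$; and $\hat q$ is continuous on $\Omega\times[0,t_1]$ and absolutely continuous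 in $x$. **Coefficients.** Let $\Omega(z,\eta)=\frac12\{1+\omega_0(z)+\omega_0(-z-\eta)-\omega_0(z)\omega_0(-z-\eta)\}$ and $$B_{\dot00}=\int_{\mathbb R}\dot\omega_0(z)\omega_0(-\eta-z)\,dz,\quad B^z_{\dot00}=\int_{\mathbb R} z\dot\omega_0(z)\omega_0(-\eta-z)\,dz,\quad B_\Omega=\int_{\mathbb R}\Omega'_z(\Omega'_z-\Omega'_\eta)\,dz,$$ $$B^z_\Omega=\int_{\mathbb R}[z(\Omega'_z-\Omega'_\eta)-(z+\eta)\Omega'_\eta](\Omega'_z-\Omega'_\eta)\,dz,\quad C_\Omega=\int_{\mathbb R}(\Omega'_z-\Omega'_\eta)\,dz,\quad \hat C=\tfrac14\int_{\mathbb R}(\Omega'_z)^2dz,\quad \hat D=\tfrac12\int_{\mathbb R} F(\Omega)\,dz,$$ $$A_i=(-1)^{i+1}\frac{\varphi_{it}}2(2-B_{\dot00})-\frac{\beta_\tau\psi_{0t}}{2\beta^2}B^z_{\dot00},$$ $$V_i^1=-\beta\Big[\varphi_{it}B_\Omega+(-1)^{i+1}\frac{\beta_\tau\psi_{0t}}{\beta^2}B^z_\Omega\Big]+(-1)^{i+1}\varkappa\,(eI+q)|_{x=\varphi_i}\,C_\Omega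 .$$ (These are the coefficients of $\delta(x-\varphi_i)$ in $\check u_t$ and in $\check u_x\big(\varepsilon L\check u-\frac{\check u-\check u^3}\varepsilon-\varkappa\check\theta\big)$, respectively.) **Theorem.** Assume: 1. $\hat q$ is a solution, with zero initial condition and zero boundary conditions (Dirichlet at both ends or Neumann at both ends), of the equation, understood in the weak sense, $$L(q+eI)=F_1+e\,\frac{\partial^2\Pi}{\partial x^2}\,B(\tau)[H(x-\varphi_1)-H(x-\varphi_2)]+e\,\frac{\partial^2\hat\Pi}{\partial x^2}\,(1-B(\tau))[H(x-\varphi_2)-H(x-\varphi_1)],$$ where $F_1=-e\,S_t+2e'S_x+e''S$, $S=\check T-I$, the derivatives of $S$ being taken pointwise off $x=\varphi_i$ (so that the right-hand side is $-L(eS)$ off $x=\varphi_i$); 2. $\displaystyle\sum_{i=1}^2\{B[\gamma_i^++\gamma_i^-]-A_i\}\,\delta(x-\varphi_i)=O_{\mathcal D'}(\varepsilon)$; 3. $\beta^2=\hat D/\hat C$ (at $\eta=\beta\rho$, for all $t\in[0,t_1]$ and all $\varepsilon$); 4. $V_1^1\delta(x-\varphi_1)+V_2^1\delta(x-\varphi_2)=O_{\mathcal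 D'}(\varepsilon)$. Then $(\check u,\check\theta)$ is a weak asymptotic solution of the phase field system. -/

import Mathlib

open Set MeasureTheory Filter Topology
open scoped ContDiff

namespace PhaseField

/-- Test functions: smooth functions with compact support in the open interval `(l₁, l₂)`. -/
def IsTest (l₁ l₂ : ℝ) (ζ : ℝ → ℝ) : Prop :=
  ContDiff ℝ ∞ ζ ∧ tsupport ζ ⊆ Ioo l₁ l₂

/-- `R ε t = O(ε ^ ν)` as `ε → 0+`, uniformly in `t ∈ [0, t₁]`. -/
def UnifO (t₁ ν : ℝ) (R : ℝ → ℝ → ℝ) : Prop :=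
  ∃ C : ℝ, ∃ ε₁ : ℝ, 0 < ε₁ ∧ ∀ ε ∈ Ioo 0 ε₁, ∀ t ∈ Icc 0 t₁, |R ε t| ≤ C * ε ^ ν

/-- The double-well potential. -/
noncomputable def wellF (v : ℝ) : ℝ := v ^ 4 / 4 - v ^ 2 / 2 + 1 / 4

/-- The Heaviside function. -/
noncomputable def heav (y : ℝ) : ℝ := if 0 < y then 1 else 0

/-- Weak asymptotic solution of the phase field system on `[l₁, l₂] × [0, t₁]`; a family is written
`u ε t x`, `0 < ε < ε₀`. The order function `u` is smooth. The temperature `θ` is only required to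
be continuous, absolutely continuous in `x`, and differentiable in `t` as a distribution in `x`
(for smooth `θ` the latter is the classical time derivative), because the temperatures built
below have kinks on the free boundaries. -/
structure IsWeakAsymptoticSolution (l₁ l₂ t₁ ε₀ ϰ : ℝ) (u θ : ℝ → ℝ → ℝ → ℝ) : Prop where
  smooth_u : ∀ ε ∈ Ioo 0 ε₀,
    ContDiffOn ℝ ∞ (fun p : ℝ × ℝ => u ε p.1 p.2) (Icc 0 t₁ ×ˢ Icc l₁ l₂)
  continuous_θ : ∀ ε ∈ Ioo 0 ε₀,
    ContinuousOn (fun p : ℝ × ℝ => θ ε p.1 p.2) (Icc 0 t₁ ×ˢ Icc l₁ l₂)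
  absCont_θ : ∀ ε ∈ Ioo 0 ε₀, ∀ t ∈ Icc 0 t₁, AbsolutelyContinuousOnInterval (θ ε t) l₁ l₂
  differentiable_θ : ∀ ζ, IsTest l₁ l₂ ζ → ∀ ε ∈ Ioo 0 ε₀,
    DifferentiableOn ℝ (fun s => ∫ x in l₁..l₂, θ ε s x * ζ x) (Icc 0 t₁)
  /-- `∫ (u_t + θ_t) ζ dx + ∫ θ_x ζ_x dx = O(ε)` -/
  heat : ∀ ζ, IsTest l₁ l₂ ζ → UnifO t₁ 1 (fun ε t =>
    (∫ x in l₁..l₂, derivWithin (fun s => u ε s x) (Icc 0 t₁) t * ζ x)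
      + derivWithin (fun s => ∫ x in l₁..l₂, θ ε s x * ζ x) (Icc 0 t₁) t
      + ∫ x in l₁..l₂, deriv (θ ε t) x * deriv ζ x)
  /-- the Allen-Cahn relation, with remainder `O(ε ^ μ)` for every `μ ∈ (0, 1/2)` -/
  allenCahn : ∀ ξ, IsTest l₁ l₂ ξ → ∀ μ ∈ Ioo (0 : ℝ) (1 / 2), UnifO t₁ μ (fun ε t =>
    ε * (∫ x in l₁..l₂, derivWithin (fun s => u ε s x) (Icc 0 t₁) t * deriv (u ε t) x * ξ x)
      + ε / 2 * (∫ x in l₁..l₂, deriv (u ε t) x ^ 2 * deriv ξ x)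
      - 1 / ε * (∫ x in l₁..l₂, wellF (u ε t x) * deriv ξ x)
      + ϰ * ∫ x in l₁..l₂, u ε t x * deriv (fun y => θ ε t y * ξ y) x)

/-! ### The integrals entering the coefficients -/

/-- `Ω(z, η) = (1 + ω₀(z) + ω₀(-z-η) - ω₀(z) ω₀(-z-η)) / 2`, `ω₀ = tanh`. -/
noncomputable def Om (z η : ℝ) : ℝ :=
  (1 + Real.tanh z + Real.tanh (-z - η) - Real.tanh z * Real.tanh (-z - η)) / 2

/-- `∂Ω/∂z` -/
noncomputable def OmZ (z η : ℝ) : ℝ := deriv (fun w => Om w η) z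

/-- `∂Ω/∂η` -/
noncomputable def OmE (z η : ℝ) : ℝ := deriv (fun h => Om z h) η

noncomputable def B00 (η : ℝ) : ℝ := ∫ z : ℝ, deriv Real.tanh z * Real.tanh (-η - z)

noncomputable def Bz00 (η : ℝ) : ℝ := ∫ z : ℝ, z * deriv Real.tanh z * Real.tanh (-η - z)

noncomputable def BOm (η : ℝ) : ℝ := ∫ z : ℝ, OmZ z η * (OmZ z η - OmE z η)

noncomputable def BzOm (η : ℝ) : ℝ :=
  ∫ z : ℝ, (z * (OmZ z η - OmE z η) - (z + η) * OmE z η) * (OmZ z η - OmE z η)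

noncomputable def COm (η : ℝ) : ℝ := ∫ z : ℝ, (OmZ z η - OmE z η)

noncomputable def Chat (η : ℝ) : ℝ := 1 / 4 * ∫ z : ℝ, OmZ z η ^ 2

noncomputable def Dhat (η : ℝ) : ℝ := 1 / 2 * ∫ z : ℝ, wellF (Om z η)

/-! ### The ansatz -/

/-- The data of the ansatz. The index `i : Fin 2` is `0` for the left and `1` for the right free
boundary. Families depending on the small parameter are written `f ε t x`. -/
structure Ansatz where
  /-- left end of the space interval -/
  l₁ : ℝ
  /-- right end of the space interval -/
  l₂ : ℝ
  /-- final time -/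
  t₁ : ℝ
  /-- the small parameter ranges over `(0, ε₀)` -/
  ε₀ : ℝ
  /-- `φ_{i0}(t)` -/
  φ0 : Fin 2 → ℝ → ℝ
  /-- `φ_{i1}(τ, t)` -/
  φ1 : Fin 2 → ℝ → ℝ → ℝ
  /-- `β(τ)` -/
  β : ℝ → ℝ
  /-- `B(τ)` -/
  B : ℝ → ℝ
  /-- `γ_i⁻(t)`, minus the slope of the temperature on the left of the `i`th free boundary -/
  γm : Fin 2 → ℝ → ℝ
  /-- `γ_i⁺(t)`, the slope of the temperature on the right of the `i`th free boundary -/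
  γp : Fin 2 → ℝ → ℝ
  /-- the cut-off function `e(x)` -/
  e : ℝ → ℝ
  /-- minus the slope in `x` of the linear function `I` -/
  κ : ℝ → ℝ → ℝ
  /-- the known part `q̌` of the temperature -/
  qc : ℝ → ℝ → ℝ → ℝ
  /-- the unknown part `q̂` of the temperature -/
  qh : ℝ → ℝ → ℝ → ℝ

namespace Ansatz

variable (A : Ansatz)

noncomputable def ψ0 (t : ℝ) : ℝ := A.φ0 1 t - A.φ0 0 t

noncomputable def τ (ε t : ℝ) : ℝ := A.ψ0 t / ε

noncomputable def φ (i : Fin 2) (ε t : ℝ) : ℝ := A.φ0 i t + A.ψ0 t * A.φ1 i (A.τ ε t) t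

/-- `∂φ_i/∂t` -/
noncomputable def φt (i : Fin 2) (ε t : ℝ) : ℝ := deriv (fun s => A.φ i ε s) t

noncomputable def ψ (ε t : ℝ) : ℝ := A.φ 1 ε t - A.φ 0 ε t

noncomputable def ρ (ε t : ℝ) : ℝ := A.ψ ε t / ε

noncomputable def η (ε t : ℝ) : ℝ := A.β (A.τ ε t) * A.ρ ε t

noncomputable def mid (ε t : ℝ) : ℝ := (A.φ 0 ε t + A.φ 1 ε t) / 2

/-- The order function `ǔ`. -/
noncomputable def u (ε t x : ℝ) : ℝ :=
  (1 + Real.tanh (A.β (A.τ ε t) * (A.φ 0 ε t - x) / ε)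
    + Real.tanh (A.β (A.τ ε t) * (x - A.φ 1 ε t) / ε)
    - Real.tanh (A.β (A.τ ε t) * (A.φ 0 ε t - x) / ε)
      * Real.tanh (A.β (A.τ ε t) * (x - A.φ 1 ε t) / ε)) / 2

/-- `γ⁻(x,t) (φ₁ - x)(x - φ₂)/ψ`, where `γ⁻` is linear in `x` with the values `γ₁⁺` at `φ₁` and
`γ₂⁻` at `φ₂`. -/
noncomputable def Pin (ε t x : ℝ) : ℝ :=
  ((A.γp 0 t + A.γm 1 t) / 2 - (x - A.mid ε t) * (A.γp 0 t - A.γm 1 t) / A.ψ ε t)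
    * ((A.φ 0 ε t - x) * (x - A.φ 1 ε t) / A.ψ ε t)

/-- `γ̂(x,t) (φ₁ - x)(x - φ₂)/ψ`, where `γ̂` is linear in `x` with the values `γ₁⁻` at `φ₁` and
`γ₂⁺` at `φ₂`. -/
noncomputable def Phat (ε t x : ℝ) : ℝ :=
  ((A.γm 0 t + A.γp 1 t) / 2 - (x - A.mid ε t) * (A.γm 0 t - A.γp 1 t) / A.ψ ε t)
    * ((A.φ 0 ε t - x) * (x - A.φ 1 ε t) / A.ψ ε t)

/-- The function `I`, linear in `x`; under `IsAdmissible.slope_I` its values at `φ₁`, `φ₂` are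
`∂φ₁/∂t` and `-∂φ₂/∂t`. -/
noncomputable def I (ε t x : ℝ) : ℝ :=
  (A.φt 0 ε t - A.φt 1 ε t) / 2 - (x - A.mid ε t) * A.κ ε t

/-- The temperature model without the summand `I`, i.e. `Ť - I`. -/
noncomputable def S (ε t x : ℝ) : ℝ :=
  A.γm 0 t * (A.φ 0 ε t - x) * heav (A.φ 0 ε t - x)
    + A.γp 1 t * (x - A.φ 1 ε t) * heav (x - A.φ 1 ε t)
    + A.Pin ε t x * A.B (A.τ ε t) * (heav (x - A.φ 0 ε t) - heav (x - A.φ 1 ε t))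
    + A.Phat ε t x * (1 - A.B (A.τ ε t)) * (heav (x - A.φ 1 ε t) - heav (x - A.φ 0 ε t))

/-- The temperature model `Ť`. -/
noncomputable def T (ε t x : ℝ) : ℝ := A.S ε t x + A.I ε t x

/-- The global temperature `θ̌ = e Ť + q̌ + q̂`. -/
noncomputable def θ (ε t x : ℝ) : ℝ := A.e x * A.T ε t x + A.qc ε t x + A.qh ε t x

/-- `q + e I`, `q = q̌ + q̂`. -/
noncomputable def qeI (ε t x : ℝ) : ℝ := A.qc ε t x + A.qh ε t x + A.e x * A.I ε t x

/-- The piecewise continuous part `F` of the right-hand side of the equation for `q + e I`. -/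
noncomputable def Freg (ε t x : ℝ) : ℝ :=
  -A.e x * deriv (fun s => A.S ε s x) t
    + 2 * deriv A.e x * deriv (fun y => A.S ε t y) x
    + deriv (deriv A.e) x * A.S ε t x

/-- The right-hand side of the equation for `q + e I`: at all points off the free boundaries where
`ψ ≠ 0` it is `-(∂_t - ∂_x²)(e (Ť - I))`. -/
noncomputable def rhs (ε t x : ℝ) : ℝ :=
  A.Freg ε t x
    + A.e x * deriv (deriv (fun y => A.Pin ε t y)) x * A.B (A.τ ε t)
        * (heav (x - A.φ 0 ε t) - heav (x - A.φ 1 ε t))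
    + A.e x * deriv (deriv (fun y => A.Phat ε t y)) x * (1 - A.B (A.τ ε t))
        * (heav (x - A.φ 1 ε t) - heav (x - A.φ 0 ε t))

/-- The coefficients `A_i` of the delta functions `δ(x - φ_i)` in `∂ǔ/∂t`. -/
noncomputable def coefA (i : Fin 2) (ε t : ℝ) : ℝ :=
  (-1) ^ (i : ℕ) * (A.φt i ε t / 2) * (2 - B00 (A.η ε t))
    - deriv A.β (A.τ ε t) * deriv A.ψ0 t / (2 * A.β (A.τ ε t) ^ 2) * Bz00 (A.η ε t)

/-- The coefficients `V_i¹` of the delta functions `δ(x - φ_i)` in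
`ǔ_x (ε L ǔ - (ǔ - ǔ³)/ε - ϰ θ̌)`. -/
noncomputable def coefV (ϰ : ℝ) (i : Fin 2) (ε t : ℝ) : ℝ :=
  -A.β (A.τ ε t) * (A.φt i ε t * BOm (A.η ε t)
      + (-1) ^ (i : ℕ) * (deriv A.β (A.τ ε t) * deriv A.ψ0 t / A.β (A.τ ε t) ^ 2)
        * BzOm (A.η ε t))
    + (-1) ^ (i : ℕ) * ϰ * A.qeI ε t (A.φ i ε t) * COm (A.η ε t)

/-- Standing assumptions on the known ingredients of the ansatz. -/
structure IsAdmissible : Prop where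
  l₁_lt_l₂ : A.l₁ < A.l₂
  t₁_pos : 0 < A.t₁
  ε₀_pos : 0 < A.ε₀
  smooth_φ0 : ∀ i, ContDiff ℝ ∞ (A.φ0 i)
  smooth_φ1 : ∀ i, ContDiff ℝ ∞ (fun p : ℝ × ℝ => A.φ1 i p.1 p.2)
  /-- the free boundaries are apart at the initial time -/
  apart : A.φ0 0 0 < A.φ0 1 0
  /-- behaviour of `φ_{i1}` as `τ → ±∞`, uniformly in `t` -/
  decay_φ1 : ∃ K : ℝ, ∃ φlim : Fin 2 → ℝ → ℝ, ∀ i, ∀ t ∈ Icc 0 A.t₁, ∀ s : ℝ,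
    (1 ≤ s → |A.φ1 i s t| ≤ K / s)
      ∧ (s ≤ -1 → |A.φ1 i s t - φlim i t| ≤ K / |s|)
      ∧ (1 ≤ |s| → |deriv (fun r => A.φ1 i r t) s| ≤ K / |s|)
      ∧ |deriv (fun r => A.φ1 i s r) t| ≤ K
  smooth_β : ContDiff ℝ ∞ A.β
  bounds_β : ∃ δ₁ δ₂ : ℝ, 0 < δ₁ ∧ ∀ s, δ₁ < A.β s ∧ A.β s < δ₂
  decay_β : ∃ K : ℝ, ∀ s : ℝ, 1 ≤ |s| → |deriv A.β s| ≤ K / |s|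
  smooth_B : ContDiff ℝ ∞ A.B
  B_top : Tendsto A.B atTop (𝓝 1)
  B_bot : Tendsto A.B atBot (𝓝 0)
  decay_B : ∀ n N : ℕ, 1 ≤ n → ∃ C : ℝ, ∀ s : ℝ, |s| ^ N * |iteratedDeriv n A.B s| ≤ C
  smooth_γm : ∀ i, ContDiff ℝ 1 (A.γm i)
  smooth_γp : ∀ i, ContDiff ℝ 1 (A.γp i)
  test_e : IsTest A.l₁ A.l₂ A.e
  e_eq_one : ∀ ε ∈ Ioo 0 A.ε₀, ∀ t ∈ Icc 0 A.t₁, ∀ x ∈ uIcc (A.φ 0 ε t) (A.φ 1 ε t), A.e x = 1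
  /-- the free boundaries meet only at exceptional instants -/
  zeros_ψ : ∀ ε ∈ Ioo 0 A.ε₀, {t ∈ Icc 0 A.t₁ | A.ψ ε t = 0}.Countable
  /-- `I` takes the values `∂φ₁/∂t` at `φ₁` and `-∂φ₂/∂t` at `φ₂`, and is continuous in `t` -/
  slope_I : ∀ ε ∈ Ioo 0 A.ε₀, ∀ t ∈ Icc 0 A.t₁, A.ψ ε t * A.κ ε t = A.φt 0 ε t + A.φt 1 ε t
  continuous_κ : ∀ ε ∈ Ioo 0 A.ε₀, ContinuousOn (A.κ ε) (Icc 0 A.t₁)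
  smooth_qc : ∀ ε ∈ Ioo 0 A.ε₀, ∀ t ∈ Icc 0 A.t₁, ContDiff ℝ 1 (A.qc ε t)
  /-- `q̌`, `∂q̌/∂x` are bounded and Lipschitz in `t`, respectively in `x`, uniformly in `ε` -/
  bounds_qc : ∃ K : ℝ, ∀ ε ∈ Ioo 0 A.ε₀, ∀ t ∈ Icc 0 A.t₁, ∀ x ∈ Icc A.l₁ A.l₂,
    |A.qc ε t x| ≤ K ∧ |deriv (A.qc ε t) x| ≤ K
      ∧ (∀ s ∈ Icc 0 A.t₁, |A.qc ε t x - A.qc ε s x| ≤ K * |t - s|)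
      ∧ (∀ y ∈ Icc A.l₁ A.l₂, |deriv (A.qc ε t) x - deriv (A.qc ε t) y| ≤ K * |x - y|)

/-- The type of the boundary conditions at `x = l₁` and `x = l₂`. -/
inductive BoundaryCondition
  | dirichlet
  | neumann

/-- `q̂` solves the problem `(∂_t - ∂_x²)(q + e I) = rhs`, `q = q̌ + q̂`, with zero initial and
zero boundary conditions. The equation is understood weakly, integrated in time; the
boundary terms are those of `q̌` (they vanish in the Dirichlet case, where the test functions vanish
at the ends; in the Neumann case the identity contains the condition `∂q̂/∂x = 0` at the
ends, since `e` vanishes there). -/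
structure SolvesHeat (bc : BoundaryCondition) : Prop where
  continuous_qh : ∀ ε ∈ Ioo 0 A.ε₀,
    ContinuousOn (fun p : ℝ × ℝ => A.qh ε p.1 p.2) (Icc 0 A.t₁ ×ˢ Icc A.l₁ A.l₂)
  absCont_qh : ∀ ε ∈ Ioo 0 A.ε₀, ∀ t ∈ Icc 0 A.t₁,
    AbsolutelyContinuousOnInterval (A.qh ε t) A.l₁ A.l₂
  initial : ∀ ε ∈ Ioo 0 A.ε₀, ∀ x ∈ Icc A.l₁ A.l₂, A.qh ε 0 x = 0
  boundary : bc = BoundaryCondition.dirichlet → ∀ ε ∈ Ioo 0 A.ε₀, ∀ t ∈ Icc 0 A.t₁,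
    A.qh ε t A.l₁ = 0 ∧ A.qh ε t A.l₂ = 0
  equation : ∀ ε ∈ Ioo 0 A.ε₀, ∀ χ : ℝ → ℝ, ContDiff ℝ ∞ χ →
    (bc = BoundaryCondition.dirichlet → χ A.l₁ = 0 ∧ χ A.l₂ = 0) → ∀ t ∈ Icc 0 A.t₁,
    (∫ x in A.l₁..A.l₂, A.qeI ε t x * χ x) - (∫ x in A.l₁..A.l₂, A.qeI ε 0 x * χ x)
      = ∫ s in (0 : ℝ)..t,
          (deriv (A.qc ε s) A.l₂ * χ A.l₂ - deriv (A.qc ε s) A.l₁ * χ A.l₁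
            - (∫ x in A.l₁..A.l₂, deriv (A.qeI ε s) x * deriv χ x)
            + ∫ x in A.l₁..A.l₂, A.rhs ε s x * χ x)

end Ansatz

end PhaseField

/-! In the layer variables `z = β (φ 0 - x) / ε` and `w = β (x - φ 1) / ε` the order function is a
fixed profile, symmetric in `z` and `w`, and `z + w = -η` does not depend on `x`. The densities
built from `ǔ_t` and `ǔ_x` split into a kernel decaying exponentially in `z` and one decaying
exponentially in `w`, uniformly in the other variable. The expansions therefore hold whether the
layers are apart, overlapping or crossed. Such a kernel acts on a Hölder function as its mass times
a delta function (`Localized.pair`), and the masses are the coefficients of the statement. This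
gives `pairing_u_t`, `pairing_u_t_mul_u_x` and `pairing_energy`; in the last one the masses vanish
because `β² = D̂/Ĉ`.

Heat relation. The source in the equation for `q + e I` is `-L(e S)` off the free boundaries. Adding
`e S` leaves for the whole temperature a heat equation whose only sources are the kinks of `S`, with
masses `B (γ⁺ + γ⁻)` (`derivWithin_θ_add`). Collisions of the boundaries do no harm: they occur at
countably many times, and `S`, rewritten without division by `ψ` (`S_eq_wedge`), is locally
Lipschitz through them. Condition 2 balances the kinks against the deltas `A_i` of `ǔ_t`.

Allen-Cahn relation. The temperature term becomes `-ϰ ∫ ǔ_x θ̌ ξ`, and its expansion with error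
`ε^{1/2}` needs `θ̌` to be Hölder of exponent `1/2` in `x`, uniformly in `ε` and `t`
(`exists_holder_θ`). The equation for `q̂` itself has sources of size `1/ψ`, but the temperature as
a whole has only bounded point sources. Its sine or cosine coefficients hence satisfy `c' + λ c =
O(1)` in integrated form, after `q̌` has been split off. A comparison argument gives `|c(t)| ≤
|c(0)| + M/λ` (`exists_abs_coeff_le`), and `c(0) = O(1/λ)` because the boundaries are initially
apart (`exists_initial_bound`). Coefficients of size `n⁻²` give the Hölder bound
(`holder_of_coeff`).

It remains to replace `θ̌` at `φ i` by `q + e I`. The difference `S` is nonzero there only after a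
crossing, and then the mass of `ǔ_x` in each layer decays like `1/|η|`, so that the product is
`O(ε)` (`abs_COm_mul_S_le`). Condition 4 removes the remaining deltas. -/

namespace PhaseField

/-! ### Estimates for `tanh` -/

theorem hasDerivAt_tanh (z : ℝ) : HasDerivAt Real.tanh (1 - Real.tanh z ^ 2) z := by
  have h : Real.tanh = fun x => Real.sinh x / Real.cosh x := by
    ext x; exact Real.tanh_eq_sinh_div_cosh x
  have hc := (Real.cosh_pos z).ne'
  rw [h]
  convert! (Real.hasDerivAt_sinh z).div (Real.hasDerivAt_cosh z) hc using 1
  field_simp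

theorem deriv_tanh (z : ℝ) : deriv Real.tanh z = 1 - Real.tanh z ^ 2 := (hasDerivAt_tanh z).deriv

theorem contDiff_tanh {n : WithTop ℕ∞} : ContDiff ℝ n Real.tanh := by
  have h : Real.tanh = fun x => Real.sinh x / Real.cosh x := by
    ext x; exact Real.tanh_eq_sinh_div_cosh x
  rw [h]
  exact Real.contDiff_sinh.div Real.contDiff_cosh fun x => (Real.cosh_pos x).ne'

theorem continuous_tanh : Continuous Real.tanh := (contDiff_tanh (n := 0)).continuous

theorem one_sub_tanh_sq_nonneg (z : ℝ) : 0 ≤ 1 - Real.tanh z ^ 2 := by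
  linarith [Real.tanh_sq_lt_one z]

/-- `1 - tanh² = 1/cosh²` and `2 cosh z ≥ e^{|z|}`. The rate `2` leaves room for a factor `|z|` when
kernels are later measured against `e^{-|z|}`. -/
theorem one_sub_tanh_sq_le (z : ℝ) : 1 - Real.tanh z ^ 2 ≤ 4 * Real.exp (-2 * |z|) := by
  have hc := Real.cosh_pos z
  have h1 : 1 - Real.tanh z ^ 2 = 1 / Real.cosh z ^ 2 := by
    rw [Real.tanh_eq_sinh_div_cosh]
    have := Real.cosh_sq z
    field_simp
    linarith
  have h2 : Real.exp |z| ≤ 2 * Real.cosh z := by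
    rw [← Real.cosh_abs, Real.cosh_eq]
    linarith [Real.exp_pos (-|z|)]
  have h3 : Real.exp (-2 * |z|) = 1 / Real.exp |z| ^ 2 := by
    rw [← Real.exp_nat_mul, one_div, ← Real.exp_neg]
    norm_num
  rw [h1, h3, mul_one_div, div_le_div_iff₀ (by positivity) (by positivity)]
  nlinarith [Real.exp_pos |z|]

theorem exp_neg_two_mul_abs_le (z : ℝ) : Real.exp (-2 * |z|) ≤ Real.exp (-|z|) :=
  Real.exp_le_exp.2 (by linarith [abs_nonneg z])

theorem abs_mul_exp_neg_two_mul_abs_le (z : ℝ) :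
    |z| * Real.exp (-2 * |z|) ≤ Real.exp (-|z|) := by
  have h : Real.exp (-2 * |z|) = Real.exp (-|z|) * Real.exp (-|z|) := by
    rw [← Real.exp_add]; ring_nf
  have h1 : |z| * Real.exp (-|z|) ≤ 1 := by
    rw [Real.exp_neg, ← div_eq_mul_inv, div_le_one (Real.exp_pos _)]
    linarith [Real.add_one_le_exp |z|]
  rw [h]
  nlinarith [Real.exp_pos (-|z|)]

/-- For `w ≥ 0` the exponential decay of `1 - tanh w` beats `w`; for `w ≤ 0` that factor is only
bounded by `2`, hence the growing term. Needed for crossed layers in `abs_mul_mass_dU_le`. -/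
theorem mul_one_sub_tanh_le (w : ℝ) : |w| * (1 - Real.tanh w) ≤ 1 + 2 * max (-w) 0 := by
  rcases le_total 0 w with hw | hw
  · have h1 : 1 - Real.tanh w = 2 / (1 + Real.exp (2 * w)) := by
      rw [Real.tanh_eq]
      have : Real.exp (2 * w) = Real.exp w / Real.exp (-w) := by
        rw [← Real.exp_sub]; ring_nf
      rw [this]
      have := Real.exp_pos w
      have := Real.exp_pos (-w)
      field_simp
      ring
    rw [h1, abs_of_nonneg hw, max_eq_right (by linarith), ← mul_div_assoc,
      div_le_iff₀ (by positivity)]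
    linarith [Real.add_one_le_exp (2 * w)]
  · rw [abs_of_nonpos hw, max_eq_left (by linarith)]
    nlinarith [Real.neg_one_lt_tanh w]

/-- Comparison with `6 / (1 + z²)`: the cubic `(1 + |z|)(1 + z²)` is at most six times the cubic
Taylor polynomial of `e^{|z|}`. -/
theorem integrable_abs_mul_exp :
    Integrable (fun z : ℝ => (1 + |z|) * Real.exp (-|z|)) := by
  refine (integrable_inv_one_add_sq.const_mul 6).mono' (by fun_prop) (Eventually.of_forall ?_)
  intro z
  rw [Real.norm_of_nonneg (by positivity), Real.exp_neg, ← div_eq_mul_inv, ← div_eq_mul_inv,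
    div_le_div_iff₀ (Real.exp_pos _) (by positivity), ← sq_abs z]
  have h := Real.sum_le_exp_of_nonneg (abs_nonneg z) 4
  simp only [Finset.sum_range_succ, Finset.sum_range_zero, Nat.factorial] at h
  norm_num at h
  have h0 := abs_nonneg z
  have h1 := sq_abs z
  have h2 : (0 : ℝ) ≤ |z| ^ 2 := by positivity
  have h3 : (1 + |z|) * (1 + |z| ^ 2) = 1 + |z| + |z| ^ 2 + |z| ^ 3 := by ring
  linarith

theorem integrable_exp_neg_abs : Integrable (fun z : ℝ => Real.exp (-|z|)) := by
  refine integrable_abs_mul_exp.mono' (by fun_prop) (Eventually.of_forall ?_)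
  intro z
  rw [Real.norm_of_nonneg (by positivity)]
  nlinarith [abs_nonneg z, Real.exp_pos (-|z|)]

/-- The total mass of the weight that dominates localized kernels. -/
noncomputable def expMass : ℝ := ∫ z : ℝ, (1 + |z|) * Real.exp (-|z|)

theorem expMass_nonneg : 0 ≤ expMass := integral_nonneg fun _ => by positivity

/-! ### Localized kernels -/

/-- The kernel `k(z, w)` is continuous and decays exponentially in its first variable. -/
structure Localized (k : ℝ → ℝ → ℝ) (C : ℝ) : Prop where
  cont : Continuous fun p : ℝ × ℝ => k p.1 p.2
  bound : ∀ z w, |k z w| ≤ C * Real.exp (-|z|)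

/-- The mass of a kernel along the line `z + w = -η`. -/
noncomputable def mass (k : ℝ → ℝ → ℝ) (η : ℝ) : ℝ := ∫ z : ℝ, k z (-z - η)

namespace Localized

variable {k k' : ℝ → ℝ → ℝ} {C C' : ℝ}

theorem const_nonneg (hk : Localized k C) : 0 ≤ C := by
  have := hk.bound 0 0
  simp only [abs_zero, neg_zero, Real.exp_zero, mul_one] at this
  exact (abs_nonneg _).trans this

theorem continuous_line (hk : Localized k C) (η : ℝ) : Continuous fun z => k z (-z - η) :=
  hk.cont.comp (by fun_prop : Continuous fun z : ℝ => (z, -z - η))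

theorem integrable (hk : Localized k C) (η : ℝ) : Integrable fun z => k z (-z - η) :=
  (integrable_exp_neg_abs.const_mul C).mono' (hk.continuous_line η).aestronglyMeasurable
    (Eventually.of_forall fun _ => hk.bound _ _)

theorem abs_mass_le (hk : Localized k C) (η : ℝ) : |mass k η| ≤ C * expMass := by
  rw [expMass, ← integral_const_mul]
  rw [← Real.norm_eq_abs]
  refine norm_integral_le_of_norm_le (integrable_abs_mul_exp.const_mul C)
    (Eventually.of_forall fun z => (hk.bound z (-z - η)).trans ?_)
  have := hk.const_nonneg
  have : (0:ℝ) ≤ C * |z| * Real.exp (-|z|) := by positivity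
  linarith

theorem add (hk : Localized k C) (hk' : Localized k' C') :
    Localized (fun z w => k z w + k' z w) (C + C') :=
  ⟨hk.cont.add hk'.cont, fun z w => (abs_add_le _ _).trans (by
    linarith [hk.bound z w, hk'.bound z w])⟩

theorem const_mul (hk : Localized k C) (a : ℝ) : Localized (fun z w => a * k z w) (|a| * C) :=
  ⟨continuous_const.mul hk.cont, fun z w => by
    rw [abs_mul, mul_assoc]
    exact mul_le_mul_of_nonneg_left (hk.bound z w) (abs_nonneg a)⟩

theorem mul_bounded (hk : Localized k C) {g : ℝ → ℝ → ℝ} {K : ℝ}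
    (hg : Continuous fun p : ℝ × ℝ => g p.1 p.2) (hb : ∀ z w, |g z w| ≤ K) :
    Localized (fun z w => k z w * g z w) (C * K) :=
  ⟨hk.cont.mul hg, fun z w => by
    rw [abs_mul]
    calc |k z w| * |g z w| ≤ (C * Real.exp (-|z|)) * K :=
          mul_le_mul (hk.bound z w) (hb z w) (abs_nonneg _) ((abs_nonneg _).trans (hk.bound z w))
      _ = _ := by ring⟩

theorem mono (hk : Localized k C) (h : C ≤ C') : Localized k C' :=
  ⟨hk.cont, fun z w => (hk.bound z w).trans (by gcongr)⟩

end Localized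

theorem mass_add {k k' : ℝ → ℝ → ℝ} {C C' : ℝ} (hk : Localized k C) (hk' : Localized k' C')
    (η : ℝ) : mass (fun z w => k z w + k' z w) η = mass k η + mass k' η :=
  integral_add (hk.integrable η) (hk'.integrable η)

theorem mass_const_mul (k : ℝ → ℝ → ℝ) (a η : ℝ) :
    mass (fun z w => a * k z w) η = a * mass k η := integral_const_mul _ _

/-- The reflection `z ↦ -η - z` exchanges the two variables on the line `z + w = -η`. -/
theorem mass_swap (k : ℝ → ℝ → ℝ) (η : ℝ) : mass (fun z w => k w z) η = mass k η := by
  have h := integral_sub_left_eq_self (fun z => k z (-z - η)) volume (-η)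
  rw [mass, mass, ← h]
  congr 1; ext z
  ring_nf

/-- Rescaling of an integral around `p`. -/
theorem integral_rescale_left (g f : ℝ → ℝ) (p : ℝ) {h : ℝ} (hh : 0 < h) :
    1 / h * ∫ x, g ((p - x) / h) * f x = ∫ z, g z * f (p - h * z) := by
  have h1 := integral_sub_left_eq_self (fun x => g ((p - x) / h) * f x) volume p
  have h2 := Measure.integral_comp_div (fun z => g z * f (p - h * z)) h
  rw [abs_of_pos hh, smul_eq_mul] at h2
  rw [← h1, one_div, inv_mul_eq_iff_eq_mul₀ hh.ne', ← h2]
  congr 1; ext x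
  congr 2
  · ring_nf
  · field_simp

theorem integral_rescale_right (g f : ℝ → ℝ) (p : ℝ) {h : ℝ} (hh : 0 < h) :
    1 / h * ∫ x, g ((x - p) / h) * f x = ∫ z, g z * f (p + h * z) := by
  have h1 := integral_add_right_eq_self (μ := volume) (fun x => g ((x - p) / h) * f x) p
  have h2 := Measure.integral_comp_div (fun z => g z * f (p + h * z)) h
  rw [abs_of_pos hh, smul_eq_mul] at h2
  rw [← h1, one_div, inv_mul_eq_iff_eq_mul₀ hh.ne', ← h2]
  congr 1; ext x
  congr 2
  · ring_nf
  · field_simp; ring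

/-- The deviation of `f` near a point, against an exponentially decaying weight. -/
theorem abs_integral_sub_le {g f : ℝ → ℝ} {C D α h y : ℝ} {s : ℝ → ℝ} (hC : 0 ≤ C) (hD : 0 ≤ D)
    (hh : 0 < h) (hα0 : 0 ≤ α) (hα1 : α ≤ 1) (hg : Continuous g)
    (hgb : ∀ z, |g z| ≤ C * Real.exp (-|z|)) (hs : Measurable s) (hf : Measurable f)
    (hfb : ∀ z, |f (s z) - y| ≤ D * |h * z| ^ α) :
    |(∫ z, g z * f (s z)) - y * ∫ z, g z| ≤ C * D * expMass * h ^ α := by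
  have hgi : Integrable g := (integrable_exp_neg_abs.const_mul C).mono' hg.aestronglyMeasurable
    (Eventually.of_forall hgb)
  have hb : ∀ z, |g z * (f (s z) - y)| ≤ C * D * h ^ α * ((1 + |z|) * Real.exp (-|z|)) := by
    intro z
    have h1 : |h * z| ^ α ≤ h ^ α * (1 + |z|) := by
      rw [abs_mul, abs_of_pos hh, Real.mul_rpow hh.le (abs_nonneg z)]
      -- True for all `α ∈ [0, 1]`, so the single weight `(1 + |z|) e^{-|z|}` serves both smooth
      -- test functions and the Hölder temperature.
      have : |z| ^ α ≤ 1 + |z| := by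
        calc |z| ^ α ≤ (1 + |z|) ^ α :=
              Real.rpow_le_rpow (abs_nonneg z) (by linarith) hα0
          _ ≤ (1 + |z|) ^ (1 : ℝ) :=
              Real.rpow_le_rpow_of_exponent_le (by linarith [abs_nonneg z]) hα1
          _ = _ := Real.rpow_one _
      exact mul_le_mul_of_nonneg_left this (by positivity)
    rw [abs_mul]
    calc |g z| * |f (s z) - y| ≤ (C * Real.exp (-|z|)) * (D * (h ^ α * (1 + |z|))) :=
          mul_le_mul (hgb z) ((hfb z).trans (mul_le_mul_of_nonneg_left h1 hD)) (abs_nonneg _)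
            (by positivity)
      _ = _ := by ring
  have hint : Integrable fun z => g z * (f (s z) - y) :=
    (integrable_abs_mul_exp.const_mul _).mono'
      (hg.measurable.mul ((hf.comp hs).sub_const y)).aestronglyMeasurable
      (Eventually.of_forall hb)
  have h2 : (∫ z, g z * f (s z)) - y * ∫ z, g z = ∫ z, g z * (f (s z) - y) := by
    have h3 : ∀ z, g z * f (s z) = g z * (f (s z) - y) + y * g z := fun z => by ring
    simp_rw [h3]
    rw [integral_add hint (hgi.const_mul y), integral_const_mul]
    ring
  rw [h2]
  rw [← Real.norm_eq_abs]
  calc ‖∫ z, g z * (f (s z) - y)‖ ≤ ∫ z, C * D * h ^ α * ((1 + |z|) * Real.exp (-|z|)) :=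
        norm_integral_le_of_norm_le (integrable_abs_mul_exp.const_mul _) (Eventually.of_forall hb)
    _ = C * D * expMass * h ^ α := by rw [integral_const_mul, expMass]; ring

variable {k : ℝ → ℝ → ℝ} {C : ℝ}

/-- A kernel localized at `p` acts on Hölder continuous functions like a multiple of `δ(x - p)`. -/
theorem Localized.left (hk : Localized k C) {f : ℝ → ℝ} {p q h D α : ℝ} (hh : 0 < h) (hD : 0 ≤ D)
    (hα0 : 0 ≤ α) (hα1 : α ≤ 1) (hf : Measurable f) (hfb : ∀ x, |f x - f p| ≤ D * |x - p| ^ α) :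
    |1 / h * (∫ x, k ((p - x) / h) ((x - q) / h) * f x) - f p * mass k ((q - p) / h)|
      ≤ C * D * expMass * h ^ α := by
  have h1 := integral_rescale_left (fun z => k z (-z - (q - p) / h)) f p hh
  -- The two arguments of the kernel always add up to `-(q - p)/h`, so after rescaling the integral
  -- runs along one of the lines on which `mass` is defined.
  have h2 : ∀ x, -((p - x) / h) - (q - p) / h = (x - q) / h := fun x => by ring
  simp only [h2] at h1
  rw [h1]
  refine abs_integral_sub_le hk.const_nonneg hD hh hα0 hα1 (hk.continuous_line _)
    (fun z => hk.bound _ _) (by fun_prop) hf fun z => (hfb _).trans (le_of_eq ?_)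
  rw [show p - h * z - p = -(h * z) by ring, abs_neg]

theorem Localized.right (hk : Localized k C) {f : ℝ → ℝ} {p q h D α : ℝ} (hh : 0 < h) (hD : 0 ≤ D)
    (hα0 : 0 ≤ α) (hα1 : α ≤ 1) (hf : Measurable f) (hfb : ∀ x, |f x - f q| ≤ D * |x - q| ^ α) :
    |1 / h * (∫ x, k ((x - q) / h) ((p - x) / h) * f x) - f q * mass k ((q - p) / h)|
      ≤ C * D * expMass * h ^ α := by
  have h1 := integral_rescale_right (fun z => k z (-z - (q - p) / h)) f q hh
  have h2 : ∀ x, -((x - q) / h) - (q - p) / h = (p - x) / h := fun x => by ring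
  simp only [h2] at h1
  rw [h1]
  refine abs_integral_sub_le hk.const_nonneg hD hh hα0 hα1 (hk.continuous_line _)
    (fun z => hk.bound _ _) (by fun_prop) hf fun z => (hfb _).trans (le_of_eq ?_)
  rw [show q + h * z - q = h * z by ring]

theorem Localized.integrable_left (hk : Localized k C) {f : ℝ → ℝ} {p q h K : ℝ} (hh : 0 < h)
    (hf : Measurable f) (hfb : ∀ x, |f x| ≤ K) :
    Integrable fun x => k ((p - x) / h) ((x - q) / h) * f x := by
  have h1 : Integrable fun z => Real.exp (-|z / h|) := integrable_exp_neg_abs.comp_div hh.ne'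
  have h2 : Integrable fun x => Real.exp (-|(p - x) / h|) := h1.comp_sub_left p
  refine (h2.const_mul (C * K)).mono' ?_ (Eventually.of_forall fun x => ?_)
  · have : Continuous fun x => k ((p - x) / h) ((x - q) / h) :=
      hk.cont.comp (by fun_prop : Continuous fun x : ℝ => ((p - x) / h, (x - q) / h))
    exact (this.measurable.mul hf).aestronglyMeasurable
  · rw [norm_mul]
    have hK := hk.const_nonneg
    calc _ ≤ (C * Real.exp (-|(p - x) / h|)) * K :=
          mul_le_mul (hk.bound _ _) (hfb x) (abs_nonneg _) (by positivity)
      _ = _ := by ring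

theorem Localized.integrable_right (hk : Localized k C) {f : ℝ → ℝ} {p q h K : ℝ} (hh : 0 < h)
    (hf : Measurable f) (hfb : ∀ x, |f x| ≤ K) :
    Integrable fun x => k ((x - q) / h) ((p - x) / h) * f x := by
  have h1 : Integrable fun z => Real.exp (-|z / h|) := integrable_exp_neg_abs.comp_div hh.ne'
  have h2 : Integrable fun x => Real.exp (-|(x - q) / h|) := h1.comp_sub_right q
  refine (h2.const_mul (C * K)).mono' ?_ (Eventually.of_forall fun x => ?_)
  · have : Continuous fun x => k ((x - q) / h) ((p - x) / h) :=
      hk.cont.comp (by fun_prop : Continuous fun x : ℝ => ((x - q) / h, (p - x) / h))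
    exact (this.measurable.mul hf).aestronglyMeasurable
  · rw [norm_mul]
    have hK := hk.const_nonneg
    calc _ ≤ (C * Real.exp (-|(x - q) / h|)) * K :=
          mul_le_mul (hk.bound _ _) (hfb x) (abs_nonneg _) (by positivity)
      _ = _ := by ring

/-- Two kernels, localized at `p` and at `q`, act on Hölder continuous functions like a combination
of `δ(x - p)` and `δ(x - q)`. -/
theorem Localized.pair {k₀ k₁ : ℝ → ℝ → ℝ} {C₀ C₁ : ℝ} (hk₀ : Localized k₀ C₀)
    (hk₁ : Localized k₁ C₁) {f : ℝ → ℝ} {p q h D K α : ℝ} (hh : 0 < h) (hD : 0 ≤ D)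
    (hα0 : 0 ≤ α) (hα1 : α ≤ 1) (hf : Measurable f) (hK : ∀ x, |f x| ≤ K)
    (hp : ∀ x, |f x - f p| ≤ D * |x - p| ^ α) (hq : ∀ x, |f x - f q| ≤ D * |x - q| ^ α) :
    |1 / h * (∫ x, (k₀ ((p - x) / h) ((x - q) / h) + k₁ ((x - q) / h) ((p - x) / h)) * f x)
      - (f p * mass k₀ ((q - p) / h) + f q * mass k₁ ((q - p) / h))|
      ≤ (C₀ + C₁) * D * expMass * h ^ α := by
  have h1 := hk₀.left (q := q) hh hD hα0 hα1 hf hp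
  have h2 := hk₁.right (p := p) hh hD hα0 hα1 hf hq
  simp_rw [add_mul]
  rw [integral_add (hk₀.integrable_left hh hf hK) (hk₁.integrable_right hh hf hK)]
  rw [abs_le] at *
  constructor <;> linarith [h1.1, h1.2, h2.1, h2.2]

/-! ### The kernels of the ansatz -/

/-- Half of `tanh'(z) (1 - tanh w)`, the derivative of the profile in its first variable. -/
noncomputable def dU (z w : ℝ) : ℝ := (1 - Real.tanh z ^ 2) * (1 - Real.tanh w) / 2

/-- The profile `Ω` in symmetric variables. -/
noncomputable def profile (z w : ℝ) : ℝ :=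
  (1 + Real.tanh z + Real.tanh w - Real.tanh z * Real.tanh w) / 2

/-- The part of `1 - Ω²` that is localized in the first variable. -/
noncomputable def profileSplit (z w : ℝ) : ℝ :=
  (1 - Real.tanh z ^ 2) * ((1 - Real.tanh w) * (3 - Real.tanh w) / 8)

theorem dU_nonneg (z w : ℝ) : 0 ≤ dU z w := by
  have := one_sub_tanh_sq_nonneg z
  have := Real.tanh_lt_one w
  unfold dU
  have : 0 ≤ 1 - Real.tanh w := by linarith
  positivity

theorem dU_le_sech (z w : ℝ) : dU z w ≤ 1 - Real.tanh z ^ 2 := by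
  have := one_sub_tanh_sq_nonneg z
  have := Real.neg_one_lt_tanh w
  unfold dU
  nlinarith

theorem dU_le_one (z w : ℝ) : dU z w ≤ 1 := (dU_le_sech z w).trans (by nlinarith)

theorem continuous_dU : Continuous fun p : ℝ × ℝ => dU p.1 p.2 := by
  have := continuous_tanh
  unfold dU
  fun_prop

theorem continuous_dU_swap : Continuous fun p : ℝ × ℝ => dU p.2 p.1 := by
  have := continuous_tanh
  unfold dU
  fun_prop

theorem continuous_profile : Continuous fun p : ℝ × ℝ => profile p.1 p.2 := by
  have := continuous_tanh
  unfold profile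
  fun_prop

theorem _root_.Continuous.profile {f g : ℝ → ℝ} (hf : Continuous f) (hg : Continuous g) :
    Continuous fun x => profile (f x) (g x) := by
  have h := continuous_tanh
  have h1 := h.comp hf
  have h2 := h.comp hg
  exact (((continuous_const.add h1).add h2).sub (h1.mul h2)).div_const 2

theorem one_sub_profile (z w : ℝ) :
    1 - profile z w = (1 - Real.tanh z) * (1 - Real.tanh w) / 2 := by unfold profile; ring

theorem abs_profile_le_one (z w : ℝ) : |profile z w| ≤ 1 := by
  have h := one_sub_profile z w
  have h1 := Real.tanh_lt_one z
  have h2 := Real.tanh_lt_one w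
  have h3 := Real.neg_one_lt_tanh z
  have h4 := Real.neg_one_lt_tanh w
  rw [abs_le]
  constructor <;> nlinarith [mul_pos (sub_pos.2 h1) (sub_pos.2 h2)]

/-- The potential is `(1 - Ω²)²/4`; splitting one factor `1 - Ω²` distributes it between the two
layers. -/
theorem one_sub_profile_sq (z w : ℝ) :
    1 - profile z w ^ 2 = profileSplit z w + profileSplit w z := by
  unfold profile profileSplit; ring

theorem profile_swap (z w : ℝ) : profile w z = profile z w := by unfold profile; ring

theorem localized_dU : Localized dU 4 := by
  refine ⟨continuous_dU, fun z w => ?_⟩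
  rw [abs_of_nonneg (dU_nonneg z w)]
  have := exp_neg_two_mul_abs_le z
  linarith [dU_le_sech z w, one_sub_tanh_sq_le z]

theorem localized_mul_dU : Localized (fun z w => z * dU z w) 4 := by
  refine ⟨continuous_fst.mul continuous_dU, fun z w => ?_⟩
  rw [abs_mul, abs_of_nonneg (dU_nonneg z w)]
  have h := abs_mul_exp_neg_two_mul_abs_le z
  have h1 := (dU_le_sech z w).trans (one_sub_tanh_sq_le z)
  nlinarith [mul_le_mul_of_nonneg_left h1 (abs_nonneg z)]

theorem localized_profileSplit : Localized profileSplit 4 := by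
  constructor
  · have := continuous_tanh
    unfold profileSplit
    fun_prop
  · intro z w
    have h1 := one_sub_tanh_sq_nonneg z
    have h2 := one_sub_tanh_sq_le z
    have h3 := exp_neg_two_mul_abs_le z
    have h4 := Real.neg_one_lt_tanh w
    have h5 := Real.tanh_lt_one w
    have h6 : 0 ≤ (1 - Real.tanh w) * (3 - Real.tanh w) / 8 := by
      have : 0 ≤ 1 - Real.tanh w := by linarith
      have : 0 ≤ 3 - Real.tanh w := by linarith
      positivity
    have h7 : (1 - Real.tanh w) * (3 - Real.tanh w) / 8 ≤ 1 := by nlinarith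
    unfold profileSplit
    rw [abs_of_nonneg (mul_nonneg h1 h6)]
    nlinarith

/-- The derivative of the profile across the layer. -/
noncomputable def layerDeriv (z w : ℝ) : ℝ := dU z w - dU w z

theorem continuous_layerDeriv : Continuous fun p : ℝ × ℝ => layerDeriv p.1 p.2 :=
  continuous_dU.sub continuous_dU_swap

theorem abs_layerDeriv_le (z w : ℝ) : |layerDeriv z w| ≤ 1 := by
  unfold layerDeriv
  rw [abs_le]
  constructor <;> linarith [dU_nonneg z w, dU_nonneg w z, dU_le_one z w, dU_le_one w z]

theorem layerDeriv_swap (z w : ℝ) : layerDeriv w z = -layerDeriv z w := by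
  unfold layerDeriv; ring

/-! ### The coefficients as masses of kernels -/

theorem Om_eq (z η : ℝ) : Om z η = profile z (-z - η) := rfl

theorem hasDerivAt_profile {f g : ℝ → ℝ} {f' g' x : ℝ} (hf : HasDerivAt f f' x)
    (hg : HasDerivAt g g' x) :
    HasDerivAt (fun y => profile (f y) (g y)) (dU (f x) (g x) * f' + dU (g x) (f x) * g') x := by
  have h1 := (hasDerivAt_tanh (f x)).comp x hf
  have h2 := (hasDerivAt_tanh (g x)).comp x hg
  have h3 := (((h1.const_add 1).add h2).sub (h1.mul h2)).div_const 2
  refine h3.congr_deriv ?_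
  simp only [dU, Function.comp]
  ring

theorem OmZ_eq (z η : ℝ) : OmZ z η = layerDeriv z (-z - η) := by
  have h := hasDerivAt_profile (hasDerivAt_id z) (((hasDerivAt_id z).neg).sub_const η)
  refine (h.deriv.trans ?_)
  simp [layerDeriv]
  ring

theorem OmE_eq (z η : ℝ) : OmE z η = -dU (-z - η) z := by
  have h := hasDerivAt_profile (hasDerivAt_const η z) ((hasDerivAt_id η).const_sub (-z))
  refine (h.deriv.trans ?_)
  simp

/-- Along `w = -z - η` the `z`-derivative moves both slots of the profile and the `η`-derivative
only the second, so the difference isolates the first slot. This turns the coefficients of the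
statement into masses of localized kernels. -/
theorem OmZ_sub_OmE (z η : ℝ) : OmZ z η - OmE z η = dU z (-z - η) := by
  rw [OmZ_eq, OmE_eq, layerDeriv]; ring

theorem COm_eq (η : ℝ) : COm η = mass dU η := by simp only [COm, mass, OmZ_sub_OmE]

theorem BOm_eq (η : ℝ) : BOm η = mass (fun z w => dU z w * layerDeriv z w) η := by
  simp only [BOm, mass, OmZ_sub_OmE]
  congr 1; ext z; rw [OmZ_eq]; ring

theorem localized_sech : Localized (fun z _ => 1 - Real.tanh z ^ 2) 4 := by
  constructor
  · have := continuous_tanh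
    fun_prop
  · intro z w
    rw [abs_of_nonneg (one_sub_tanh_sq_nonneg z)]
    linarith [one_sub_tanh_sq_le z, exp_neg_two_mul_abs_le z]

theorem localized_mul_sech : Localized (fun z _ => z * (1 - Real.tanh z ^ 2)) 4 := by
  constructor
  · have := continuous_tanh
    fun_prop
  · intro z w
    rw [abs_mul, abs_of_nonneg (one_sub_tanh_sq_nonneg z)]
    nlinarith [abs_mul_exp_neg_two_mul_abs_le z,
      mul_le_mul_of_nonneg_left (one_sub_tanh_sq_le z) (abs_nonneg z)]

theorem tendsto_tanh_atTop : Tendsto Real.tanh atTop (𝓝 1) := by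
  have h : ∀ z, |Real.tanh z - 1| ≤ 2 * Real.exp (-z) := by
    intro z
    rw [abs_of_nonpos (by linarith [Real.tanh_lt_one z]), Real.tanh_eq]
    have := Real.exp_pos z
    have := Real.exp_pos (-z)
    have h1 : Real.exp z * Real.exp (-z) = 1 := by rw [← Real.exp_add]; simp
    have h2 := Real.add_one_le_exp z
    have h3 := Real.add_one_le_exp (-z)
    have h4 : -((Real.exp z - Real.exp (-z)) / (Real.exp z + Real.exp (-z)) - 1)
        = 2 * Real.exp (-z) / (Real.exp z + Real.exp (-z)) := by field_simp; ring
    rw [h4, div_le_iff₀ (by positivity)]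
    nlinarith
  rw [tendsto_iff_norm_sub_tendsto_zero]
  refine squeeze_zero (fun _ => norm_nonneg _) h ?_
  simpa using (Real.tendsto_exp_neg_atTop_nhds_zero).const_mul 2

theorem tendsto_tanh_atBot : Tendsto Real.tanh atBot (𝓝 (-1)) := by
  have := (tendsto_tanh_atTop.comp tendsto_neg_atBot_atTop).neg
  simpa [Function.comp_def] using this

theorem integral_sech : ∫ z : ℝ, (1 - Real.tanh z ^ 2) = 2 := by
  rw [integral_of_hasDerivAt_of_tendsto hasDerivAt_tanh (localized_sech.integrable 0)
    tendsto_tanh_atBot tendsto_tanh_atTop]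
  norm_num

theorem integral_mul_sech : ∫ z : ℝ, z * (1 - Real.tanh z ^ 2) = 0 := by
  have h := integral_neg_eq_self (fun z => z * (1 - Real.tanh z ^ 2)) volume
  have h2 : ∀ z : ℝ, -z * (1 - Real.tanh (-z) ^ 2) = -(z * (1 - Real.tanh z ^ 2)) := by
    intro z; rw [Real.tanh_neg]; ring
  simp only [h2, integral_neg] at h
  linarith

theorem mass_dU (η : ℝ) : mass dU η = (2 - B00 η) / 2 := by
  have h1 : Localized (fun z w => (1 - Real.tanh z ^ 2) * Real.tanh w) (4 * 1) :=
    localized_sech.mul_bounded (continuous_tanh.comp continuous_snd)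
      fun _ w => (Real.abs_tanh_lt_one w).le
  have h2 : ∀ z : ℝ, dU z (-z - η) = 1 / 2 * (1 - Real.tanh z ^ 2)
      - 1 / 2 * ((1 - Real.tanh z ^ 2) * Real.tanh (-z - η)) := by intro z; unfold dU; ring
  have h3 := integral_sub ((localized_sech.integrable η).const_mul (1 / 2))
    ((h1.integrable η).const_mul (1 / 2))
  simp only [mass, h2]
  rw [h3, integral_const_mul, integral_const_mul, integral_sech, B00]
  simp only [deriv_tanh, show ∀ z : ℝ, -η - z = -z - η from fun z => by ring]
  ring

theorem mass_mul_dU (η : ℝ) : mass (fun z w => z * dU z w) η = -Bz00 η / 2 := by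
  have h1 : Localized (fun z w => z * (1 - Real.tanh z ^ 2) * Real.tanh w) (4 * 1) :=
    localized_mul_sech.mul_bounded (continuous_tanh.comp continuous_snd)
      fun _ w => (Real.abs_tanh_lt_one w).le
  have h2 : ∀ z : ℝ, z * dU z (-z - η) = 1 / 2 * (z * (1 - Real.tanh z ^ 2))
      - 1 / 2 * (z * (1 - Real.tanh z ^ 2) * Real.tanh (-z - η)) := by intro z; unfold dU; ring
  have h3 := integral_sub ((localized_mul_sech.integrable η).const_mul (1 / 2))
    ((h1.integrable η).const_mul (1 / 2))
  simp only [mass, h2]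
  rw [h3, integral_const_mul, integral_const_mul, integral_mul_sech, Bz00]
  simp only [deriv_tanh, show ∀ z : ℝ, -η - z = -z - η from fun z => by ring]
  ring

theorem localized_dU_mul_layerDeriv : Localized (fun z w => dU z w * layerDeriv z w) 4 := by
  simpa using localized_dU.mul_bounded continuous_layerDeriv abs_layerDeriv_le

theorem localized_mul_dU_mul_layerDeriv :
    Localized (fun z w => z * dU z w * layerDeriv z w) 4 := by
  simpa using localized_mul_dU.mul_bounded continuous_layerDeriv abs_layerDeriv_le

/-- With `w = -z - η` the integrand is `(z dU(z,w) - w dU(w,z)) dU(z,w)`. It differs from the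
localized kernel by `(z - w) dU(z,w) dU(w,z)`, which is antisymmetric under `z ↔ w` and integrates
to zero. -/
theorem BzOm_eq (η : ℝ) : BzOm η = mass (fun z w => z * dU z w * layerDeriv z w) η := by
  have h0 : Localized (fun z w => z * dU z w * dU w z) (4 * 1) :=
    localized_mul_dU.mul_bounded continuous_dU_swap fun z w => by
      rw [abs_of_nonneg (dU_nonneg _ _)]; exact dU_le_one _ _
  have h1 := mass_swap (fun z w => z * dU z w * dU w z) η
  simp only [mass] at h1
  have hi := h0.integrable η
  have hi' : Integrable fun z : ℝ => (-z - η) * dU (-z - η) z * dU z (-z - η) := by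
    have := (hi.comp_sub_left (-η))
    refine this.congr (Eventually.of_forall fun z => ?_)
    ring_nf
  have h2 : ∀ z, (z * (OmZ z η - OmE z η) - (z + η) * OmE z η) * (OmZ z η - OmE z η)
      = z * dU z (-z - η) * layerDeriv z (-z - η) + (z * dU z (-z - η) * dU (-z - η) z
        - (-z - η) * dU (-z - η) z * dU z (-z - η)) := by
    intro z
    rw [OmZ_sub_OmE, OmE_eq, layerDeriv]; ring
  have h3 := integral_add (localized_mul_dU_mul_layerDeriv.integrable η) (hi.sub hi')
  simp only [Pi.sub_apply] at h3
  simp only [BzOm, h2]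
  rw [h3, integral_sub hi hi', h1, sub_self, add_zero, mass]

/-! ### Balance of the gradient energy and the potential energy -/

/-- The part of `β/2 (Ω_z)² - F(Ω)/β` localized in the first variable. -/
noncomputable def energyKernel (b z w : ℝ) : ℝ :=
  b / 2 * (dU z w * layerDeriv z w)
    + -(1 / (4 * b)) * (profileSplit z w * (1 - profile z w ^ 2))

theorem energyKernel_add_swap (b z w : ℝ) : energyKernel b z w + energyKernel b w z
    = b / 2 * layerDeriv z w ^ 2 - 1 / b * wellF (profile z w) := by
  have h1 : wellF (profile z w) = (1 - profile z w ^ 2) * (1 - profile z w ^ 2) / 4 := by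
    unfold wellF; ring
  have h2 : wellF (profile z w) = (profileSplit z w + profileSplit w z)
      * (1 - profile z w ^ 2) / 4 := by rw [h1, ← one_sub_profile_sq]
  rw [h2, energyKernel, energyKernel, profile_swap z w, layerDeriv_swap z w]
  unfold layerDeriv
  ring

theorem localized_profileSplit_mul :
    Localized (fun z w => profileSplit z w * (1 - profile z w ^ 2)) 4 := by
  have h : Localized (fun z w => profileSplit z w * (1 - profile z w ^ 2)) (4 * 1) := by
    refine localized_profileSplit.mul_bounded (continuous_const.sub (continuous_profile.pow 2)) ?_
    intro z w
    have := (sq_le_one_iff_abs_le_one _).2 (abs_profile_le_one z w)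
    rw [abs_le]
    constructor <;> nlinarith [sq_nonneg (profile z w)]
  simpa using h

theorem localized_energyKernel (b : ℝ) :
    Localized (energyKernel b) (|b / 2| * 4 + |-(1 / (4 * b))| * 4) :=
  (localized_dU_mul_layerDeriv.const_mul _).add (localized_profileSplit_mul.const_mul _)

theorem Localized.integrable_swap {k : ℝ → ℝ → ℝ} {C : ℝ} (hk : Localized k C) (η : ℝ) :
    Integrable fun z => k (-z - η) z := by
  refine ((hk.integrable η).comp_sub_left (-η)).congr (Eventually.of_forall fun z => ?_)
  ring_nf

theorem integral_add_swap {k : ℝ → ℝ → ℝ} {C : ℝ} (hk : Localized k C) (η : ℝ) :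
    ∫ z : ℝ, (k z (-z - η) + k (-z - η) z) = 2 * mass k η := by
  have h := mass_swap k η
  rw [integral_add (hk.integrable η) (hk.integrable_swap η)]
  simp only [mass] at h ⊢
  rw [h]; ring

/-- The kernel and its swap have equal masses, so each is half of the integral of `b/2 Ω_z² -
F(Ω)/b`, that is `b Ĉ - D̂/b`. -/
theorem mass_energyKernel (b η : ℝ) (hb : 0 < b) (h : b ^ 2 = Dhat η / Chat η) :
    mass (energyKernel b) η = 0 := by
  -- If `Ĉ` were zero, the quotient would be `0` by convention, against `b > 0`.
  have hC : Chat η ≠ 0 := by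
    intro h0
    rw [h0, div_zero] at h
    exact hb.ne' (pow_eq_zero_iff two_ne_zero |>.1 h)
  rw [eq_div_iff hC] at h
  have h1 : ∀ z, OmZ z η ^ 2 = dU z (-z - η) * layerDeriv z (-z - η)
      + dU (-z - η) z * layerDeriv (-z - η) z := by
    intro z
    rw [OmZ_eq, layerDeriv, layerDeriv]; ring
  have h2 : ∀ z, wellF (Om z η) = 1 / 4 * (profileSplit z (-z - η) * (1 - profile z (-z - η) ^ 2)
      + profileSplit (-z - η) z * (1 - profile (-z - η) z ^ 2)) := by
    intro z
    have h1 : wellF (Om z η) = (1 - profile z (-z - η) ^ 2) * (1 - profile z (-z - η) ^ 2) / 4 := by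
      rw [Om_eq]; unfold wellF; ring
    rw [h1, profile_swap z]
    nth_rewrite 1 [one_sub_profile_sq]
    ring
  have h3 : Chat η = 1 / 2 * mass (fun z w => dU z w * layerDeriv z w) η := by
    have := integral_add_swap localized_dU_mul_layerDeriv η
    simp only [Chat, h1]
    rw [this]; ring
  have h4 : Dhat η = 1 / 4 * mass (fun z w => profileSplit z w * (1 - profile z w ^ 2)) η := by
    have := integral_add_swap localized_profileSplit_mul η
    simp only [Dhat, h2]
    rw [integral_const_mul, this]; ring
  have h5 : mass (energyKernel b) η = b / 2 * mass (fun z w => dU z w * layerDeriv z w) η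
      + -(1 / (4 * b)) * mass (fun z w => profileSplit z w * (1 - profile z w ^ 2)) η := by
    rw [← mass_const_mul, ← mass_const_mul]
    exact mass_add (localized_dU_mul_layerDeriv.const_mul _)
      (localized_profileSplit_mul.const_mul _) η
  rw [h5]
  rw [h3, h4] at h
  field_simp
  linarith

/-- When the layers have passed through each other the total variation of the profile is small. -/
theorem abs_mul_mass_dU_le {η : ℝ} (hη : η ≤ 0) : |η * mass dU η| ≤ 20 * expMass := by
  -- On the line `-η = z + w`, so it is enough to bound `|z| dU` and `|w| dU`. Here `η` is a
  -- parameter and the kernel ignores its second variable.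
  have hb : Localized (fun z w => -η * dU z (-z - η)) 20 := by
    constructor
    · have : Continuous fun p : ℝ × ℝ => dU p.1 (-p.1 - η) :=
        (localized_dU.continuous_line η).comp continuous_fst
      exact continuous_const.mul this
    · intro z _
      have h0 := dU_nonneg z (-z - η)
      rw [abs_of_nonneg (mul_nonneg (by linarith) h0)]
      set w := -z - η with hw
      have h1 := (localized_mul_dU).bound z w
      rw [abs_mul, abs_of_nonneg h0] at h1
      have h2 := mul_one_sub_tanh_le w
      -- The place where `η ≤ 0` enters: `-w = z + η ≤ |z|`, so the growth in `-w` is absorbed by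
      -- the decay in `z`.
      have h3 : max (-w) 0 ≤ |z| := by
        rcases le_total (-w) 0 with h | h
        · rw [max_eq_right h]; positivity
        · rw [max_eq_left h]; linarith [le_abs_self z]
      have h4 := one_sub_tanh_sq_nonneg z
      have h5 := localized_mul_sech.bound z 0
      have h6 := localized_sech.bound z 0
      rw [abs_mul, abs_of_nonneg h4] at h5
      rw [abs_of_nonneg h4] at h6
      have h7 : |w| * dU z w ≤ (1 - Real.tanh z ^ 2) * ((1 + 2 * |z|) / 2) := by
        have : |w| * dU z w = (1 - Real.tanh z ^ 2) * (|w| * (1 - Real.tanh w) / 2) := by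
          unfold dU; ring
        rw [this]
        exact mul_le_mul_of_nonneg_left (by linarith) h4
      have h8 : -η * dU z w ≤ |z| * dU z w + |w| * dU z w := by
        rw [← add_mul]
        refine mul_le_mul_of_nonneg_right ?_ h0
        have := le_abs_self z
        have := le_abs_self w
        linarith
      nlinarith [Real.exp_pos (-|z|)]
  have h := hb.abs_mass_le η
  have h2 : mass (fun z _ => -η * dU z (-z - η)) η = -η * mass dU η := integral_const_mul _ _
  rwa [h2, neg_mul, abs_neg] at h

/-! ### Test functions -/

namespace IsTest

variable {l₁ l₂ : ℝ} {ζ : ℝ → ℝ}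

theorem deriv (hζ : IsTest l₁ l₂ ζ) : IsTest l₁ l₂ (deriv ζ) :=
  ⟨(contDiff_infty_iff_deriv.1 hζ.1).2, (tsupport_deriv_subset).trans hζ.2⟩

theorem eq_zero (hζ : IsTest l₁ l₂ ζ) {x : ℝ} (hx : x ∉ Ioo l₁ l₂) : ζ x = 0 :=
  image_eq_zero_of_notMem_tsupport fun h => hx (hζ.2 h)

theorem left (hζ : IsTest l₁ l₂ ζ) : ζ l₁ = 0 := hζ.eq_zero fun h => lt_irrefl _ h.1

theorem right (hζ : IsTest l₁ l₂ ζ) : ζ l₂ = 0 := hζ.eq_zero fun h => lt_irrefl _ h.2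

theorem hasCompactSupport (hζ : IsTest l₁ l₂ ζ) : HasCompactSupport ζ :=
  HasCompactSupport.of_support_subset_isCompact isCompact_Icc
    ((subset_tsupport ζ).trans (hζ.2.trans Ioo_subset_Icc_self))

theorem exists_abs_le (hζ : IsTest l₁ l₂ ζ) : ∃ K, 0 ≤ K ∧ ∀ x, |ζ x| ≤ K := by
  obtain ⟨K, hK⟩ := hζ.hasCompactSupport.exists_bound_of_continuous hζ.1.continuous
  exact ⟨K, (norm_nonneg _).trans (hK 0), hK⟩

theorem exists_lipschitz (hζ : IsTest l₁ l₂ ζ) : ∃ D, 0 ≤ D ∧ ∀ x y, |ζ x - ζ y| ≤ D * |x - y| := by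
  obtain ⟨D, hD0, hD⟩ := hζ.deriv.exists_abs_le
  refine ⟨D, hD0, fun x y => ?_⟩
  exact Convex.norm_image_sub_le_of_norm_deriv_le (s := univ)
    (fun z _ => hζ.1.differentiable (by norm_num) z) (fun z _ => hD z) convex_univ
    (mem_univ y) (mem_univ x)

/-- On the whole line, translation and rescaling move no endpoints. -/
theorem integral_eq (hζ : IsTest l₁ l₂ ζ) (hl : l₁ ≤ l₂) (g : ℝ → ℝ) :
    ∫ x in l₁..l₂, g x * ζ x = ∫ x, g x * ζ x := by
  rw [intervalIntegral.integral_of_le hl]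
  refine setIntegral_eq_integral_of_forall_compl_eq_zero fun x hx => ?_
  rw [hζ.eq_zero fun h => hx (Ioo_subset_Ioc_self h), mul_zero]

theorem integrable_mul (hζ : IsTest l₁ l₂ ζ) {g : ℝ → ℝ} (hg : Continuous g) :
    Integrable fun x => g x * ζ x :=
  (hg.mul hζ.1.continuous).integrable_of_hasCompactSupport
    (HasCompactSupport.mul_left (f := g) hζ.hasCompactSupport)

end IsTest

theorem exists_abs_le_on_Icc {f : ℝ → ℝ} (hf : Continuous f) (a b : ℝ) :
    ∃ K, 0 ≤ K ∧ ∀ t ∈ Icc a b, |f t| ≤ K := by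
  obtain ⟨K, hK⟩ := (isCompact_Icc (a := a) (b := b)).exists_bound_of_continuousOn hf.continuousOn
  exact ⟨max K 0, le_max_right _ _, fun t ht => (hK t ht).trans (le_max_left _ _)⟩

/-! ### The order function in layer variables, and regularity of the ansatz -/

namespace Ansatz

/-- The width of the layers. -/
noncomputable def width (A : Ansatz) (ε t : ℝ) : ℝ := ε / A.β (A.τ ε t)

/-- The logarithmic rate of change of the layer width, times the width. -/
noncomputable def rate (A : Ansatz) (ε t : ℝ) : ℝ :=
  deriv A.β (A.τ ε t) * deriv A.ψ0 t / A.β (A.τ ε t) ^ 2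

variable {A : Ansatz}

theorem u_eq (ε t x : ℝ) : A.u ε t x
    = profile ((A.φ 0 ε t - x) / A.width ε t) ((x - A.φ 1 ε t) / A.width ε t) := by
  have h : ∀ y : ℝ, y / A.width ε t = A.β (A.τ ε t) * y / ε := fun y => by
    rw [width, div_div_eq_mul_div, mul_comm]
  rw [h, h]
  rfl

theorem hasDerivAt_u_x (ε t x : ℝ) : HasDerivAt (A.u ε t)
    (-(1 / A.width ε t * layerDeriv ((A.φ 0 ε t - x) / A.width ε t)
      ((x - A.φ 1 ε t) / A.width ε t))) x := by
  have h1 := ((hasDerivAt_id x).const_sub (A.φ 0 ε t)).div_const (A.width ε t)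
  have h2 := ((hasDerivAt_id x).sub_const (A.φ 1 ε t)).div_const (A.width ε t)
  have h3 := hasDerivAt_profile h1 h2
  have h4 : A.u ε t = fun y => profile ((A.φ 0 ε t - y) / A.width ε t)
      ((y - A.φ 1 ε t) / A.width ε t) := funext (u_eq ε t)
  rw [h4]
  refine h3.congr_deriv ?_
  simp only [layerDeriv, id]
  ring

namespace IsAdmissible

variable (hA : A.IsAdmissible)

include hA

theorem contDiff_ψ0 : ContDiff ℝ ∞ A.ψ0 := (hA.smooth_φ0 1).sub (hA.smooth_φ0 0)

theorem contDiff_τ (ε : ℝ) : ContDiff ℝ ∞ (A.τ ε) := hA.contDiff_ψ0.div_const ε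

theorem contDiff_φ (i : Fin 2) (ε : ℝ) : ContDiff ℝ ∞ (A.φ i ε) :=
  (hA.smooth_φ0 i).add (hA.contDiff_ψ0.mul
    ((hA.smooth_φ1 i).comp ((hA.contDiff_τ ε).prodMk contDiff_id)))

theorem hasDerivAt_φ (i : Fin 2) (ε t : ℝ) : HasDerivAt (A.φ i ε) (A.φt i ε t) t :=
  ((hA.contDiff_φ i ε).differentiable (by norm_num) t).hasDerivAt

theorem contDiff_φt (i : Fin 2) (ε : ℝ) : ContDiff ℝ ∞ (A.φt i ε) :=
  (contDiff_infty_iff_deriv.1 (hA.contDiff_φ i ε)).2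

theorem contDiff_ψ (ε : ℝ) : ContDiff ℝ ∞ (A.ψ ε) :=
  (hA.contDiff_φ 1 ε).sub (hA.contDiff_φ 0 ε)

theorem hasDerivAt_ψ0 (t : ℝ) : HasDerivAt A.ψ0 (deriv A.ψ0 t) t :=
  (hA.contDiff_ψ0.differentiable (by norm_num) t).hasDerivAt

theorem hasDerivAt_β (s : ℝ) : HasDerivAt A.β (deriv A.β s) s :=
  (hA.smooth_β.differentiable (by norm_num) s).hasDerivAt

theorem β_pos (s : ℝ) : 0 < A.β s := by
  obtain ⟨δ₁, δ₂, h, hb⟩ := hA.bounds_β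
  exact h.trans (hb s).1

theorem width_pos {ε : ℝ} (hε : 0 < ε) (t : ℝ) : 0 < A.width ε t := div_pos hε (hA.β_pos _)

theorem η_eq (ε t : ℝ) : A.η ε t = (A.φ 1 ε t - A.φ 0 ε t) / A.width ε t := by
  have := (hA.β_pos (A.τ ε t)).ne'
  rw [η, ρ, ψ, width]
  rcases eq_or_ne ε 0 with rfl | h
  · simp
  · field_simp

theorem e_eq_one_at {ε t : ℝ} (hε : ε ∈ Ioo 0 A.ε₀) (ht : t ∈ Icc 0 A.t₁) (i : Fin 2) :
    A.e (A.φ i ε t) = 1 := by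
  refine hA.e_eq_one ε hε t ht _ ?_
  fin_cases i
  · exact left_mem_uIcc
  · exact right_mem_uIcc

theorem φ_mem {ε t : ℝ} (hε : ε ∈ Ioo 0 A.ε₀) (ht : t ∈ Icc 0 A.t₁) (i : Fin 2) :
    A.φ i ε t ∈ Ioo A.l₁ A.l₂ := by
  by_contra h
  have := hA.e_eq_one_at hε ht i
  rw [hA.test_e.eq_zero h] at this
  exact zero_ne_one this

/-! ### Uniform bounds -/

theorem exists_bound_B : ∃ K, 0 ≤ K ∧ ∀ s, |A.B s| ≤ K := by
  have h1 := (hA.B_top.abs).eventually (gt_mem_nhds (show |(1 : ℝ)| < 2 by norm_num))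
  have h2 := (hA.B_bot.abs).eventually (gt_mem_nhds (show |(0 : ℝ)| < 2 by norm_num))
  obtain ⟨b, hb⟩ := eventually_atTop.1 h1
  obtain ⟨a, ha⟩ := eventually_atBot.1 h2
  obtain ⟨K, hK0, hK⟩ := exists_abs_le_on_Icc hA.smooth_B.continuous a b
  refine ⟨max K 2, le_max_of_le_left hK0, fun s => ?_⟩
  rcases le_total s a with h | h
  · exact (ha s h).le.trans (le_max_right _ _)
  rcases le_total b s with h' | h'
  · exact (hb s h').le.trans (le_max_right _ _)
  · exact (hK s ⟨h, h'⟩).trans (le_max_left _ _)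

theorem exists_bound_deriv_β : ∃ K, 0 ≤ K ∧ ∀ s, |deriv A.β s| ≤ K := by
  obtain ⟨K, hK⟩ := hA.decay_β
  obtain ⟨K', hK0, hK'⟩ := exists_abs_le_on_Icc
    (contDiff_infty_iff_deriv.1 hA.smooth_β).2.continuous (-1) 1
  refine ⟨max K K', le_max_of_le_right hK0, fun s => ?_⟩
  rcases le_total 1 |s| with h | h
  · refine (hK s h).trans ((div_le_iff₀ (by linarith)).2 ?_)
    have : max K K' ≤ max K K' * |s| :=
      le_mul_of_one_le_right (le_max_of_le_right hK0) h
    exact (le_max_left _ _).trans this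
  · exact (hK' s (abs_le.1 h)).trans (le_max_right _ _)

theorem deriv_φ1_fst (i : Fin 2) (s t : ℝ) : HasDerivAt (fun r => A.φ1 i r t)
    (fderiv ℝ (fun p : ℝ × ℝ => A.φ1 i p.1 p.2) (s, t) (1, 0)) s :=
  (((hA.smooth_φ1 i).differentiable (by norm_num) (s, t)).hasFDerivAt.comp_hasDerivAt s
    ((hasDerivAt_id s).prodMk (hasDerivAt_const s t)) :)

theorem deriv_φ1_snd (i : Fin 2) (s t : ℝ) : HasDerivAt (fun r => A.φ1 i s r)
    (fderiv ℝ (fun p : ℝ × ℝ => A.φ1 i p.1 p.2) (s, t) (0, 1)) t :=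
  (((hA.smooth_φ1 i).differentiable (by norm_num) (s, t)).hasFDerivAt.comp_hasDerivAt t
    ((hasDerivAt_const t s).prodMk (hasDerivAt_id t)) :)

/-- The derivative in the fast variable carries the weight `s`, which is the weight produced by
differentiating `ψ₀ φ_{i1}(ψ₀/ε, t)` in time. The decay assumptions cover `|s| ≥ 1`, compactness
covers `[-1, 1] × [0, t₁]`. -/
theorem exists_bound_φ1 : ∃ K, 0 ≤ K ∧ ∀ i, ∀ t ∈ Icc 0 A.t₁, ∀ s, |A.φ1 i s t| ≤ K
    ∧ |s * deriv (fun r => A.φ1 i r t) s| ≤ K ∧ |deriv (fun r => A.φ1 i s r) t| ≤ K := by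
  obtain ⟨K, φl, hK⟩ := hA.decay_φ1
  have hcpt : IsCompact (Icc (-1 : ℝ) 1 ×ˢ Icc 0 A.t₁) := isCompact_Icc.prod isCompact_Icc
  have hb : ∀ i, ∃ M, ∀ p ∈ Icc (-1 : ℝ) 1 ×ˢ Icc 0 A.t₁, |A.φ1 i p.1 p.2| ≤ M
      ∧ |p.1 * deriv (fun r => A.φ1 i r p.2) p.1| ≤ M := by
    intro i
    obtain ⟨M1, hM1⟩ := hcpt.exists_bound_of_continuousOn (hA.smooth_φ1 i).continuous.continuousOn
    have hc : Continuous fun p : ℝ × ℝ => p.1 * deriv (fun r => A.φ1 i r p.2) p.1 := by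
      have h1 : ∀ p : ℝ × ℝ, deriv (fun r => A.φ1 i r p.2) p.1
          = fderiv ℝ (fun p : ℝ × ℝ => A.φ1 i p.1 p.2) p (1, 0) :=
        fun p => (hA.deriv_φ1_fst i p.1 p.2).deriv
      simp only [h1]
      have := (hA.smooth_φ1 i).continuous_fderiv (by norm_num)
      fun_prop
    obtain ⟨M2, hM2⟩ := hcpt.exists_bound_of_continuousOn hc.continuousOn
    exact ⟨max M1 M2, fun p hp => ⟨(hM1 p hp).trans (le_max_left _ _),
      (hM2 p hp).trans (le_max_right _ _)⟩⟩
  choose M hM using hb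
  set L := max (max (M 0) (M 1)) 0 with hL
  have hL0 : 0 ≤ L := le_max_right _ _
  have hM' : ∀ i, M i ≤ L := by
    intro i
    fin_cases i
    · exact (le_max_left _ _).trans (le_max_left _ _)
    · exact (le_max_right _ _).trans (le_max_left _ _)
  have hKa : K ≤ |K| := le_abs_self K
  refine ⟨2 * |K| + L, by positivity, fun i t ht s => ⟨?_, ?_, ?_⟩⟩
  · rcases le_total |s| 1 with h | h
    · have := (hM i (s, t) ⟨abs_le.1 h, ht⟩).1.trans (hM' i)
      linarith [abs_nonneg K]
    · rcases le_abs.1 h with h' | h'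
      · have h1 := (hK i t ht s).1 h'
        have : K / s ≤ |K| := (div_le_iff₀ (by linarith)).2 (by nlinarith [abs_nonneg K])
        linarith [abs_nonneg K]
      · have h1 := (hK i t ht s).2.1 (by linarith)
        -- The limit `φlim` has no bound of its own; the value at `s = -1`, already bounded by
        -- compactness, provides one.
        have h2 := (hK i t ht (-1)).2.1 le_rfl
        have h3 := (hM i (-1, t) ⟨by norm_num, ht⟩).1.trans (hM' i)
        simp only [abs_neg, abs_one, div_one] at h2 h3
        have h4 : K / |s| ≤ |K| := (div_le_iff₀ (by linarith)).2 (by nlinarith [abs_nonneg K])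
        rw [abs_le] at *
        constructor <;> linarith
  · rcases le_total |s| 1 with h | h
    · have := (hM i (s, t) ⟨abs_le.1 h, ht⟩).2.trans (hM' i)
      simp only at this
      linarith [abs_nonneg K]
    · have h1 := (hK i t ht s).2.2.1 h
      rw [le_div_iff₀ (by linarith)] at h1
      rw [abs_mul, mul_comm]
      linarith [abs_nonneg K]
  · have := (hK i t ht s).2.2.2
    linarith [abs_nonneg K]

/-- The chain rule gives a factor `ψ₀/ε`, which is `τ` again. No negative power of `ε` is left, and
the decay of the fast derivative bounds the term. -/
theorem φt_eq (i : Fin 2) (ε t : ℝ) : A.φt i ε t = deriv (A.φ0 i) t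
    + (deriv A.ψ0 t * A.φ1 i (A.τ ε t) t
      + (A.τ ε t * deriv (fun r => A.φ1 i r t) (A.τ ε t) * deriv A.ψ0 t
        + A.ψ0 t * deriv (fun r => A.φ1 i (A.τ ε t) r) t)) := by
  have h0 := ((hA.smooth_φ0 i).differentiable (by norm_num) t).hasDerivAt
  have h1 := hA.hasDerivAt_ψ0 t
  have h2 : HasDerivAt (fun s => A.φ1 i (A.τ ε s) s) _ t :=
    HasFDerivAt.comp_hasDerivAt (f := fun s => (A.τ ε s, s)) t
      ((hA.smooth_φ1 i).differentiable (by norm_num) (A.τ ε t, t)).hasFDerivAt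
      ((h1.div_const ε).prodMk (hasDerivAt_id t))
  have h3 := h0.add (h1.mul h2)
  refine h3.deriv.trans ?_
  rw [(hA.deriv_φ1_fst i _ t).deriv, (hA.deriv_φ1_snd i _ t).deriv]
  have h4 : (deriv A.ψ0 t / ε, (1 : ℝ)) = (deriv A.ψ0 t / ε) • ((1 : ℝ), (0 : ℝ)) + (0, 1) := by
    simp
  rw [h4, map_add, map_smul, smul_eq_mul]
  simp only [τ]
  ring_nf

theorem exists_bound_φt : ∃ K, 0 ≤ K ∧ ∀ i ε, ∀ t ∈ Icc 0 A.t₁, |A.φt i ε t| ≤ K := by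
  obtain ⟨K1, h10, h1⟩ := hA.exists_bound_φ1
  have h2 : ∀ i, ∃ K, 0 ≤ K ∧ ∀ t ∈ Icc 0 A.t₁, |deriv (A.φ0 i) t| ≤ K := fun i =>
    exists_abs_le_on_Icc (contDiff_infty_iff_deriv.1 (hA.smooth_φ0 i)).2.continuous _ _
  choose K2 h20 h2 using h2
  obtain ⟨K3, h30, h3⟩ := exists_abs_le_on_Icc
    (contDiff_infty_iff_deriv.1 hA.contDiff_ψ0).2.continuous 0 A.t₁
  obtain ⟨K4, h40, h4⟩ := exists_abs_le_on_Icc hA.contDiff_ψ0.continuous 0 A.t₁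
  refine ⟨K2 0 + K2 1 + (K3 * K1 + (K1 * K3 + K4 * K1)), ?_, fun i ε t ht => ?_⟩
  · have := h20 0
    have := h20 1
    positivity
  · have hi : K2 i ≤ K2 0 + K2 1 := by
      fin_cases i
      · exact le_add_of_nonneg_right (h20 1)
      · exact le_add_of_nonneg_left (h20 0)
    obtain ⟨ha, hb, hc⟩ := h1 i t ht (A.τ ε t)
    rw [hA.φt_eq]
    refine (abs_add_le _ _).trans (add_le_add ((h2 i t ht).trans hi) ?_)
    refine (abs_add_le _ _).trans (add_le_add ?_ ((abs_add_le _ _).trans (add_le_add ?_ ?_)))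
    · rw [abs_mul]; exact mul_le_mul (h3 t ht) ha (abs_nonneg _) h30
    · rw [abs_mul]; exact mul_le_mul hb (h3 t ht) (abs_nonneg _) h10
    · rw [abs_mul]; exact mul_le_mul (h4 t ht) hc (abs_nonneg _) h40

end IsAdmissible

/-- Bounds for the ingredients of the ansatz that are uniform in `ε` and `t`. -/
structure UniformBounds (A : Ansatz) (K : ℝ) : Prop where
  one_le : 1 ≤ K
  φt : ∀ i ε, ∀ t ∈ Icc 0 A.t₁, |A.φt i ε t| ≤ K
  β' : ∀ ε, ∀ t ∈ Icc 0 A.t₁, |deriv A.β (A.τ ε t) * deriv A.ψ0 t| ≤ K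
  β_le : ∀ s, A.β s ≤ K
  inv_β_le : ∀ s, 1 / A.β s ≤ K
  B : ∀ s, |A.B s| ≤ K
  γm : ∀ i, ∀ t ∈ Icc 0 A.t₁, |A.γm i t| ≤ K
  γp : ∀ i, ∀ t ∈ Icc 0 A.t₁, |A.γp i t| ≤ K

theorem IsAdmissible.exists_uniformBounds (hA : A.IsAdmissible) : ∃ K, A.UniformBounds K := by
  obtain ⟨K1, h10, h1⟩ := hA.exists_bound_φt
  obtain ⟨K2, h20, h2⟩ := hA.exists_bound_deriv_β
  obtain ⟨K3, h30, h3⟩ := exists_abs_le_on_Icc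
    (contDiff_infty_iff_deriv.1 hA.contDiff_ψ0).2.continuous 0 A.t₁
  obtain ⟨K4, h40, h4⟩ := hA.exists_bound_B
  obtain ⟨δ₁, δ₂, hδ, hβ⟩ := hA.bounds_β
  choose K5 h50 h5 using fun i => exists_abs_le_on_Icc (hA.smooth_γm i).continuous 0 A.t₁
  choose K6 h60 h6 using fun i => exists_abs_le_on_Icc (hA.smooth_γp i).continuous 0 A.t₁
  have p1 := h50 0
  have p2 := h50 1
  have p3 := h60 0
  have p4 := h60 1
  have p5 : 0 < δ₂ := hδ.trans ((hβ 0).1.trans (hβ 0).2)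
  have p6 : 0 ≤ 1 / δ₁ := by positivity
  have p7 : 0 ≤ K2 * K3 := by positivity
  refine ⟨1 + K1 + K2 * K3 + δ₂ + 1 / δ₁ + K4 + (K5 0 + K5 1) + (K6 0 + K6 1),
    by linarith, fun i ε t ht => ?_, fun ε t ht => ?_, fun s => ?_, fun s => ?_, fun s => ?_,
    fun i t ht => ?_, fun i t ht => ?_⟩
  · linarith [h1 i ε t ht]
  · rw [abs_mul]
    have := mul_le_mul (h2 (A.τ ε t)) (h3 t ht) (abs_nonneg _) h20
    linarith
  · linarith [hβ s]
  · have := one_div_le_one_div_of_le hδ (hβ s).1.le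
    linarith
  · linarith [h4 s]
  · have := h5 i t ht
    fin_cases i <;> simp only [Fin.zero_eta, Fin.mk_one] at this ⊢ <;> linarith
  · have := h6 i t ht
    fin_cases i <;> simp only [Fin.zero_eta, Fin.mk_one] at this ⊢ <;> linarith

/-! ### The order function -/

namespace IsAdmissible

variable (hA : A.IsAdmissible)

include hA

theorem contDiff_u (ε : ℝ) : ContDiff ℝ ∞ fun p : ℝ × ℝ => A.u ε p.1 p.2 := by
  have h1 : ContDiff ℝ ∞ fun p : ℝ × ℝ => A.β (A.τ ε p.1) :=
    hA.smooth_β.comp ((hA.contDiff_τ ε).comp contDiff_fst)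
  have h2 : ∀ i, ContDiff ℝ ∞ fun p : ℝ × ℝ => A.φ i ε p.1 := fun i =>
    (hA.contDiff_φ i ε).comp contDiff_fst
  have h3 : ContDiff ℝ ∞ fun p : ℝ × ℝ =>
      Real.tanh (A.β (A.τ ε p.1) * (A.φ 0 ε p.1 - p.2) / ε) :=
    contDiff_tanh.comp ((h1.mul ((h2 0).sub contDiff_snd)).div_const ε)
  have h4 : ContDiff ℝ ∞ fun p : ℝ × ℝ =>
      Real.tanh (A.β (A.τ ε p.1) * (p.2 - A.φ 1 ε p.1) / ε) :=
    contDiff_tanh.comp ((h1.mul (contDiff_snd.sub (h2 1))).div_const ε)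
  exact (((contDiff_const.add h3).add h4).sub (h3.mul h4)).div_const 2

/-- Time enters through the positions and through the scale `β(τ)/ε`. The latter yields `rate` times
the layer variable, a term of the same order as the transport term `φt`. -/
theorem hasDerivAt_u_t {ε : ℝ} (hε : ε ≠ 0) (t x : ℝ) : HasDerivAt (fun s => A.u ε s x)
    (1 / A.width ε t *
      (dU ((A.φ 0 ε t - x) / A.width ε t) ((x - A.φ 1 ε t) / A.width ε t)
          * (A.rate ε t * ((A.φ 0 ε t - x) / A.width ε t) + A.φt 0 ε t)
        + dU ((x - A.φ 1 ε t) / A.width ε t) ((A.φ 0 ε t - x) / A.width ε t)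
          * (A.rate ε t * ((x - A.φ 1 ε t) / A.width ε t) - A.φt 1 ε t))) t := by
  have hβ : HasDerivAt (fun s => A.β (A.τ ε s)) (deriv A.β (A.τ ε t) * (deriv A.ψ0 t / ε)) t :=
    (hA.hasDerivAt_β _).comp t ((hA.hasDerivAt_ψ0 t).div_const ε)
  have h1 := (hβ.mul ((hA.hasDerivAt_φ 0 ε t).sub_const x)).div_const ε
  have h2 := (hβ.mul ((hA.hasDerivAt_φ 1 ε t).const_sub x)).div_const ε
  have h3 := hasDerivAt_profile h1 h2
  have h4 : (fun s => A.u ε s x) = fun s => profile (A.β (A.τ ε s) * (A.φ 0 ε s - x) / ε)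
      (A.β (A.τ ε s) * (x - A.φ 1 ε s) / ε) := rfl
  rw [h4]
  refine h3.congr_deriv ?_
  have h : ∀ y : ℝ, y / A.width ε t = A.β (A.τ ε t) * y / ε := fun y => by
    rw [width, div_div_eq_mul_div, mul_comm]
  have hb := (hA.β_pos (A.τ ε t)).ne'
  rw [h, h, h, rate]
  simp only [Pi.mul_apply]
  set d1 := dU (A.β (A.τ ε t) * (A.φ 0 ε t - x) / ε) (A.β (A.τ ε t) * (x - A.φ 1 ε t) / ε)
  set d2 := dU (A.β (A.τ ε t) * (x - A.φ 1 ε t) / ε) (A.β (A.τ ε t) * (A.φ 0 ε t - x) / ε)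
  field_simp
  ring

theorem derivWithin_u {ε t : ℝ} (hε : ε ≠ 0) (ht : t ∈ Icc 0 A.t₁) (x : ℝ) :
    derivWithin (fun s => A.u ε s x) (Icc 0 A.t₁) t = 1 / A.width ε t *
      (dU ((A.φ 0 ε t - x) / A.width ε t) ((x - A.φ 1 ε t) / A.width ε t)
          * (A.rate ε t * ((A.φ 0 ε t - x) / A.width ε t) + A.φt 0 ε t)
        + dU ((x - A.φ 1 ε t) / A.width ε t) ((A.φ 0 ε t - x) / A.width ε t)
          * (A.rate ε t * ((x - A.φ 1 ε t) / A.width ε t) - A.φt 1 ε t)) :=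
  (hA.hasDerivAt_u_t hε t x).hasDerivWithinAt.derivWithin
    (uniqueDiffOn_Icc hA.t₁_pos t ht)

end IsAdmissible

end Ansatz

/-! ### Asymptotics of the pairings with the order function -/

namespace Ansatz

variable {A : Ansatz} {K : ℝ}

theorem UniformBounds.nonneg (hK : A.UniformBounds K) : 0 ≤ K := zero_le_one.trans hK.one_le

theorem UniformBounds.abs_rate_le (hK : A.UniformBounds K) (hA : A.IsAdmissible) (ε : ℝ) {t : ℝ}
    (ht : t ∈ Icc 0 A.t₁) : |A.rate ε t| ≤ K * K ^ 2 := by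
  have hb := hA.β_pos (A.τ ε t)
  have h0 := hK.nonneg
  have h : A.rate ε t = deriv A.β (A.τ ε t) * deriv A.ψ0 t * (1 / A.β (A.τ ε t)) ^ 2 := by
    rw [rate, one_div, inv_pow]; rfl
  rw [h, abs_mul, abs_of_nonneg (by positivity : 0 ≤ (1 / A.β (A.τ ε t)) ^ 2)]
  exact mul_le_mul (hK.β' ε t ht) (pow_le_pow_left₀ (by positivity) (hK.inv_β_le _) 2)
    (by positivity) h0

theorem UniformBounds.width_le (hK : A.UniformBounds K) {ε : ℝ} (hε : 0 ≤ ε) (t : ℝ) :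
    A.width ε t ≤ K * ε := by
  have : A.width ε t = 1 / A.β (A.τ ε t) * ε := by rw [width]; ring
  rw [this]
  exact mul_le_mul_of_nonneg_right (hK.inv_β_le _) hε

/-- The pairing of the time derivative of the order function with a test function. -/
theorem IsAdmissible.pairing_u_t (hA : A.IsAdmissible) {ζ : ℝ → ℝ} (hζ : IsTest A.l₁ A.l₂ ζ) :
    ∃ C, 0 ≤ C ∧ ∀ ε ∈ Ioo 0 A.ε₀, ∀ t ∈ Icc 0 A.t₁,
      |(∫ x in A.l₁..A.l₂, derivWithin (fun s => A.u ε s x) (Icc 0 A.t₁) t * ζ x)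
        - ∑ i : Fin 2, A.coefA i ε t * ζ (A.φ i ε t)| ≤ C * ε := by
  obtain ⟨K, hK⟩ := hA.exists_uniformBounds
  obtain ⟨D, hD0, hD⟩ := hζ.exists_lipschitz
  obtain ⟨Z, hZ0, hZ⟩ := hζ.exists_abs_le
  have hK0 := hK.nonneg
  have hM := expMass_nonneg
  refine ⟨(K * K ^ 2 * 4 + K * 4 + (K * K ^ 2 * 4 + K * 4)) * D * expMass * K, by positivity,
    fun ε hε t ht => ?_⟩
  have hh := hA.width_pos hε.1 t
  set h := A.width ε t with hdef
  have hr := hK.abs_rate_le hA ε ht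
  set a := A.rate ε t with ha
  have hk : ∀ c : ℝ, |c| ≤ K →
      Localized (fun z w => a * (z * dU z w) + c * dU z w) (K * K ^ 2 * 4 + K * 4) := by
    intro c hc
    exact ((localized_mul_dU.const_mul a).add (localized_dU.const_mul c)).mono (by gcongr)
  have hm : ∀ c : ℝ, mass (fun z w => a * (z * dU z w) + c * dU z w) (A.η ε t)
      = a * (-Bz00 (A.η ε t) / 2) + c * ((2 - B00 (A.η ε t)) / 2) := by
    intro c
    rw [mass_add (localized_mul_dU.const_mul a) (localized_dU.const_mul c), mass_const_mul,
      mass_const_mul, mass_dU, mass_mul_dU]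
  have hL := (hk (A.φt 0 ε t) (hK.φt 0 ε t ht)).pair
    (hk (-A.φt 1 ε t) (by rw [abs_neg]; exact hK.φt 1 ε t ht)) hh hD0 zero_le_one le_rfl
    hζ.1.continuous.measurable hZ
    (fun x => by rw [Real.rpow_one]; exact hD x (A.φ 0 ε t))
    (fun x => by rw [Real.rpow_one]; exact hD x (A.φ 1 ε t))
  rw [← hA.η_eq, hm, hm, Real.rpow_one] at hL
  have h1 : (∫ x in A.l₁..A.l₂, derivWithin (fun s => A.u ε s x) (Icc 0 A.t₁) t * ζ x)
      = 1 / h * ∫ x, ((a * ((A.φ 0 ε t - x) / h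
            * dU ((A.φ 0 ε t - x) / h) ((x - A.φ 1 ε t) / h))
          + A.φt 0 ε t * dU ((A.φ 0 ε t - x) / h) ((x - A.φ 1 ε t) / h))
        + (a * ((x - A.φ 1 ε t) / h * dU ((x - A.φ 1 ε t) / h) ((A.φ 0 ε t - x) / h))
          + -A.φt 1 ε t * dU ((x - A.φ 1 ε t) / h) ((A.φ 0 ε t - x) / h))) * ζ x := by
    rw [hζ.integral_eq hA.l₁_lt_l₂.le, ← integral_const_mul]
    congr 1; ext x
    rw [hA.derivWithin_u hε.1.ne' ht]
    ring
  rw [h1]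
  have h2 : ∑ i : Fin 2, A.coefA i ε t * ζ (A.φ i ε t)
      = ζ (A.φ 0 ε t) * (a * (-Bz00 (A.η ε t) / 2) + A.φt 0 ε t * ((2 - B00 (A.η ε t)) / 2))
      + ζ (A.φ 1 ε t)
        * (a * (-Bz00 (A.η ε t) / 2) + -A.φt 1 ε t * ((2 - B00 (A.η ε t)) / 2)) := by
    have hb := (hA.β_pos (A.τ ε t)).ne'
    simp only [Fin.sum_univ_two, coefA, ha, rate, Fin.val_zero, Fin.val_one, pow_zero, pow_one]
    field_simp
    ring
  rw [h2]
  refine hL.trans ?_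
  have := hK.width_le hε.1.le t
  rw [mul_assoc _ K ε]
  exact mul_le_mul_of_nonneg_left this (by positivity)

/-- The pairing of `ε ǔ_t ǔ_x` with a test function. -/
theorem IsAdmissible.pairing_u_t_mul_u_x (hA : A.IsAdmissible) {ξ : ℝ → ℝ}
    (hξ : IsTest A.l₁ A.l₂ ξ) :
    ∃ C, 0 ≤ C ∧ ∀ ε ∈ Ioo 0 A.ε₀, ∀ t ∈ Icc 0 A.t₁,
      |ε * (∫ x in A.l₁..A.l₂,
          derivWithin (fun s => A.u ε s x) (Icc 0 A.t₁) t * deriv (A.u ε t) x * ξ x)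
        - ∑ i : Fin 2, -A.β (A.τ ε t) * (A.φt i ε t * BOm (A.η ε t)
            + (-1) ^ (i : ℕ) * A.rate ε t * BzOm (A.η ε t)) * ξ (A.φ i ε t)| ≤ C * ε := by
  obtain ⟨K, hK⟩ := hA.exists_uniformBounds
  obtain ⟨D, hD0, hD⟩ := hξ.exists_lipschitz
  obtain ⟨Z, hZ0, hZ⟩ := hξ.exists_abs_le
  have hK0 := hK.nonneg
  have hM := expMass_nonneg
  refine ⟨K * ((K * K ^ 2 * 4 + K * 4 + (K * K ^ 2 * 4 + K * 4)) * D * expMass * K),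
    by positivity, fun ε hε t ht => ?_⟩
  have hh := hA.width_pos hε.1 t
  have hb := hA.β_pos (A.τ ε t)
  -- Of the two factors `1/h` in `ǔ_t ǔ_x` one is cancelled by the prefactor `ε = β h`, leaving `β`
  -- and a kernel in the scaling of `Localized.pair`.
  have hβh : ε = A.β (A.τ ε t) * A.width ε t := by rw [width]; field_simp
  set h := A.width ε t with hdef
  have hr := hK.abs_rate_le hA ε ht
  set a := A.rate ε t with ha
  have hk : ∀ c d : ℝ, |c| ≤ K → |d| ≤ K * K ^ 2 →
      Localized (fun z w => d * (z * dU z w * layerDeriv z w) + c * (dU z w * layerDeriv z w))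
        (K * K ^ 2 * 4 + K * 4) := by
    intro c d hc hd
    exact ((localized_mul_dU_mul_layerDeriv.const_mul d).add
      (localized_dU_mul_layerDeriv.const_mul c)).mono (by gcongr)
  have hm : ∀ c d : ℝ,
      mass (fun z w => d * (z * dU z w * layerDeriv z w) + c * (dU z w * layerDeriv z w)) (A.η ε t)
      = d * BzOm (A.η ε t) + c * BOm (A.η ε t) := by
    intro c d
    rw [mass_add (localized_mul_dU_mul_layerDeriv.const_mul d)
      (localized_dU_mul_layerDeriv.const_mul c), mass_const_mul, mass_const_mul, BOm_eq, BzOm_eq]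
  -- The derivative `layerDeriv` is antisymmetric, which makes the coefficient of the moment kernel
  -- change sign between the two layers while that of the transport kernel is `-φt` in both.
  have hL := (hk (-A.φt 0 ε t) (-a) (by rw [abs_neg]; exact hK.φt 0 ε t ht)
      (by rwa [abs_neg])).pair
    (hk (-A.φt 1 ε t) a (by rw [abs_neg]; exact hK.φt 1 ε t ht) hr) hh hD0 zero_le_one le_rfl
    hξ.1.continuous.measurable hZ
    (fun x => by rw [Real.rpow_one]; exact hD x (A.φ 0 ε t))
    (fun x => by rw [Real.rpow_one]; exact hD x (A.φ 1 ε t))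
  rw [← hA.η_eq, hm, hm, Real.rpow_one] at hL
  set R := 1 / h * ∫ x, ((-a * ((A.φ 0 ε t - x) / h
            * dU ((A.φ 0 ε t - x) / h) ((x - A.φ 1 ε t) / h)
            * layerDeriv ((A.φ 0 ε t - x) / h) ((x - A.φ 1 ε t) / h))
          + -A.φt 0 ε t * (dU ((A.φ 0 ε t - x) / h) ((x - A.φ 1 ε t) / h)
            * layerDeriv ((A.φ 0 ε t - x) / h) ((x - A.φ 1 ε t) / h)))
        + (a * ((x - A.φ 1 ε t) / h * dU ((x - A.φ 1 ε t) / h) ((A.φ 0 ε t - x) / h)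
            * layerDeriv ((x - A.φ 1 ε t) / h) ((A.φ 0 ε t - x) / h))
          + -A.φt 1 ε t * (dU ((x - A.φ 1 ε t) / h) ((A.φ 0 ε t - x) / h)
            * layerDeriv ((x - A.φ 1 ε t) / h) ((A.φ 0 ε t - x) / h)))) * ξ x with hR
  have h1 : ε * (∫ x in A.l₁..A.l₂,
      derivWithin (fun s => A.u ε s x) (Icc 0 A.t₁) t * deriv (A.u ε t) x * ξ x)
      = A.β (A.τ ε t) * R := by
    rw [hξ.integral_eq hA.l₁_lt_l₂.le
      (fun x => derivWithin (fun s => A.u ε s x) (Icc 0 A.t₁) t * deriv (A.u ε t) x), hR,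
      ← integral_const_mul, ← integral_const_mul, ← integral_const_mul]
    congr 1; ext x
    rw [hA.derivWithin_u hε.1.ne' ht, (hasDerivAt_u_x ε t x).deriv, ← hdef, ← ha]
    rw [layerDeriv_swap ((A.φ 0 ε t - x) / h)]
    nth_rewrite 1 [hβh]
    field_simp
    ring
  rw [h1]
  have h2 : ∑ i : Fin 2, -A.β (A.τ ε t) * (A.φt i ε t * BOm (A.η ε t)
      + (-1) ^ (i : ℕ) * a * BzOm (A.η ε t)) * ξ (A.φ i ε t)
      = A.β (A.τ ε t) * (ξ (A.φ 0 ε t) * (-a * BzOm (A.η ε t) + -A.φt 0 ε t * BOm (A.η ε t))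
        + ξ (A.φ 1 ε t) * (a * BzOm (A.η ε t) + -A.φt 1 ε t * BOm (A.η ε t))) := by
    simp only [Fin.sum_univ_two, Fin.val_zero, Fin.val_one, pow_zero, pow_one]
    ring
  rw [h2, ← mul_sub, abs_mul, abs_of_pos hb, mul_assoc]
  refine mul_le_mul (hK.β_le _) (hL.trans ?_) (abs_nonneg _) hK0
  have := hK.width_le hε.1.le t
  rw [mul_assoc _ K ε]
  exact mul_le_mul_of_nonneg_left this (by positivity)

/-- The gradient energy balances the potential energy. -/
theorem IsAdmissible.pairing_energy (hA : A.IsAdmissible) {ξ : ℝ → ℝ} (hξ : IsTest A.l₁ A.l₂ ξ)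
    (hβ : ∀ ε ∈ Ioo 0 A.ε₀, ∀ t ∈ Icc 0 A.t₁,
      A.β (A.τ ε t) ^ 2 = Dhat (A.η ε t) / Chat (A.η ε t)) :
    ∃ C, 0 ≤ C ∧ ∀ ε ∈ Ioo 0 A.ε₀, ∀ t ∈ Icc 0 A.t₁,
      |ε / 2 * (∫ x in A.l₁..A.l₂, deriv (A.u ε t) x ^ 2 * ξ x)
        - 1 / ε * (∫ x in A.l₁..A.l₂, wellF (A.u ε t x) * ξ x)| ≤ C * ε := by
  obtain ⟨K, hK⟩ := hA.exists_uniformBounds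
  obtain ⟨D, hD0, hD⟩ := hξ.exists_lipschitz
  obtain ⟨Z, hZ0, hZ⟩ := hξ.exists_abs_le
  have hK0 := hK.nonneg
  have hM := expMass_nonneg
  refine ⟨(K * 4 + K * 4 + (K * 4 + K * 4)) * D * expMass * K, by positivity,
    fun ε hε t ht => ?_⟩
  have hh := hA.width_pos hε.1 t
  have hb := hA.β_pos (A.τ ε t)
  have hβh : ε = A.β (A.τ ε t) * A.width ε t := by rw [width]; field_simp
  -- Both delta coefficients vanish, so only the Lipschitz error of `Localized.pair` survives.
  have hm := mass_energyKernel _ _ hb (hβ ε hε t ht)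
  have hbK := hK.β_le (A.τ ε t)
  have hbK' := hK.inv_β_le (A.τ ε t)
  set h := A.width ε t with hdef
  set b := A.β (A.τ ε t)
  have hk : Localized (energyKernel b) (K * 4 + K * 4) := by
    refine (localized_energyKernel b).mono ?_
    have h1 : |b / 2| ≤ K := by rw [abs_of_pos (by positivity)]; linarith
    have h2 : |-(1 / (4 * b))| ≤ K := by
      have : 1 / (4 * b) = 1 / b / 4 := by field_simp
      have h3 : 0 < 1 / b := by positivity
      rw [abs_neg, this, abs_of_pos (by positivity)]
      linarith
    gcongr
  have hL := hk.pair hk hh hD0 zero_le_one le_rfl hξ.1.continuous.measurable hZ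
    (fun x => by rw [Real.rpow_one]; exact hD x (A.φ 0 ε t))
    (fun x => by rw [Real.rpow_one]; exact hD x (A.φ 1 ε t))
  rw [← hA.η_eq, hm, Real.rpow_one, mul_zero, mul_zero, add_zero, sub_zero] at hL
  set z : ℝ → ℝ := fun x => (A.φ 0 ε t - x) / h with hz
  set w : ℝ → ℝ := fun x => (x - A.φ 1 ε t) / h with hw
  have hi : Integrable fun x => (layerDeriv (z x) (w x)) ^ 2 * ξ x := by
    have h1 := localized_dU_mul_layerDeriv.integrable_left (p := A.φ 0 ε t) (q := A.φ 1 ε t)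
      hh hξ.1.continuous.measurable hZ
    have h2 := localized_dU_mul_layerDeriv.integrable_right (p := A.φ 0 ε t) (q := A.φ 1 ε t)
      hh hξ.1.continuous.measurable hZ
    refine (h1.add h2).congr (Eventually.of_forall fun x => ?_)
    simp only [layerDeriv, z, w, Pi.add_apply]
    ring
  have hi' : Integrable fun x => wellF (profile (z x) (w x)) * ξ x := by
    have hz' : Continuous z := by simp only [hz]; fun_prop
    have hw' : Continuous w := by simp only [hw]; fun_prop
    have h1 : Continuous fun x => profile (z x) (w x) := hz'.profile hw'
    have h2 : Continuous wellF := by unfold wellF; fun_prop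
    exact hξ.integrable_mul (h2.comp h1)
  have h1 : ε / 2 * (∫ x in A.l₁..A.l₂, deriv (A.u ε t) x ^ 2 * ξ x)
        - 1 / ε * (∫ x in A.l₁..A.l₂, wellF (A.u ε t x) * ξ x)
      = 1 / h * ∫ x, (energyKernel b (z x) (w x) + energyKernel b (w x) (z x)) * ξ x := by
    rw [hξ.integral_eq hA.l₁_lt_l₂.le, hξ.integral_eq hA.l₁_lt_l₂.le]
    have h2 : ∀ x, (energyKernel b (z x) (w x) + energyKernel b (w x) (z x)) * ξ x
        = b / 2 * (layerDeriv (z x) (w x) ^ 2 * ξ x)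
          - 1 / b * (wellF (profile (z x) (w x)) * ξ x) := by
      intro x; rw [energyKernel_add_swap]; ring
    have h3 : ∀ x, deriv (A.u ε t) x ^ 2 * ξ x
        = (1 / h) ^ 2 * (layerDeriv (z x) (w x) ^ 2 * ξ x) := by
      intro x; rw [(hasDerivAt_u_x ε t x).deriv]; ring
    have h4 : ∀ x, wellF (A.u ε t x) * ξ x = wellF (profile (z x) (w x)) * ξ x := by
      intro x; rw [u_eq]
    simp_rw [h2, h3, h4]
    rw [integral_sub (hi.const_mul _) (hi'.const_mul _), integral_const_mul, integral_const_mul,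
      integral_const_mul, hβh]
    field_simp
  rw [h1]
  refine hL.trans ?_
  have := hK.width_le hε.1.le t
  rw [mul_assoc _ K ε]
  exact mul_le_mul_of_nonneg_left this (by positivity)

/-- The pairing of `ǔ_x` with a function that is Hölder continuous of exponent `1/2`. -/
theorem UniformBounds.pairing_u_x (hK : A.UniformBounds K) (hA : A.IsAdmissible) {ε t : ℝ}
    (hε : ε ∈ Ioo 0 A.ε₀) {f : ℝ → ℝ} {D Z : ℝ} (hf : Measurable f)
    (hZ : ∀ x, |f x| ≤ Z) (hD0 : 0 ≤ D)
    (hD : ∀ i x, |f x - f (A.φ i ε t)| ≤ D * |x - A.φ i ε t| ^ (1 / 2 : ℝ)) :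
    |(∫ x, deriv (A.u ε t) x * f x)
        + COm (A.η ε t) * (f (A.φ 0 ε t) - f (A.φ 1 ε t))|
      ≤ 8 * D * expMass * K * ε ^ (1 / 2 : ℝ) := by
  have hh := hA.width_pos hε.1 t
  have hM := expMass_nonneg
  have hK0 := hK.nonneg
  have hL := (localized_dU).pair (localized_dU.const_mul (-1)) hh hD0 (α := 1 / 2) (by norm_num)
    (by norm_num) hf hZ (hD 0) (hD 1)
  rw [← hA.η_eq, mass_const_mul, ← COm_eq] at hL
  have h1 : ∫ x, deriv (A.u ε t) x * f x
      = -(1 / A.width ε t * ∫ x, (dU ((A.φ 0 ε t - x) / A.width ε t) ((x - A.φ 1 ε t) / A.width ε t)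
        + -1 * dU ((x - A.φ 1 ε t) / A.width ε t) ((A.φ 0 ε t - x) / A.width ε t)) * f x) := by
    rw [← integral_const_mul, ← integral_neg]
    congr 1; ext x
    rw [(hasDerivAt_u_x ε t x).deriv, layerDeriv]
    ring
  rw [h1, ← abs_neg]
  -- `1 ≤ K` allows `K^{1/2}` to be replaced by `K`.
  have h2 : A.width ε t ^ (1 / 2 : ℝ) ≤ K * ε ^ (1 / 2 : ℝ) := by
    calc A.width ε t ^ (1 / 2 : ℝ) ≤ (K * ε) ^ (1 / 2 : ℝ) :=
          Real.rpow_le_rpow hh.le (hK.width_le hε.1.le t) (by norm_num)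
      _ = K ^ (1 / 2 : ℝ) * ε ^ (1 / 2 : ℝ) := Real.mul_rpow hK0 hε.1.le
      _ ≤ K ^ (1 : ℝ) * ε ^ (1 / 2 : ℝ) := by
          have := hε.1.le
          have := Real.rpow_le_rpow_of_exponent_le hK.one_le (by norm_num : (1 / 2 : ℝ) ≤ 1)
          gcongr
      _ = _ := by rw [Real.rpow_one]
  refine le_trans (le_of_eq ?_) (hL.trans ?_)
  · congr 1; ring
  · have h3 : (4 + |(-1 : ℝ)| * 4) * D * expMass = 8 * D * expMass := by norm_num
    rw [h3, mul_assoc _ K]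
    exact mul_le_mul_of_nonneg_left h2 (by positivity)

end Ansatz

/-! ### The shape functions of the temperature model -/

/-- `a² b / (a + b)²` -/
noncomputable def cone (a b : ℝ) : ℝ := a ^ 2 * b / (a + b) ^ 2

/-- `cone` is homogeneous of degree one, so bounded difference quotients on the quadrant are
natural; the quotient is factored explicitly and estimated. The edge `b = 0` is separate because the
denominators may vanish there. -/
theorem abs_cone_sub_left {a a' b : ℝ} (ha : 0 ≤ a) (ha' : 0 ≤ a') (hb : 0 ≤ b) :
    |cone a b - cone a' b| ≤ 2 * |a - a'| := by
  rcases hb.eq_or_lt with rfl | hb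
  · simp [cone]
  have hs : 0 < a + b := by linarith
  have hs' : 0 < a' + b := by linarith
  have h1 : cone a b - cone a' b = (a - a') *
      (b ^ 2 * (a * (a' + b) + a' * (a + b)) / ((a + b) ^ 2 * (a' + b) ^ 2)) := by
    unfold cone; field_simp; ring
  rw [h1, abs_mul, mul_comm, abs_of_nonneg (by positivity :
    0 ≤ b ^ 2 * (a * (a' + b) + a' * (a + b)) / ((a + b) ^ 2 * (a' + b) ^ 2))]
  refine mul_le_mul_of_nonneg_right ((div_le_iff₀ (by positivity)).2 ?_) (abs_nonneg _)
  have e1 : b ^ 2 ≤ (a + b) * (a' + b) := by nlinarith [mul_nonneg ha ha']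
  have e2 : a * (a' + b) + a' * (a + b) ≤ 2 * ((a + b) * (a' + b)) := by
    nlinarith [mul_nonneg ha ha', mul_nonneg ha hb.le, mul_nonneg ha' hb.le]
  calc _ ≤ ((a + b) * (a' + b)) * (2 * ((a + b) * (a' + b))) :=
        mul_le_mul e1 e2 (by positivity) (by positivity)
    _ = _ := by ring

theorem abs_cone_sub_right {a b b' : ℝ} (ha : 0 ≤ a) (hb : 0 ≤ b) (hb' : 0 ≤ b') :
    |cone a b - cone a b'| ≤ |b - b'| := by
  rcases ha.eq_or_lt with rfl | ha
  · simp [cone]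
  have hs : 0 < a + b := by linarith
  have hs' : 0 < a + b' := by linarith
  have h1 : cone a b - cone a b' = (b - b') *
      (a ^ 2 * (a ^ 2 - b * b') / ((a + b) ^ 2 * (a + b') ^ 2)) := by
    unfold cone; field_simp; ring
  have h2 : |a ^ 2 * (a ^ 2 - b * b') / ((a + b) ^ 2 * (a + b') ^ 2)| ≤ 1 := by
    rw [abs_div, abs_of_pos (by positivity : 0 < (a + b) ^ 2 * (a + b') ^ 2),
      div_le_one (by positivity), abs_mul, abs_of_pos (by positivity : 0 < a ^ 2)]
    have hbb := mul_nonneg hb hb'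
    have e1 : a ^ 2 ≤ (a + b) * (a + b') := by nlinarith
    have e2 : |a ^ 2 - b * b'| ≤ (a + b) * (a + b') := by
      rw [abs_le]
      constructor <;> nlinarith
    calc _ ≤ ((a + b) * (a + b')) * ((a + b) * (a + b')) :=
          mul_le_mul e1 e2 (by positivity) (by positivity)
      _ = _ := by ring
  rw [h1, abs_mul]
  exact mul_le_of_le_one_right (abs_nonneg _) h2

/-- `a² |b| / (a + b)²` if `a` and `b` have the same sign, `0` otherwise. -/
noncomputable def wedge (a b : ℝ) : ℝ :=
  cone (max a 0) (max b 0) + cone (max (-a) 0) (max (-b) 0)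

theorem abs_wedge_sub_le (a b a' b' : ℝ) :
    |wedge a b - wedge a' b'| ≤ 4 * (|a - a'| + |b - b'|) := by
  have h : ∀ a b a' b' : ℝ, |cone (max a 0) (max b 0) - cone (max a' 0) (max b' 0)|
      ≤ 2 * |a - a'| + |b - b'| := by
    intro a b a' b'
    have h1 := abs_cone_sub_left (le_max_right a 0) (le_max_right a' 0) (le_max_right b 0)
    have h2 := abs_cone_sub_right (le_max_right a' 0) (le_max_right b 0) (le_max_right b' 0)
    have h3 := abs_max_sub_max_le_abs a a' 0
    have h4 := abs_max_sub_max_le_abs b b' 0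
    have h5 := abs_sub_le (cone (max a 0) (max b 0)) (cone (max a' 0) (max b 0))
      (cone (max a' 0) (max b' 0))
    linarith
  have h1 := h a b a' b'
  have h2 := h (-a) (-b) (-a') (-b')
  rw [show -a - -a' = -(a - a') by ring, show -b - -b' = -(b - b') by ring, abs_neg, abs_neg] at h2
  have h3 := abs_add_le (cone (max a 0) (max b 0) - cone (max a' 0) (max b' 0))
    (cone (max (-a) 0) (max (-b) 0) - cone (max (-a') 0) (max (-b') 0))
  have h4 : wedge a b - wedge a' b' = (cone (max a 0) (max b 0) - cone (max a' 0) (max b' 0))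
    + (cone (max (-a) 0) (max (-b) 0) - cone (max (-a') 0) (max (-b') 0)) := by
    unfold wedge; ring
  rw [h4]
  linarith [abs_nonneg (b - b')]

theorem lipschitz_wedge : LipschitzWith 8 fun p : ℝ × ℝ => wedge p.1 p.2 := by
  refine LipschitzWith.of_dist_le_mul fun p q => ?_
  rw [Real.dist_eq, Prod.dist_eq]
  have h1 : |p.1 - q.1| ≤ max (dist p.1 q.1) (dist p.2 q.2) := le_max_left _ _
  have h2 : |p.2 - q.2| ≤ max (dist p.1 q.1) (dist p.2 q.2) := le_max_right _ _
  have := abs_wedge_sub_le p.1 p.2 q.1 q.2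
  norm_num
  linarith

/-- The cubic that vanishes at `p` and `q` and has the slopes `c` at `p`, `-d` at `q`. -/
noncomputable def bump (c d p q x : ℝ) : ℝ :=
  ((c + d) / 2 - (x - (p + q) / 2) * (c - d) / (q - p)) * ((p - x) * (x - q) / (q - p))

theorem heav_of_pos {y : ℝ} (h : 0 < y) : heav y = 1 := if_pos h

theorem heav_of_nonpos {y : ℝ} (h : y ≤ 0) : heav y = 0 := if_neg h.not_gt

theorem mul_heav_self (y : ℝ) : y * heav y = max y 0 := by
  rcases le_or_gt y 0 with h | h
  · rw [heav_of_nonpos h, max_eq_right h, mul_zero]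
  · rw [heav_of_pos h, max_eq_left h.le, mul_one]

theorem cone_zero_left (b : ℝ) : cone 0 b = 0 := by simp [cone]

theorem cone_zero_right (a : ℝ) : cone a 0 = 0 := by simp [cone]

/-- The bump is a combination of the two Hermite cubics on the segment. Through `wedge` the division
by `q - p` is absorbed into a globally Lipschitz function, which keeps the temperature model
Lipschitz at a collision `p = q`. -/
theorem bump_mul_heav (c d p q x : ℝ) : bump c d p q x * (heav (x - p) - heav (x - q))
    = c * wedge (x - q) (p - x) + d * wedge (p - x) (x - q) := by
  have hn : ∀ y : ℝ, (y : ℝ) ^ 2 = (-y) ^ 2 := fun y => by ring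
  -- Off the segment both sides vanish. Inside it `p - x` and `x - q` have the same sign, negative
  -- for `p < q` and positive for `q < p`.
  rcases lt_or_ge (p - x) 0 with h0 | h0 <;> rcases lt_or_ge 0 (x - q) with h1 | h1
  · rw [heav_of_pos (by linarith : 0 < x - p), heav_of_pos h1]
    simp only [wedge, max_eq_right h0.le, max_eq_right (by linarith : -(x - q) ≤ 0),
      cone_zero_left, cone_zero_right]
    ring
  · rw [heav_of_pos (by linarith : 0 < x - p), heav_of_nonpos h1]
    simp only [wedge, max_eq_right h0.le, max_eq_right h1, cone_zero_left,
      max_eq_left (by linarith : (0 : ℝ) ≤ -(x - q)), max_eq_left (by linarith : (0 : ℝ) ≤ -(p - x))]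
    have hne : q - p ≠ 0 := by linarith
    have e1 : -(x - q) + -(p - x) = q - p := by ring
    have e2 : -(p - x) + -(x - q) = q - p := by ring
    simp only [cone, bump, e1, e2]
    field_simp
    ring
  · rw [heav_of_nonpos (by linarith : x - p ≤ 0), heav_of_pos h1]
    simp only [wedge, max_eq_right (by linarith : -(p - x) ≤ 0), cone_zero_left,
      max_eq_right (by linarith : -(x - q) ≤ 0), max_eq_left h0, max_eq_left h1.le]
    have hne : q - p ≠ 0 := by linarith
    have hne' : p - q ≠ 0 := by linarith
    have e1 : (x - q) + (p - x) = p - q := by ring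
    have e2 : (p - x) + (x - q) = p - q := by ring
    have e3 : (p - q) ^ 2 = (q - p) ^ 2 := by ring
    simp only [cone, bump, e1, e2, e3]
    field_simp
    ring
  · rw [heav_of_nonpos (by linarith : x - p ≤ 0), heav_of_nonpos h1]
    simp only [wedge, max_eq_right h1, max_eq_right (by linarith : -(p - x) ≤ 0),
      cone_zero_left, cone_zero_right]
    ring

theorem hasDerivAt_bump (c d p q x : ℝ) : HasDerivAt (bump c d p q)
    (-((c - d) / (q - p)) * ((p - x) * (x - q) / (q - p))
      + ((c + d) / 2 - (x - (p + q) / 2) * (c - d) / (q - p)) * ((p + q - 2 * x) / (q - p))) x := by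
  have h1 : HasDerivAt (fun x => (c + d) / 2 - (x - (p + q) / 2) * (c - d) / (q - p))
      (-(1 * (c - d) / (q - p))) x :=
    ((((hasDerivAt_id x).sub_const _).mul_const (c - d)).div_const (q - p)).const_sub _
  have h2 := (((hasDerivAt_id x).const_sub p).mul ((hasDerivAt_id x).sub_const q)).div_const (q - p)
  refine (h1.mul h2).congr_deriv ?_
  simp only [Pi.mul_apply, id]
  ring

theorem hasDerivAt_deriv_bump (c d p q x : ℝ) : HasDerivAt (deriv (bump c d p q))
    (-(2 * ((c - d) / (q - p)) * ((p + q - 2 * x) / (q - p)))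
      - 2 / (q - p) * ((c + d) / 2 - (x - (p + q) / 2) * (c - d) / (q - p))) x := by
  have h0 := funext fun x => (hasDerivAt_bump c d p q x).deriv
  rw [h0]
  have h1 : HasDerivAt (fun x => (c + d) / 2 - (x - (p + q) / 2) * (c - d) / (q - p))
      (-(1 * (c - d) / (q - p))) x :=
    ((((hasDerivAt_id x).sub_const _).mul_const (c - d)).div_const (q - p)).const_sub _
  have h2 := (((hasDerivAt_id x).const_sub p).mul ((hasDerivAt_id x).sub_const q)).div_const (q - p)
  have h3 := (((hasDerivAt_id x).const_mul 2).const_sub (p + q)).div_const (q - p)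
  refine ((h2.const_mul (-((c - d) / (q - p)))).add (h1.mul h3)).congr_deriv ?_
  simp only [id]
  ring

theorem contDiff_bump (c d p q : ℝ) : ContDiff ℝ ∞ (bump c d p q) := by
  unfold bump
  exact (contDiff_const.sub (((contDiff_id.sub contDiff_const).mul contDiff_const).div_const _)).mul
    (((contDiff_const.sub contDiff_id).mul (contDiff_id.sub contDiff_const)).div_const _)

/-! ### Integration by parts for functions with kinks -/

theorem integral_heav_left {l₁ l₂ p : ℝ} (hp : p ∈ Icc l₁ l₂) {g : ℝ → ℝ} (hg : Continuous g) :
    ∫ x in l₁..l₂, g x * heav (p - x) = ∫ x in l₁..p, g x := by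
  have hi : ∀ a b, IntervalIntegrable g volume a b := fun a b => hg.intervalIntegrable a b
  have h1 : ∫ x in l₁..p, g x * heav (p - x) = ∫ x in l₁..p, g x := by
    refine intervalIntegral.integral_congr_ae ?_
    have : ∀ᵐ x : ℝ, x ≠ p := (measure_eq_zero_iff_ae_notMem.1 (measure_singleton p))
    filter_upwards [this] with x hx hx'
    rw [uIoc_of_le hp.1] at hx'
    rw [heav_of_pos (sub_pos.2 (lt_of_le_of_ne hx'.2 hx)), mul_one]
  have h2 : ∀ x ∈ uIcc p l₂, g x * heav (p - x) = 0 := by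
    intro x hx
    rw [uIcc_of_le hp.2] at hx
    rw [heav_of_nonpos (by linarith [hx.1]), mul_zero]
  have h3 : ∫ x in p..l₂, g x * heav (p - x) = 0 := by
    rw [intervalIntegral.integral_congr h2]; simp
  have h4 : IntervalIntegrable (fun x => g x * heav (p - x)) volume l₁ p := by
    refine (hi l₁ p).congr_ae ?_
    rw [Filter.EventuallyEq, ae_restrict_iff' measurableSet_uIoc]
    have : ∀ᵐ x : ℝ, x ≠ p := (measure_eq_zero_iff_ae_notMem.1 (measure_singleton p))
    filter_upwards [this] with x hx hx'
    rw [uIoc_of_le hp.1] at hx'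
    rw [heav_of_pos (sub_pos.2 (lt_of_le_of_ne hx'.2 hx)), mul_one]
  have h5 : IntervalIntegrable (fun x => g x * heav (p - x)) volume p l₂ := by
    refine (intervalIntegrable_const (c := (0 : ℝ))).congr fun x hx => ?_
    exact (h2 x (uIoc_subset_uIcc hx)).symm
  rw [← intervalIntegral.integral_add_adjacent_intervals h4 h5, h1, h3, add_zero]

theorem intervalIntegrable_mul_heav {g s : ℝ → ℝ} (hg : Continuous g) (hs : Measurable s)
    (a b : ℝ) : IntervalIntegrable (fun x => g x * heav (s x)) volume a b := by
  have hm : Measurable heav := Measurable.ite measurableSet_Ioi measurable_const measurable_const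
  refine (hg.intervalIntegrable a b).mono_fun
    (hg.measurable.mul (hm.comp hs)).aestronglyMeasurable (Eventually.of_forall fun x => ?_)
  simp only [norm_mul]
  refine mul_le_of_le_one_right (norm_nonneg _) ?_
  unfold heav
  split_ifs <;> simp

theorem heav_add_heav_neg {y : ℝ} (hy : y ≠ 0) : heav y + heav (-y) = 1 := by
  rcases hy.lt_or_gt with h | h
  · rw [heav_of_nonpos h.le, heav_of_pos (by linarith), zero_add]
  · rw [heav_of_nonpos (by linarith : -y ≤ 0), heav_of_pos h, add_zero]

theorem integral_heav_right {l₁ l₂ q : ℝ} (hq : q ∈ Icc l₁ l₂) {g : ℝ → ℝ} (hg : Continuous g) :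
    ∫ x in l₁..l₂, g x * heav (x - q) = ∫ x in q..l₂, g x := by
  have h1 := integral_heav_left hq hg
  have h2 : (∫ x in l₁..l₂, g x * heav (x - q)) + ∫ x in l₁..l₂, g x * heav (q - x)
      = ∫ x in l₁..l₂, g x := by
    rw [← intervalIntegral.integral_add (intervalIntegrable_mul_heav hg (by fun_prop) _ _)
      (intervalIntegrable_mul_heav hg (by fun_prop) _ _)]
    refine intervalIntegral.integral_congr_ae ?_
    have : ∀ᵐ x : ℝ, x ≠ q := (measure_eq_zero_iff_ae_notMem.1 (measure_singleton q))
    filter_upwards [this] with x hx _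
    have := heav_add_heav_neg (sub_ne_zero.2 hx)
    rw [neg_sub] at this
    rw [← mul_add, this, mul_one]
  have h3 := intervalIntegral.integral_add_adjacent_intervals
    (hg.intervalIntegrable (μ := volume) l₁ q) (hg.intervalIntegrable q l₂)
  linarith

theorem integral_deriv_deriv_mul {g χ : ℝ → ℝ} (hg : ContDiff ℝ ∞ g) (hχ : ContDiff ℝ ∞ χ)
    (a b : ℝ) : ∫ x in a..b, deriv (deriv g) x * χ x
      = (∫ x in a..b, g x * deriv (deriv χ) x)
        + ((deriv g b * χ b - g b * deriv χ b) - (deriv g a * χ a - g a * deriv χ a)) := by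
  have hg1 := (contDiff_infty_iff_deriv.1 hg).2
  have hg2 := (contDiff_infty_iff_deriv.1 hg1).2
  have hχ1 := (contDiff_infty_iff_deriv.1 hχ).2
  have hχ2 := (contDiff_infty_iff_deriv.1 hχ1).2
  have hd : ∀ {f : ℝ → ℝ}, ContDiff ℝ ∞ f → ∀ x, HasDerivAt f (deriv f x) x := fun hf x =>
    (hf.differentiable (by norm_num) x).hasDerivAt
  have h := intervalIntegral.integral_eq_sub_of_hasDerivAt (a := a) (b := b)
    (f := fun x => deriv g x * χ x - g x * deriv χ x)
    (f' := fun x => deriv (deriv g) x * χ x - g x * deriv (deriv χ) x)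
    (fun x _ => (((hd hg1 x).mul (hd hχ x)).sub ((hd hg x).mul (hd hχ1 x))).congr_deriv (by ring))
    (((hg2.continuous.mul hχ.continuous).sub
      (hg.continuous.mul hχ2.continuous)).intervalIntegrable _ _)
  rw [intervalIntegral.integral_sub
    ((hg2.continuous.fun_mul hχ.continuous).intervalIntegrable _ _)
    ((hg.continuous.fun_mul hχ2.continuous).intervalIntegrable _ _)] at h
  linarith

/-- A function that is smooth off the points `p` and `q`. -/
noncomputable def kinked (p q : ℝ) (f₁ f₂ f₃ : ℝ → ℝ) (x : ℝ) : ℝ :=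
  f₁ x * heav (p - x) + f₂ x * heav (x - q) + f₃ x * (heav (x - p) - heav (x - q))

theorem hasDerivAt_mul_heav {f s : ℝ → ℝ} {f' x : ℝ} (hf : HasDerivAt f f' x)
    (hs : ContinuousAt s x) (h : s x ≠ 0) :
    HasDerivAt (fun y => f y * heav (s y)) (f' * heav (s x)) x := by
  have : (fun y => f y * heav (s y)) =ᶠ[𝓝 x] fun y => f y * heav (s x) := by
    rcases h.lt_or_gt with h | h
    · filter_upwards [hs.eventually (gt_mem_nhds h)] with y hy
      rw [heav_of_nonpos hy.le, heav_of_nonpos h.le]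
    · filter_upwards [hs.eventually (lt_mem_nhds h)] with y hy
      rw [heav_of_pos hy, heav_of_pos h]
  exact (hf.mul_const _).congr_of_eventuallyEq this

theorem hasDerivAt_kinked {p q x : ℝ} {f₁ f₂ f₃ : ℝ → ℝ} (h₁ : DifferentiableAt ℝ f₁ x)
    (h₂ : DifferentiableAt ℝ f₂ x) (h₃ : DifferentiableAt ℝ f₃ x) (hp : x ≠ p) (hq : x ≠ q) :
    HasDerivAt (kinked p q f₁ f₂ f₃) (kinked p q (deriv f₁) (deriv f₂) (deriv f₃) x) x := by
  have e1 := hasDerivAt_mul_heav h₁.hasDerivAt (s := fun y => p - y) (by fun_prop)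
    (sub_ne_zero.2 hp.symm)
  have e2 := hasDerivAt_mul_heav h₂.hasDerivAt (s := fun y => y - q) (by fun_prop)
    (sub_ne_zero.2 hq)
  have e3 := hasDerivAt_mul_heav h₃.hasDerivAt (s := fun y => y - p) (by fun_prop)
    (sub_ne_zero.2 hp)
  have e4 := hasDerivAt_mul_heav h₃.hasDerivAt (s := fun y => y - q) (by fun_prop)
    (sub_ne_zero.2 hq)
  have h := (e1.add e2).add (e3.sub e4)
  refine (h.congr_deriv ?_).congr_of_eventuallyEq (Eventually.of_forall fun y => ?_)
  · simp only [kinked]; ring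
  · simp only [kinked, Pi.add_apply, Pi.sub_apply]; ring

theorem intervalIntegrable_kinked {p q : ℝ} {f₁ f₂ f₃ : ℝ → ℝ} (h₁ : Continuous f₁)
    (h₂ : Continuous f₂) (h₃ : Continuous f₃) (a b : ℝ) :
    IntervalIntegrable (kinked p q f₁ f₂ f₃) volume a b := by
  have h := ((intervalIntegrable_mul_heav h₁ (by fun_prop : Measurable fun x => p - x) a b).add
    (intervalIntegrable_mul_heav h₂ (by fun_prop : Measurable fun x => x - q) a b)).add
    ((intervalIntegrable_mul_heav h₃ (by fun_prop : Measurable fun x => x - p) a b).sub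
    (intervalIntegrable_mul_heav h₃ (by fun_prop : Measurable fun x => x - q) a b))
  refine h.congr fun x _ => ?_
  simp only [kinked, mul_sub]

/-- Oriented integrals make the formula valid for both orders of `p` and `q`, so crossed boundaries
need no separate treatment. -/
theorem integral_kinked {l₁ l₂ p q : ℝ} (hp : p ∈ Icc l₁ l₂) (hq : q ∈ Icc l₁ l₂)
    {f₁ f₂ f₃ : ℝ → ℝ} (h₁ : Continuous f₁) (h₂ : Continuous f₂) (h₃ : Continuous f₃) :
    ∫ x in l₁..l₂, kinked p q f₁ f₂ f₃ x
      = (∫ x in l₁..p, f₁ x) + (∫ x in q..l₂, f₂ x) + ∫ x in p..q, f₃ x := by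
  have i1 := intervalIntegrable_mul_heav h₁ (by fun_prop : Measurable fun x => p - x) l₁ l₂
  have i2 := intervalIntegrable_mul_heav h₂ (by fun_prop : Measurable fun x => x - q) l₁ l₂
  have i3 := intervalIntegrable_mul_heav h₃ (by fun_prop : Measurable fun x => x - p) l₁ l₂
  have i4 := intervalIntegrable_mul_heav h₃ (by fun_prop : Measurable fun x => x - q) l₁ l₂
  simp only [kinked, mul_sub]
  rw [intervalIntegral.integral_add (i1.add i2) (i3.sub i4), intervalIntegral.integral_add i1 i2,
    intervalIntegral.integral_sub i3 i4, integral_heav_left hp h₁, integral_heav_right hq h₂,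
    integral_heav_right hp h₃, integral_heav_right hq h₃]
  have := intervalIntegral.integral_add_adjacent_intervals
    (h₃.intervalIntegrable (μ := volume) p q) (h₃.intervalIntegrable q l₂)
  linarith

/-- The regular part of the second derivative of a function with kinks at `p` and `q`. -/
theorem integral_kinked_deriv_deriv {l₁ l₂ p q : ℝ} (hp : p ∈ Icc l₁ l₂) (hq : q ∈ Icc l₁ l₂)
    {e χ f₁ f₂ f₃ : ℝ → ℝ} (he : IsTest l₁ l₂ e) (hep : e p = 1) (heq : e q = 1)
    (hχ : ContDiff ℝ ∞ χ) (h₁ : ContDiff ℝ ∞ f₁) (h₂ : ContDiff ℝ ∞ f₂) (h₃ : ContDiff ℝ ∞ f₃)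
    (z₁ : f₁ p = 0) (z₂ : f₂ q = 0) (z₃ : f₃ p = 0) (z₄ : f₃ q = 0) :
    ∫ x in l₁..l₂, kinked p q (deriv (deriv fun y => e y * f₁ y))
        (deriv (deriv fun y => e y * f₂ y)) (deriv (deriv fun y => e y * f₃ y)) x * χ x
      = (∫ x in l₁..l₂, e x * kinked p q f₁ f₂ f₃ x * deriv (deriv χ) x)
        + (deriv f₁ p - deriv f₃ p) * χ p + (deriv f₃ q - deriv f₂ q) * χ q := by
  have c2 : ∀ {f : ℝ → ℝ}, ContDiff ℝ ∞ f → ContDiff ℝ ∞ (deriv (deriv f)) := fun hf =>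
    (contDiff_infty_iff_deriv.1 (contDiff_infty_iff_deriv.1 hf).2).2
  have g₁ := he.1.mul h₁
  have g₂ := he.1.mul h₂
  have g₃ := he.1.mul h₃
  -- Each piece vanishes at its boundary points, so in Green's formula only its slope there
  -- contributes.
  have hd : ∀ {f : ℝ → ℝ}, ContDiff ℝ ∞ f → ∀ x, f x = 0 →
      deriv (fun y => e y * f y) x = e x * deriv f x := by
    intro f hf x hx
    rw [deriv_fun_mul (he.1.differentiable (by norm_num) x) (hf.differentiable (by norm_num) x),
      hx, mul_zero, zero_add]
  have hdl : ∀ {f : ℝ → ℝ}, ContDiff ℝ ∞ f → ∀ x, x ∉ Ioo l₁ l₂ →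
      deriv (fun y => e y * f y) x = 0 := by
    intro f hf x hx
    rw [deriv_fun_mul (he.1.differentiable (by norm_num) x) (hf.differentiable (by norm_num) x),
      he.eq_zero hx, he.deriv.eq_zero hx]
    ring
  have hl1 : l₁ ∉ Ioo l₁ l₂ := fun h => lt_irrefl _ h.1
  have hl2 : l₂ ∉ Ioo l₁ l₂ := fun h => lt_irrefl _ h.2
  have e1 : ∀ x, kinked p q (deriv (deriv fun y => e y * f₁ y))
        (deriv (deriv fun y => e y * f₂ y)) (deriv (deriv fun y => e y * f₃ y)) x * χ x
      = kinked p q (fun x => deriv (deriv fun y => e y * f₁ y) x * χ x)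
        (fun x => deriv (deriv fun y => e y * f₂ y) x * χ x)
        (fun x => deriv (deriv fun y => e y * f₃ y) x * χ x) x := fun x => by
    simp only [kinked]; ring
  have e2 : ∀ x, e x * kinked p q f₁ f₂ f₃ x * deriv (deriv χ) x
      = kinked p q (fun x => e x * f₁ x * deriv (deriv χ) x)
        (fun x => e x * f₂ x * deriv (deriv χ) x) (fun x => e x * f₃ x * deriv (deriv χ) x) x :=
    fun x => by simp only [kinked]; ring
  simp_rw [e1, e2]
  rw [integral_kinked hp hq ((c2 g₁).continuous.fun_mul hχ.continuous)
      ((c2 g₂).continuous.fun_mul hχ.continuous) ((c2 g₃).continuous.fun_mul hχ.continuous),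
    integral_kinked hp hq (g₁.continuous.fun_mul (c2 hχ).continuous)
      (g₂.continuous.fun_mul (c2 hχ).continuous) (g₃.continuous.fun_mul (c2 hχ).continuous),
    integral_deriv_deriv_mul g₁ hχ, integral_deriv_deriv_mul g₂ hχ, integral_deriv_deriv_mul g₃ hχ,
    hd h₁ p z₁, hd h₂ q z₂, hd h₃ p z₃, hd h₃ q z₄, hdl h₁ l₁ hl1, hdl h₂ l₂ hl2,
    he.left, he.right, hep, heq, z₁, z₂, z₃, z₄]
  ring

theorem LocallyLipschitz.mul_real {X : Type*} [PseudoMetricSpace X] {f g : X → ℝ}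
    (hf : LocallyLipschitz f) (hg : LocallyLipschitz g) : LocallyLipschitz fun x => f x * g x :=
  ((contDiff_mul (𝕜 := ℝ) (𝔸 := ℝ) (n := 1)).locallyLipschitz).comp (hf.prodMk hg)

theorem LocallyLipschitz.add_real {X : Type*} [PseudoMetricSpace X] {f g : X → ℝ}
    (hf : LocallyLipschitz f) (hg : LocallyLipschitz g) : LocallyLipschitz fun x => f x + g x :=
  ((contDiff_add (𝕜 := ℝ) (F := ℝ) (n := 1)).locallyLipschitz).comp (hf.prodMk hg)

theorem LocallyLipschitz.wedge_real {X : Type*} [PseudoMetricSpace X] {f g : X → ℝ}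
    (hf : LocallyLipschitz f) (hg : LocallyLipschitz g) :
    LocallyLipschitz fun x => wedge (f x) (g x) :=
  LocallyLipschitz.comp (f := fun p : ℝ × ℝ => wedge p.1 p.2) (g := fun x => (f x, g x))
    lipschitz_wedge.locallyLipschitz (hf.prodMk hg)

/-! ### The temperature model: Lipschitz bounds, time derivative, kinks -/

namespace Ansatz

variable {A : Ansatz} {K : ℝ}

/-- The two cubics carry opposite differences of Heaviside functions and merge into one middle
piece. -/
theorem S_eq_kinked (A : Ansatz) (ε t x : ℝ) : A.S ε t x
    = kinked (A.φ 0 ε t) (A.φ 1 ε t) (fun y => A.γm 0 t * (A.φ 0 ε t - y))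
      (fun y => A.γp 1 t * (y - A.φ 1 ε t))
      (fun y => A.B (A.τ ε t) * A.Pin ε t y - (1 - A.B (A.τ ε t)) * A.Phat ε t y) x := by
  simp only [S, kinked]; ring

/-- No division by `ψ` occurs in this form. It yields the uniform Lipschitz bound in `x` and the
local Lipschitz continuity in time through collisions. -/
theorem S_eq_wedge (A : Ansatz) (ε t x : ℝ) : A.S ε t x
    = A.γm 0 t * max (A.φ 0 ε t - x) 0 + A.γp 1 t * max (x - A.φ 1 ε t) 0
      + (A.B (A.τ ε t) * A.γp 0 t - (1 - A.B (A.τ ε t)) * A.γm 0 t)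
        * wedge (x - A.φ 1 ε t) (A.φ 0 ε t - x)
      + (A.B (A.τ ε t) * A.γm 1 t - (1 - A.B (A.τ ε t)) * A.γp 1 t)
        * wedge (A.φ 0 ε t - x) (x - A.φ 1 ε t) := by
  have h1 : A.Pin ε t x * (heav (x - A.φ 0 ε t) - heav (x - A.φ 1 ε t)) = _ :=
    bump_mul_heav (A.γp 0 t) (A.γm 1 t) (A.φ 0 ε t) (A.φ 1 ε t) x
  have h2 : A.Phat ε t x * (heav (x - A.φ 0 ε t) - heav (x - A.φ 1 ε t)) = _ :=
    bump_mul_heav (A.γm 0 t) (A.γp 1 t) (A.φ 0 ε t) (A.φ 1 ε t) x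
  rw [← mul_heav_self, ← mul_heav_self]
  simp only [S]
  linear_combination A.B (A.τ ε t) * h1 - (1 - A.B (A.τ ε t)) * h2

/-- A Lipschitz constant in `x` for the temperature model. -/
noncomputable def lipS (K : ℝ) : ℝ := 2 * K + 2 * ((K * K + (1 + K) * K) * 8)

theorem UniformBounds.abs_S_sub_le (hK : A.UniformBounds K) (ε : ℝ) {t : ℝ} (ht : t ∈ Icc 0 A.t₁)
    (x y : ℝ) : |A.S ε t x - A.S ε t y| ≤ lipS K * |x - y| := by
  have hK0 := hK.nonneg
  have hB := hK.B (A.τ ε t)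
  have hB' : |1 - A.B (A.τ ε t)| ≤ 1 + K := (abs_sub _ _).trans (by simpa using hB)
  have hc : ∀ c d : ℝ, |c| ≤ K → |d| ≤ K →
      |A.B (A.τ ε t) * c - (1 - A.B (A.τ ε t)) * d| ≤ K * K + (1 + K) * K := by
    intro c d hc hd
    refine (abs_sub _ _).trans ?_
    rw [abs_mul, abs_mul]
    gcongr
  have e0 : ∀ p : ℝ, |(p - x) - (p - y)| = |x - y| := fun p => by
    rw [← abs_neg]; ring_nf
  have e1 : ∀ p : ℝ, |(x - p) - (y - p)| = |x - y| := fun p => by ring_nf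
  have w1 := abs_wedge_sub_le (x - A.φ 1 ε t) (A.φ 0 ε t - x) (y - A.φ 1 ε t) (A.φ 0 ε t - y)
  have w2 := abs_wedge_sub_le (A.φ 0 ε t - x) (x - A.φ 1 ε t) (A.φ 0 ε t - y) (y - A.φ 1 ε t)
  have w3 := abs_max_sub_max_le_abs (A.φ 0 ε t - x) (A.φ 0 ε t - y) 0
  have w4 := abs_max_sub_max_le_abs (x - A.φ 1 ε t) (y - A.φ 1 ε t) 0
  rw [e0, e1] at w1 w2
  rw [e0] at w3
  rw [e1] at w4
  have c1 := hc _ _ (hK.γp 0 t ht) (hK.γm 0 t ht)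
  have c2 := hc _ _ (hK.γm 1 t ht) (hK.γp 1 t ht)
  have hm : ∀ a b C D : ℝ, |a| ≤ C → |b| ≤ D → |a * b| ≤ C * D := by
    intro a b C D h h'
    rw [abs_mul]
    exact mul_le_mul h h' (abs_nonneg _) ((abs_nonneg _).trans h)
  have m1 := hm _ _ _ _ (hK.γm 0 t ht) w3
  have m2 := hm _ _ _ _ (hK.γp 1 t ht) w4
  have m3 := hm _ _ _ _ c1 w1
  have m4 := hm _ _ _ _ c2 w2
  rw [S_eq_wedge, S_eq_wedge, lipS]
  rw [abs_le] at *
  constructor <;> linarith [m1.1, m1.2, m2.1, m2.2, m3.1, m3.2, m4.1, m4.2]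

theorem lipS_nonneg (hK : 0 ≤ K) : 0 ≤ lipS K := by unfold lipS; positivity

namespace IsAdmissible

variable (hA : A.IsAdmissible)

include hA

theorem locallyLipschitz_S (ε : ℝ) : LocallyLipschitz fun p : ℝ × ℝ => A.S ε p.1 p.2 := by
  have ht : ∀ {f : ℝ → ℝ}, ContDiff ℝ 1 f → LocallyLipschitz fun p : ℝ × ℝ => f p.1 := fun hf =>
    (hf.comp contDiff_fst).locallyLipschitz
  have hφ : ∀ i, ContDiff ℝ 1 fun p : ℝ × ℝ => A.φ i ε p.1 := fun i =>
    ((hA.contDiff_φ i ε).of_le (by exact_mod_cast le_top)).comp contDiff_fst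
  have r0 : LocallyLipschitz fun p : ℝ × ℝ => A.φ 0 ε p.1 - p.2 :=
    ((hφ 0).sub contDiff_snd).locallyLipschitz
  have r1 : LocallyLipschitz fun p : ℝ × ℝ => p.2 - A.φ 1 ε p.1 :=
    (contDiff_snd.sub (hφ 1)).locallyLipschitz
  have hB : ContDiff ℝ 1 fun s => A.B (A.τ ε s) :=
    (hA.smooth_B.comp (hA.contDiff_τ ε)).of_le (by exact_mod_cast le_top)
  have hc : ∀ {c d : ℝ → ℝ}, ContDiff ℝ 1 c → ContDiff ℝ 1 d → LocallyLipschitz fun p : ℝ × ℝ =>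
      A.B (A.τ ε p.1) * c p.1 - (1 - A.B (A.τ ε p.1)) * d p.1 := by
    intro c d h h'
    exact ht (f := fun s => A.B (A.τ ε s) * c s - (1 - A.B (A.τ ε s)) * d s)
      ((hB.mul h).sub ((contDiff_const.sub hB).mul h'))
  have k1 := LocallyLipschitz.mul_real (ht (hA.smooth_γm 0)) (r0.max_const 0)
  have k2 := LocallyLipschitz.mul_real (ht (hA.smooth_γp 1)) (r1.max_const 0)
  have k3 := LocallyLipschitz.mul_real (hc (hA.smooth_γp 0) (hA.smooth_γm 0))
    (LocallyLipschitz.wedge_real r1 r0)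
  have k4 := LocallyLipschitz.mul_real (hc (hA.smooth_γm 1) (hA.smooth_γp 1))
    (LocallyLipschitz.wedge_real r0 r1)
  have k := LocallyLipschitz.add_real (LocallyLipschitz.add_real (LocallyLipschitz.add_real k1 k2)
    k3) k4
  simpa only [S_eq_wedge] using k

theorem continuous_S (ε : ℝ) : Continuous fun p : ℝ × ℝ => A.S ε p.1 p.2 :=
  (hA.locallyLipschitz_S ε).continuous

theorem continuous_S_x (ε t : ℝ) : Continuous (A.S ε t) :=
  (hA.continuous_S ε).comp (by fun_prop : Continuous fun x : ℝ => (t, x))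

/-- The time interval is enlarged by one on each side so that `0` and `t₁` are interior and
two-sided derivatives can be taken there. -/
theorem exists_lipschitz_S_t (ε : ℝ) : ∃ C : ℝ, 0 ≤ C ∧ ∀ s ∈ Icc (-1) (A.t₁ + 1),
    ∀ r ∈ Icc (-1) (A.t₁ + 1), ∀ x ∈ Icc A.l₁ A.l₂, |A.S ε s x - A.S ε r x| ≤ C * |s - r| := by
  obtain ⟨C, hC⟩ := ((hA.locallyLipschitz_S ε).locallyLipschitzOn
    (s := Icc (-1) (A.t₁ + 1) ×ˢ Icc A.l₁ A.l₂)).exists_lipschitzOnWith_of_compact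
    (isCompact_Icc.prod isCompact_Icc)
  refine ⟨C, C.2, fun s hs r hr x hx => ?_⟩
  have := hC.dist_le_mul (s, x) ⟨hs, hx⟩ (r, x) ⟨hr, hx⟩
  simpa [Prod.dist_eq, Real.dist_eq] using this

/-- Off the free boundaries the Heaviside factors are locally constant in time, and `ψ ≠ 0` makes
the cubics differentiable. -/
theorem differentiableAt_S_t {ε t x : ℝ} (hψ : A.ψ ε t ≠ 0) (h0 : x ≠ A.φ 0 ε t)
    (h1 : x ≠ A.φ 1 ε t) : DifferentiableAt ℝ (fun s => A.S ε s x) t := by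
  have hd : ∀ {f : ℝ → ℝ}, ContDiff ℝ 1 f → DifferentiableAt ℝ f t := fun hf =>
    hf.differentiable (by norm_num) t
  have hd' : ∀ {f : ℝ → ℝ}, ContDiff ℝ ∞ f → DifferentiableAt ℝ f t := fun hf =>
    hf.differentiable (by norm_num) t
  have φd : ∀ i, DifferentiableAt ℝ (A.φ i ε) t := fun i => hd' (hA.contDiff_φ i ε)
  have ψd : DifferentiableAt ℝ (A.ψ ε) t := hd' (hA.contDiff_ψ ε)
  have Bd : DifferentiableAt ℝ (fun s => A.B (A.τ ε s)) t :=
    hd' (hA.smooth_B.comp (hA.contDiff_τ ε))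
  have γmd := fun i => hd (hA.smooth_γm i)
  have γpd := fun i => hd (hA.smooth_γp i)
  have md : DifferentiableAt ℝ (A.mid ε) t := ((φd 0).add (φd 1)).div_const 2
  have hb : ∀ {c d : ℝ → ℝ}, DifferentiableAt ℝ c t → DifferentiableAt ℝ d t →
      DifferentiableAt ℝ (fun s => ((c s + d s) / 2 - (x - A.mid ε s) * (c s - d s) / A.ψ ε s)
        * ((A.φ 0 ε s - x) * (x - A.φ 1 ε s) / A.ψ ε s)) t := fun hc hd =>
    (((hc.add hd).div_const 2).sub (((md.const_sub x).mul (hc.sub hd)).div ψd hψ)).mul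
      ((((φd 0).sub_const x).mul ((φd 1).const_sub x)).div ψd hψ)
  have hh : ∀ {f s : ℝ → ℝ}, DifferentiableAt ℝ f t → DifferentiableAt ℝ s t → s t ≠ 0 →
      DifferentiableAt ℝ (fun r => f r * heav (s r)) t := fun hf hs h =>
    (hasDerivAt_mul_heav hf.hasDerivAt hs.continuousAt h).differentiableAt
  have k1 := hh ((γmd 0).mul ((φd 0).sub_const x)) ((φd 0).sub_const x) (sub_ne_zero.2 h0.symm)
  have k2 := hh ((γpd 1).mul ((φd 1).const_sub x)) ((φd 1).const_sub x) (sub_ne_zero.2 h1)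
  have g : DifferentiableAt ℝ
      (fun s => A.B (A.τ ε s) * A.Pin ε s x - (1 - A.B (A.τ ε s)) * A.Phat ε s x) t :=
    (Bd.mul (hb (γpd 0) (γmd 1))).sub ((Bd.const_sub 1).mul (hb (γmd 0) (γpd 1)))
  have k3 := hh g ((φd 0).const_sub x) (sub_ne_zero.2 h0)
  have k4 := hh g ((φd 1).const_sub x) (sub_ne_zero.2 h1)
  refine ((k1.add k2).add (k3.sub k4)).congr_of_eventuallyEq (Eventually.of_forall fun s => ?_)
  simp only [S_eq_kinked, kinked, Pi.add_apply, Pi.sub_apply, Pi.mul_apply]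
  ring

/-- The pairing of `e S` with a smooth function is Lipschitz in time, and is differentiable when
the free boundaries do not meet. -/
theorem hasDerivAt_integral_S {ε t : ℝ} (ht : t ∈ Icc 0 A.t₁) (hψ : A.ψ ε t ≠ 0)
    {χ : ℝ → ℝ} (hχ : Continuous χ) :
    IntervalIntegrable (fun x => A.e x * deriv (fun s => A.S ε s x) t * χ x) volume A.l₁ A.l₂ ∧
    HasDerivAt (fun s => ∫ x in A.l₁..A.l₂, A.e x * A.S ε s x * χ x)
      (∫ x in A.l₁..A.l₂, A.e x * deriv (fun s => A.S ε s x) t * χ x) t := by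
  obtain ⟨C, hC0, hC⟩ := hA.exists_lipschitz_S_t ε
  have hec := hA.test_e.1.continuous
  have hU : Ioo (-1) (A.t₁ + 1) ∈ 𝓝 t := Ioo_mem_nhds (by linarith [ht.1]) (by linarith [ht.2])
  have hcont : ∀ s, Continuous fun x => A.e x * A.S ε s x * χ x := fun s =>
    (hec.mul (hA.continuous_S_x ε s)).mul hχ
  refine intervalIntegral.hasDerivAt_integral_of_dominated_loc_of_lip
    (bound := fun x => |A.e x| * C * |χ x|) hU
    (Eventually.of_forall fun s => (hcont s).aestronglyMeasurable)
    ((hcont t).intervalIntegrable _ _) ?_ ?_ ?_ ?_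
  · have hS : Continuous (Function.uncurry fun x s => A.S ε s x) :=
      (hA.continuous_S ε).comp continuous_swap
    have := (measurable_deriv_with_param hS).comp (by fun_prop : Measurable fun x : ℝ => (x, t))
    exact ((hec.measurable.mul this).mul hχ.measurable).aestronglyMeasurable
  · refine Eventually.of_forall fun x hx => ?_
    rw [uIoc_of_le hA.l₁_lt_l₂.le] at hx
    refine LipschitzOnWith.of_dist_le_mul fun s hs r hr => ?_
    rw [Real.dist_eq, Real.dist_eq, Real.coe_nnabs,
      abs_of_nonneg (by positivity : (0 : ℝ) ≤ |A.e x| * C * |χ x|),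
      show A.e x * A.S ε s x * χ x - A.e x * A.S ε r x * χ x
        = A.e x * (A.S ε s x - A.S ε r x) * χ x by ring, abs_mul, abs_mul]
    have := hC s (Ioo_subset_Icc_self hs) r (Ioo_subset_Icc_self hr) x (Ioc_subset_Icc_self hx)
    calc _ ≤ |A.e x| * (C * |s - r|) * |χ x| := by gcongr
      _ = _ := by ring
  · have : Continuous fun x => |A.e x| * C * |χ x| := by fun_prop
    exact this.intervalIntegrable _ _
  · have h0 : ∀ i, ∀ᵐ x : ℝ, x ≠ A.φ i ε t := fun i =>
      (measure_eq_zero_iff_ae_notMem.1 (measure_singleton (A.φ i ε t)))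
    filter_upwards [h0 0, h0 1] with x hx0 hx1 _
    exact ((hA.differentiableAt_S_t hψ hx0 hx1).hasDerivAt.const_mul (A.e x)).mul_const (χ x)

/-- Differentiability is only available away from collisions; this bound justifies the fundamental
theorem of calculus across them. -/
theorem exists_lipschitz_integral_S (ε : ℝ) {χ : ℝ → ℝ} (hχ : Continuous χ) :
    ∃ C : NNReal, LipschitzOnWith C (fun s => ∫ x in A.l₁..A.l₂, A.e x * A.S ε s x * χ x)
      (Icc 0 A.t₁) := by
  obtain ⟨C, hC0, hC⟩ := hA.exists_lipschitz_S_t ε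
  have hec := hA.test_e.1.continuous
  have hcont : ∀ s, Continuous fun x => A.e x * A.S ε s x * χ x := fun s =>
    (hec.mul (hA.continuous_S_x ε s)).mul hχ
  have hcb : Continuous fun x => |A.e x| * C * |χ x| := by fun_prop
  obtain ⟨Z, hZ0, hZ⟩ := exists_abs_le_on_Icc hcb A.l₁ A.l₂
  have hl := hA.l₁_lt_l₂.le
  refine ⟨⟨Z * (A.l₂ - A.l₁), mul_nonneg hZ0 (by linarith)⟩,
    LipschitzOnWith.of_dist_le_mul fun s hs r hr => ?_⟩
  rw [Real.dist_eq, Real.dist_eq, ← intervalIntegral.integral_sub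
    ((hcont s).intervalIntegrable _ _) ((hcont r).intervalIntegrable _ _)]
  have hsub : Icc 0 A.t₁ ⊆ Icc (-1) (A.t₁ + 1) := Icc_subset_Icc (by norm_num) (by norm_num)
  have := intervalIntegral.norm_integral_le_of_norm_le_const (a := A.l₁) (b := A.l₂)
    (f := fun x => A.e x * A.S ε s x * χ x - A.e x * A.S ε r x * χ x) (C := Z * |s - r|) ?_
  · rw [Real.norm_eq_abs, abs_of_nonneg (sub_nonneg.2 hl)] at this
    refine this.trans (le_of_eq ?_)
    change Z * |s - r| * (A.l₂ - A.l₁) = Z * (A.l₂ - A.l₁) * |s - r|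
    ring
  · intro x hx
    rw [uIoc_of_le hl] at hx
    have hx' := Ioc_subset_Icc_self hx
    have h1 := hC s (hsub hs) r (hsub hr) x hx'
    have h2 := (le_abs_self _).trans (hZ x hx')
    rw [Real.norm_eq_abs, show A.e x * A.S ε s x * χ x - A.e x * A.S ε r x * χ x
        = A.e x * (A.S ε s x - A.S ε r x) * χ x by ring, abs_mul, abs_mul]
    calc _ ≤ |A.e x| * (C * |s - r|) * |χ x| := by gcongr
      _ = |A.e x| * C * |χ x| * |s - r| := by ring
      _ ≤ _ := by gcongr

end IsAdmissible

/-- The second derivative of `e S` in `x` off the free boundaries. -/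
noncomputable def regPart (A : Ansatz) (ε t : ℝ) : ℝ → ℝ :=
  kinked (A.φ 0 ε t) (A.φ 1 ε t)
    (deriv (deriv fun y => A.e y * (A.γm 0 t * (A.φ 0 ε t - y))))
    (deriv (deriv fun y => A.e y * (A.γp 1 t * (y - A.φ 1 ε t))))
    (deriv (deriv fun y =>
      A.e y * (A.B (A.τ ε t) * A.Pin ε t y - (1 - A.B (A.τ ε t)) * A.Phat ε t y)))

/-- The mass that the second derivative of the temperature has at the `i`th free boundary. -/
noncomputable def kinkMass (A : Ansatz) (i : Fin 2) (ε t : ℝ) : ℝ :=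
  A.B (A.τ ε t) * (A.γp i t + A.γm i t)

theorem contDiff_Pin (A : Ansatz) (ε t : ℝ) : ContDiff ℝ ∞ (A.Pin ε t) :=
  contDiff_bump (A.γp 0 t) (A.γm 1 t) (A.φ 0 ε t) (A.φ 1 ε t)

theorem contDiff_Phat (A : Ansatz) (ε t : ℝ) : ContDiff ℝ ∞ (A.Phat ε t) :=
  contDiff_bump (A.γm 0 t) (A.γp 1 t) (A.φ 0 ε t) (A.φ 1 ε t)

theorem contDiff_mixed (A : Ansatz) (ε t : ℝ) : ContDiff ℝ ∞ fun y =>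
    A.B (A.τ ε t) * A.Pin ε t y - (1 - A.B (A.τ ε t)) * A.Phat ε t y :=
  (contDiff_const.mul (A.contDiff_Pin ε t)).sub (contDiff_const.mul (A.contDiff_Phat ε t))

theorem contDiff_outer_left (A : Ansatz) (ε t : ℝ) :
    ContDiff ℝ ∞ fun y => A.γm 0 t * (A.φ 0 ε t - y) := by fun_prop

theorem contDiff_outer_right (A : Ansatz) (ε t : ℝ) :
    ContDiff ℝ ∞ fun y => A.γp 1 t * (y - A.φ 1 ε t) := by fun_prop

theorem deriv_bump_left (c d : ℝ) {p q : ℝ} (h : q - p ≠ 0) : deriv (bump c d p q) p = c := by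
  rw [(hasDerivAt_bump c d p q p).deriv]
  field_simp
  ring

theorem deriv_bump_right (c d : ℝ) {p q : ℝ} (h : q - p ≠ 0) : deriv (bump c d p q) q = -d := by
  rw [(hasDerivAt_bump c d p q q).deriv]
  field_simp
  ring

theorem deriv_mixed (A : Ansatz) (ε t x : ℝ) :
    deriv (fun y => A.B (A.τ ε t) * A.Pin ε t y - (1 - A.B (A.τ ε t)) * A.Phat ε t y) x
    = A.B (A.τ ε t) * deriv (A.Pin ε t) x - (1 - A.B (A.τ ε t)) * deriv (A.Phat ε t) x := by
  have h1 := (A.contDiff_Pin ε t).differentiable (by norm_num) x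
  have h2 := (A.contDiff_Phat ε t).differentiable (by norm_num) x
  exact ((h1.hasDerivAt.const_mul _).sub (h2.hasDerivAt.const_mul _)).deriv

theorem deriv_deriv_mixed (A : Ansatz) (ε t x : ℝ) :
    deriv (deriv fun y => A.B (A.τ ε t) * A.Pin ε t y - (1 - A.B (A.τ ε t)) * A.Phat ε t y) x
      = A.B (A.τ ε t) * deriv (deriv (A.Pin ε t)) x
        - (1 - A.B (A.τ ε t)) * deriv (deriv (A.Phat ε t)) x := by
  have e1 := ((contDiff_infty_iff_deriv.1 (A.contDiff_Pin ε t)).2).differentiable (by norm_num) x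
  have e2 := ((contDiff_infty_iff_deriv.1 (A.contDiff_Phat ε t)).2).differentiable (by norm_num) x
  rw [funext (A.deriv_mixed ε t)]
  exact ((e1.hasDerivAt.const_mul _).sub (e2.hasDerivAt.const_mul _)).deriv

/-- At `φ 0` the middle piece has slope `B γp - (1 - B) γm` and the outer piece `-γm`, so the jump
is `B (γp + γm)`; the computation at `φ 1` is analogous. The cubics have these slopes only if `ψ ≠
0`. -/
theorem integral_regPart (hA : A.IsAdmissible) {ε t : ℝ} (hε : ε ∈ Ioo 0 A.ε₀)
    (ht : t ∈ Icc 0 A.t₁) (hψ : A.ψ ε t ≠ 0) {χ : ℝ → ℝ} (hχ : ContDiff ℝ ∞ χ) :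
    ∫ x in A.l₁..A.l₂, A.regPart ε t x * χ x
      = (∫ x in A.l₁..A.l₂, A.e x * A.S ε t x * deriv (deriv χ) x)
        - ∑ i : Fin 2, A.kinkMass i ε t * χ (A.φ i ε t) := by
  have hz : ∀ c d p q : ℝ, bump c d p q p = 0 ∧ bump c d p q q = 0 := fun c d p q => by
    simp [bump]
  have z1 := hz (A.γp 0 t) (A.γm 1 t) (A.φ 0 ε t) (A.φ 1 ε t)
  have z2 := hz (A.γm 0 t) (A.γp 1 t) (A.φ 0 ε t) (A.φ 1 ε t)
  have hP : A.Pin ε t = bump (A.γp 0 t) (A.γm 1 t) (A.φ 0 ε t) (A.φ 1 ε t) := rfl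
  have hQ : A.Phat ε t = bump (A.γm 0 t) (A.γp 1 t) (A.φ 0 ε t) (A.φ 1 ε t) := rfl
  have h := integral_kinked_deriv_deriv (Ioo_subset_Icc_self (hA.φ_mem hε ht 0))
    (Ioo_subset_Icc_self (hA.φ_mem hε ht 1)) hA.test_e (hA.e_eq_one_at hε ht 0)
    (hA.e_eq_one_at hε ht 1) hχ (A.contDiff_outer_left ε t) (A.contDiff_outer_right ε t)
    (A.contDiff_mixed ε t) (by simp) (by simp) (by simp only [hP, hQ, z1, z2]; ring)
    (by simp only [hP, hQ, z1, z2]; ring)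
  have d1 : ∀ x, deriv (fun y => A.γm 0 t * (A.φ 0 ε t - y)) x = -A.γm 0 t := fun x => by
    simp
  have d2 : ∀ x, deriv (fun y => A.γp 1 t * (y - A.φ 1 ε t)) x = A.γp 1 t := fun x => by
    simp
  have hψ' : A.φ 1 ε t - A.φ 0 ε t ≠ 0 := hψ
  rw [deriv_mixed, deriv_mixed, d1, d2, hP, hQ, deriv_bump_left _ _ hψ', deriv_bump_left _ _ hψ',
    deriv_bump_right _ _ hψ', deriv_bump_right _ _ hψ'] at h
  simp only [← hP, ← hQ, ← S_eq_kinked] at h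
  rw [regPart, h, Fin.sum_univ_two, kinkMass, kinkMass]
  ring

theorem deriv_deriv_mul {f g : ℝ → ℝ} (hf : ContDiff ℝ ∞ f) (hg : ContDiff ℝ ∞ g) (x : ℝ) :
    deriv (deriv fun y => f y * g y) x
      = deriv (deriv f) x * g x + 2 * deriv f x * deriv g x + f x * deriv (deriv g) x := by
  have hd : ∀ {f : ℝ → ℝ}, ContDiff ℝ ∞ f → ∀ x, HasDerivAt f (deriv f x) x := fun hf x =>
    (hf.differentiable (by norm_num) x).hasDerivAt
  have h1 : deriv (fun y => f y * g y) = fun y => deriv f y * g y + f y * deriv g y :=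
    funext fun y => ((hd hf y).mul (hd hg y)).deriv
  rw [h1]
  have hf1 := (contDiff_infty_iff_deriv.1 hf).2
  have hg1 := (contDiff_infty_iff_deriv.1 hg).2
  refine (((hd hf1 x).mul (hd hg x)).add ((hd hf x).mul (hd hg1 x))).deriv.trans ?_
  ring

/-- The prescribed source is `-L(e S)` written out by the product rule. The outer pieces are affine,
so only the cubics contribute second derivatives besides those of `e`. -/
theorem rhs_eq (hA : A.IsAdmissible) {ε t x : ℝ} (h0 : x ≠ A.φ 0 ε t) (h1 : x ≠ A.φ 1 ε t) :
    A.rhs ε t x = -(A.e x * deriv (fun s => A.S ε s x) t) + A.regPart ε t x := by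
  have hS : A.S ε t = kinked (A.φ 0 ε t) (A.φ 1 ε t) (fun y => A.γm 0 t * (A.φ 0 ε t - y))
      (fun y => A.γp 1 t * (y - A.φ 1 ε t))
      (fun y => A.B (A.τ ε t) * A.Pin ε t y - (1 - A.B (A.τ ε t)) * A.Phat ε t y) :=
    funext (A.S_eq_kinked ε t)
  have c1 := A.contDiff_outer_left ε t
  have c2 := A.contDiff_outer_right ε t
  have c3 := A.contDiff_mixed ε t
  have hSx := (hasDerivAt_kinked (c1.differentiable (by norm_num) x)
    (c2.differentiable (by norm_num) x) (c3.differentiable (by norm_num) x) h0 h1).deriv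
  rw [← hS] at hSx
  have d1 : deriv (fun y => A.γm 0 t * (A.φ 0 ε t - y)) = fun _ => -A.γm 0 t := funext fun x => by
    simp
  have d2 : deriv (fun y => A.γp 1 t * (y - A.φ 1 ε t)) = fun _ => A.γp 1 t := funext fun x => by
    simp
  rw [rhs, Freg, hSx, S_eq_kinked, regPart]
  simp only [kinked]
  rw [deriv_deriv_mul hA.test_e.1 c1, deriv_deriv_mul hA.test_e.1 c2,
    deriv_deriv_mul hA.test_e.1 c3, d1, d2, deriv_deriv_mixed]
  simp only [deriv_const]
  ring

theorem continuous_deriv_deriv {f : ℝ → ℝ} (hf : ContDiff ℝ ∞ f) : Continuous (deriv (deriv f)) :=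
  (contDiff_infty_iff_deriv.1 (contDiff_infty_iff_deriv.1 hf).2).2.continuous

theorem intervalIntegrable_regPart (hA : A.IsAdmissible) (ε t a b : ℝ) :
    IntervalIntegrable (A.regPart ε t) volume a b :=
  intervalIntegrable_kinked (continuous_deriv_deriv (hA.test_e.1.mul (A.contDiff_outer_left ε t)))
    (continuous_deriv_deriv (hA.test_e.1.mul (A.contDiff_outer_right ε t)))
    (continuous_deriv_deriv (hA.test_e.1.mul (A.contDiff_mixed ε t))) a b

/-- The right-hand side of the equation for `q + e I` in weak form. -/
theorem integral_rhs (hA : A.IsAdmissible) {ε t : ℝ} (hε : ε ∈ Ioo 0 A.ε₀)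
    (ht : t ∈ Icc 0 A.t₁) (hψ : A.ψ ε t ≠ 0) {χ : ℝ → ℝ} (hχ : ContDiff ℝ ∞ χ) :
    ∫ x in A.l₁..A.l₂, A.rhs ε t x * χ x
      = -deriv (fun s => ∫ x in A.l₁..A.l₂, A.e x * A.S ε s x * χ x) t
        + ((∫ x in A.l₁..A.l₂, A.e x * A.S ε t x * deriv (deriv χ) x)
        - ∑ i : Fin 2, A.kinkMass i ε t * χ (A.φ i ε t)) := by
  obtain ⟨hi, hd⟩ := hA.hasDerivAt_integral_S ht hψ hχ.continuous
  have h0 : ∀ i, ∀ᵐ x : ℝ, x ≠ A.φ i ε t := fun i =>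
    (measure_eq_zero_iff_ae_notMem.1 (measure_singleton (A.φ i ε t)))
  have hi' : IntervalIntegrable (fun x => -(A.e x * deriv (fun s => A.S ε s x) t * χ x)) volume
      A.l₁ A.l₂ := hi.neg
  rw [hd.deriv, ← integral_regPart hA hε ht hψ hχ, ← intervalIntegral.integral_neg,
    ← intervalIntegral.integral_add hi'
      ((intervalIntegrable_regPart hA ε t _ _).mul_continuousOn hχ.continuous.continuousOn)]
  refine intervalIntegral.integral_congr_ae ?_
  filter_upwards [h0 0, h0 1] with x hx0 hx1 _
  rw [rhs_eq hA hx0 hx1]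
  ring

end Ansatz

/-! ### The heat equation with point sources for the whole temperature -/

theorem absolutelyContinuousOnInterval_of_contDiff {f : ℝ → ℝ} (hf : ContDiff ℝ 1 f) (a b : ℝ) :
    AbsolutelyContinuousOnInterval f a b := by
  obtain ⟨C, hC⟩ := ((hf.locallyLipschitz).locallyLipschitzOn
    (s := uIcc a b)).exists_lipschitzOnWith_of_compact isCompact_uIcc
  exact hC.absolutelyContinuousOnInterval

/-- Both variables are clamped to the rectangle. -/
theorem exists_continuous_extension {f : ℝ → ℝ → ℝ} {a b c d : ℝ} (hab : a ≤ b) (hcd : c ≤ d)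
    (hf : ContinuousOn (fun p : ℝ × ℝ => f p.1 p.2) (Icc a b ×ˢ Icc c d)) :
    ∃ g : ℝ → ℝ → ℝ, Continuous (fun p : ℝ × ℝ => g p.1 p.2) ∧
      ∀ s ∈ Icc a b, ∀ x ∈ Icc c d, g s x = f s x := by
  refine ⟨fun s x => f (projIcc a b hab s) (projIcc c d hcd x), ?_, fun s hs x hx => ?_⟩
  · refine hf.comp_continuous
      (f := fun p : ℝ × ℝ => ((projIcc a b hab p.1 : ℝ), (projIcc c d hcd p.2 : ℝ))) ?_
      fun p => ⟨Subtype.coe_prop _, Subtype.coe_prop _⟩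
    exact (continuous_subtype_val.comp (continuous_projIcc.comp continuous_fst)).prodMk
      (continuous_subtype_val.comp (continuous_projIcc.comp continuous_snd))
  · simp only [projIcc_of_mem hab hs, projIcc_of_mem hcd hx]

theorem continuousOn_integral_mul {f : ℝ → ℝ → ℝ} {a b c d : ℝ} (hab : a ≤ b) (hcd : c ≤ d)
    (hf : ContinuousOn (fun p : ℝ × ℝ => f p.1 p.2) (Icc a b ×ˢ Icc c d)) {χ : ℝ → ℝ}
    (hχ : Continuous χ) : ContinuousOn (fun s => ∫ x in c..d, f s x * χ x) (Icc a b) := by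
  obtain ⟨g, hg, hgf⟩ := exists_continuous_extension hab hcd hf
  have h := intervalIntegral.continuous_parametric_intervalIntegral_of_continuous' (μ := volume)
    (f := fun s x => g s x * χ x) (hg.mul (hχ.comp continuous_snd)) c d
  refine h.continuousOn.congr fun s hs => ?_
  refine intervalIntegral.integral_congr fun x hx => ?_
  rw [uIcc_of_le hcd] at hx
  simp only [hgf s hs x hx]

/-- Mean value inequality for `z ↦ f z - f'(x) z` between `x` and `y`. -/
theorem abs_sub_sub_mul_le {f : ℝ → ℝ} {K a b x y : ℝ} (hf : ContDiff ℝ 1 f)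
    (hK : ∀ z ∈ Icc a b, |deriv f x - deriv f z| ≤ K * |x - z|) (hK0 : 0 ≤ K)
    (hx : x ∈ Icc a b) (hy : y ∈ Icc a b) :
    |f y - f x - deriv f x * (y - x)| ≤ K * |y - x| * |y - x| := by
  have hd := hf.differentiable (by norm_num)
  have h := Convex.norm_image_sub_le_of_norm_hasDerivWithin_le (s := uIcc x y)
    (f := fun z => f z - deriv f x * z) (f' := fun z => deriv f z - deriv f x)
    (C := K * |y - x|) (fun z _ => (((hd z).hasDerivAt.sub
      ((hasDerivAt_id z).const_mul (deriv f x))).congr_deriv (by simp)).hasDerivWithinAt)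
    (fun z hz => ?_) (convex_uIcc x y) left_mem_uIcc right_mem_uIcc
  · rw [Real.norm_eq_abs, Real.norm_eq_abs] at h
    refine le_trans (le_of_eq ?_) h
    congr 1; ring
  · have hz' : z ∈ Icc a b := uIcc_subset_Icc hx hy hz
    rw [Real.norm_eq_abs, ← abs_neg, neg_sub]
    refine (hK z hz').trans (mul_le_mul_of_nonneg_left ?_ hK0)
    have := abs_sub_left_of_mem_uIcc hz
    rwa [abs_sub_comm x z]

namespace Ansatz

variable {A : Ansatz} {K : ℝ}

/-- The temperature without `q̌`. -/
noncomputable def excess (A : Ansatz) (ε t x : ℝ) : ℝ := A.e x * A.T ε t x + A.qh ε t x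

theorem excess_eq (A : Ansatz) (ε t x : ℝ) :
    A.excess ε t x = A.e x * A.S ε t x + (A.qeI ε t x - A.qc ε t x) := by
  simp only [excess, T, qeI]; ring

theorem θ_eq (A : Ansatz) (ε t x : ℝ) : A.θ ε t x = A.excess ε t x + A.qc ε t x := by
  simp only [excess, θ]; ring

namespace IsAdmissible

variable (hA : A.IsAdmissible)

include hA

theorem continuousOn_I {ε : ℝ} (hε : ε ∈ Ioo 0 A.ε₀) :
    ContinuousOn (fun p : ℝ × ℝ => A.I ε p.1 p.2) (Icc 0 A.t₁ ×ˢ Icc A.l₁ A.l₂) := by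
  have h1 : ContinuousOn (fun p : ℝ × ℝ => A.κ ε p.1) (Icc 0 A.t₁ ×ˢ Icc A.l₁ A.l₂) :=
    (hA.continuous_κ ε hε).comp continuousOn_fst fun p hp => hp.1
  have h2 : ∀ i, Continuous fun p : ℝ × ℝ => A.φt i ε p.1 := fun i =>
    (hA.contDiff_φt i ε).continuous.comp continuous_fst
  have h3 : ∀ i, Continuous fun p : ℝ × ℝ => A.φ i ε p.1 := fun i =>
    (hA.contDiff_φ i ε).continuous.comp continuous_fst
  have h4 : Continuous fun p : ℝ × ℝ => (A.φt 0 ε p.1 - A.φt 1 ε p.1) / 2 :=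
    ((h2 0).sub (h2 1)).div_const 2
  have h5 : Continuous fun p : ℝ × ℝ => p.2 - A.mid ε p.1 :=
    continuous_snd.sub (((h3 0).add (h3 1)).div_const 2)
  exact h4.continuousOn.sub (h5.continuousOn.mul h1)

omit hA in
theorem contDiff_I_x (ε t : ℝ) : ContDiff ℝ ∞ (A.I ε t) :=
  contDiff_const.sub ((contDiff_id.sub contDiff_const).mul contDiff_const)

theorem continuousOn_qc {ε : ℝ} (hε : ε ∈ Ioo 0 A.ε₀) :
    ContinuousOn (fun p : ℝ × ℝ => A.qc ε p.1 p.2) (Icc 0 A.t₁ ×ˢ Icc A.l₁ A.l₂) := by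
  obtain ⟨K, hK⟩ := hA.bounds_qc
  have h : LipschitzOnWith (Real.toNNReal K + Real.toNNReal K)
      (fun p : ℝ × ℝ => A.qc ε p.1 p.2) (Icc 0 A.t₁ ×ˢ Icc A.l₁ A.l₂) := by
    refine LipschitzOnWith.of_dist_le_mul fun p hp r hr => ?_
    have h1 : |A.qc ε p.1 p.2 - A.qc ε p.1 r.2| ≤ K * |p.2 - r.2| :=
      Convex.norm_image_sub_le_of_norm_deriv_le (s := Icc A.l₁ A.l₂)
        (fun z _ => (hA.smooth_qc ε hε p.1 hp.1).differentiable (by norm_num) z)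
        (fun z hz => (hK ε hε p.1 hp.1 z hz).2.1) (convex_Icc _ _) hr.2 hp.2
    have h2 := (hK ε hε p.1 hp.1 r.2 hr.2).2.2.1 r.1 hr.1
    have hK' : 0 ≤ K := (abs_nonneg _).trans (hK ε hε p.1 hp.1 p.2 hp.2).1
    have h3 : |p.1 - r.1| ≤ dist p r := le_max_left _ _
    have h4 : |p.2 - r.2| ≤ dist p r := le_max_right _ _
    rw [Real.dist_eq, NNReal.coe_add, Real.coe_toNNReal _ hK']
    have h5 := abs_sub_le (A.qc ε p.1 p.2) (A.qc ε p.1 r.2) (A.qc ε r.1 r.2)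
    nlinarith
  exact h.continuousOn

/-- No regularity of `∂q̌/∂x` in time is assumed. Difference quotients in `x` are continuous in time
and, since `∂q̌/∂x` is Lipschitz in `x`, converge to the derivative uniformly in time. -/
theorem continuousOn_deriv_qc {ε : ℝ} (hε : ε ∈ Ioo 0 A.ε₀) {x : ℝ} (hx : x ∈ Icc A.l₁ A.l₂) :
    ContinuousOn (fun s => deriv (A.qc ε s) x) (Icc 0 A.t₁) := by
  obtain ⟨K, hK⟩ := hA.bounds_qc
  have hl := hA.l₁_lt_l₂
  have hK0 : 0 ≤ K := (abs_nonneg _).trans (hK ε hε 0 ⟨le_rfl, hA.t₁_pos.le⟩ x hx).1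
  refine continuousOn_of_uniform_approx_of_continuousOn fun u hu => ?_
  obtain ⟨r, hr, hru⟩ := Metric.mem_uniformity_dist.1 hu
  -- The second node is taken towards the farther endpoint, so that it stays in the interval, and
  -- close enough for the error of the quotient to be below `r`.
  obtain ⟨y, hy, hyx, hyr⟩ : ∃ y ∈ Icc A.l₁ A.l₂, y ≠ x ∧ K * |y - x| < r := by
    set d := min ((A.l₂ - A.l₁) / 2) (r / (K + 1)) with hd
    have hd0 : 0 < d := lt_min (by linarith) (by positivity)
    have hd1 : d ≤ (A.l₂ - A.l₁) / 2 := min_le_left _ _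
    have hd2 : K * d < r := by
      have := min_le_right ((A.l₂ - A.l₁) / 2) (r / (K + 1))
      rw [← hd, le_div_iff₀ (by positivity)] at this
      nlinarith
    rcases le_total x ((A.l₁ + A.l₂) / 2) with h | h
    · refine ⟨x + d, ⟨by linarith [hx.1], by linarith⟩, by linarith, ?_⟩
      rwa [add_sub_cancel_left, abs_of_pos hd0]
    · refine ⟨x - d, ⟨by linarith, by linarith [hx.2]⟩, by linarith, ?_⟩
      rwa [sub_sub_cancel_left, abs_neg, abs_of_pos hd0]
  have hq : ∀ z ∈ Icc A.l₁ A.l₂, ContinuousOn (fun s => A.qc ε s z) (Icc 0 A.t₁) := fun z hz =>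
    (hA.continuousOn_qc hε).comp (by fun_prop : ContinuousOn (fun s : ℝ => (s, z)) _)
      fun s hs => ⟨hs, hz⟩
  refine ⟨fun s => (A.qc ε s y - A.qc ε s x) / (y - x),
    ((hq y hy).sub (hq x hx)).div_const _, fun s hs => hru ?_⟩
  have h := abs_sub_sub_mul_le (hA.smooth_qc ε hε s hs)
    (fun z hz => (hK ε hε s hs x hx).2.2.2 z hz) hK0 hx hy
  have hp : 0 < |y - x| := abs_pos.2 (sub_ne_zero.2 hyx)
  have h2 : (A.qc ε s y - A.qc ε s x) / (y - x) - deriv (A.qc ε s) x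
      = (A.qc ε s y - A.qc ε s x - deriv (A.qc ε s) x * (y - x)) / (y - x) := by
    have := sub_ne_zero.2 hyx
    field_simp
  rw [dist_comm, Real.dist_eq, h2, abs_div, div_lt_iff₀ hp]
  nlinarith

variable {bc : BoundaryCondition} (hq : A.SolvesHeat bc)

include hq

theorem continuousOn_excess {ε : ℝ} (hε : ε ∈ Ioo 0 A.ε₀) :
    ContinuousOn (fun p : ℝ × ℝ => A.excess ε p.1 p.2) (Icc 0 A.t₁ ×ˢ Icc A.l₁ A.l₂) :=
  ((hA.test_e.1.continuous.comp continuous_snd).continuousOn.mul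
    ((hA.continuous_S ε).continuousOn.add (hA.continuousOn_I hε))).add (hq.continuous_qh ε hε)

theorem continuousOn_θ {ε : ℝ} (hε : ε ∈ Ioo 0 A.ε₀) :
    ContinuousOn (fun p : ℝ × ℝ => A.θ ε p.1 p.2) (Icc 0 A.t₁ ×ˢ Icc A.l₁ A.l₂) := by
  simp only [θ_eq]
  exact (hA.continuousOn_excess hq hε).add (hA.continuousOn_qc hε)

theorem absCont_qeI {ε t : ℝ} (hε : ε ∈ Ioo 0 A.ε₀) (ht : t ∈ Icc 0 A.t₁) :
    AbsolutelyContinuousOnInterval (A.qeI ε t) A.l₁ A.l₂ :=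
  ((absolutelyContinuousOnInterval_of_contDiff (hA.smooth_qc ε hε t ht) _ _).fun_add
    (hq.absCont_qh ε hε t ht)).fun_add (absolutelyContinuousOnInterval_of_contDiff
      ((hA.test_e.1.mul (contDiff_I_x ε t)).of_le (by exact_mod_cast le_top)) _ _)

omit hq in
theorem absCont_eS (ε : ℝ) {t : ℝ} (ht : t ∈ Icc 0 A.t₁) :
    AbsolutelyContinuousOnInterval (fun x => A.e x * A.S ε t x) A.l₁ A.l₂ := by
  obtain ⟨K, hK⟩ := hA.exists_uniformBounds
  have h : LipschitzOnWith (Real.toNNReal (lipS K)) (A.S ε t) (uIcc A.l₁ A.l₂) := by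
    refine LipschitzOnWith.of_dist_le_mul fun x _ y _ => ?_
    rw [Real.dist_eq, Real.dist_eq, Real.coe_toNNReal _ (lipS_nonneg hK.nonneg)]
    exact hK.abs_S_sub_le ε ht x y
  exact (absolutelyContinuousOnInterval_of_contDiff
    (hA.test_e.1.of_le (by exact_mod_cast le_top)) _ _).fun_mul h.absolutelyContinuousOnInterval

theorem absCont_θ {ε t : ℝ} (hε : ε ∈ Ioo 0 A.ε₀) (ht : t ∈ Icc 0 A.t₁) :
    AbsolutelyContinuousOnInterval (A.θ ε t) A.l₁ A.l₂ := by
  have h := (hA.absCont_eS ε ht).fun_add (hA.absCont_qeI hq hε ht)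
  have h2 : A.θ ε t = fun x => A.e x * A.S ε t x + A.qeI ε t x := by
    funext x; rw [θ_eq, excess_eq]; ring
  rwa [h2]

end IsAdmissible

/-- The contribution of `q̌` to the heat flow, tested against `χ`. -/
noncomputable def fluxQc (A : Ansatz) (χ : ℝ → ℝ) (ε s : ℝ) : ℝ :=
  deriv (A.qc ε s) A.l₂ * χ A.l₂ - deriv (A.qc ε s) A.l₁ * χ A.l₁
    - ∫ x in A.l₁..A.l₂, deriv (A.qc ε s) x * deriv χ x

/-- The rate of change of the temperature, tested against `χ`. -/
noncomputable def heatRate (A : Ansatz) (χ : ℝ → ℝ) (ε s : ℝ) : ℝ :=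
  A.fluxQc χ ε s + (∫ x in A.l₁..A.l₂, A.excess ε s x * deriv (deriv χ) x)
    - ∑ i : Fin 2, A.kinkMass i ε s * χ (A.φ i ε s)

namespace IsAdmissible

variable (hA : A.IsAdmissible)

include hA

theorem integral_deriv_qc {ε t : ℝ} (hε : ε ∈ Ioo 0 A.ε₀) (ht : t ∈ Icc 0 A.t₁) {χ : ℝ → ℝ}
    (hχ : ContDiff ℝ ∞ χ) : ∫ x in A.l₁..A.l₂, deriv (A.qc ε t) x * deriv χ x
      = A.qc ε t A.l₂ * deriv χ A.l₂ - A.qc ε t A.l₁ * deriv χ A.l₁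
        - ∫ x in A.l₁..A.l₂, A.qc ε t x * deriv (deriv χ) x := by
  have h1 := absolutelyContinuousOnInterval_of_contDiff (hA.smooth_qc ε hε t ht) A.l₁ A.l₂
  have h2 := absolutelyContinuousOnInterval_of_contDiff
    ((contDiff_infty_iff_deriv.1 hχ).2.of_le (by exact_mod_cast le_top)) A.l₁ A.l₂
  linarith [h1.integral_mul_deriv_eq_deriv_mul h2]

theorem continuousOn_fluxQc {ε : ℝ} (hε : ε ∈ Ioo 0 A.ε₀) {χ : ℝ → ℝ} (hχ : ContDiff ℝ ∞ χ) :
    ContinuousOn (A.fluxQc χ ε) (Icc 0 A.t₁) := by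
  have hl := hA.l₁_lt_l₂.le
  have m1 : A.l₁ ∈ Icc A.l₁ A.l₂ := left_mem_Icc.2 hl
  have m2 : A.l₂ ∈ Icc A.l₁ A.l₂ := right_mem_Icc.2 hl
  have hqz : ∀ z ∈ Icc A.l₁ A.l₂, ContinuousOn (fun s => A.qc ε s z) (Icc 0 A.t₁) := fun z hz =>
    (hA.continuousOn_qc hε).comp (by fun_prop : ContinuousOn (fun s : ℝ => (s, z)) _)
      fun s hs => ⟨hs, hz⟩
  have h1 := continuousOn_integral_mul hA.t₁_pos.le hl (hA.continuousOn_qc hε)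
    (continuous_deriv_deriv hχ)
  have h2 : ContinuousOn (fun s => deriv (A.qc ε s) A.l₂ * χ A.l₂ - deriv (A.qc ε s) A.l₁ * χ A.l₁
      - (A.qc ε s A.l₂ * deriv χ A.l₂ - A.qc ε s A.l₁ * deriv χ A.l₁
        - ∫ x in A.l₁..A.l₂, A.qc ε s x * deriv (deriv χ) x)) (Icc 0 A.t₁) :=
    (((hA.continuousOn_deriv_qc hε m2).mul continuousOn_const).sub
      ((hA.continuousOn_deriv_qc hε m1).mul continuousOn_const)).sub
      ((((hqz _ m2).mul continuousOn_const).sub ((hqz _ m1).mul continuousOn_const)).sub h1)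
  exact h2.congr fun s hs => by rw [fluxQc, hA.integral_deriv_qc hε hs hχ]

variable {bc : BoundaryCondition} (hq : A.SolvesHeat bc)

include hq

theorem continuousOn_heatRate {ε : ℝ} (hε : ε ∈ Ioo 0 A.ε₀) {χ : ℝ → ℝ} (hχ : ContDiff ℝ ∞ χ) :
    ContinuousOn (A.heatRate χ ε) (Icc 0 A.t₁) := by
  refine ((hA.continuousOn_fluxQc hε hχ).add (continuousOn_integral_mul hA.t₁_pos.le
    hA.l₁_lt_l₂.le (hA.continuousOn_excess hq hε) (continuous_deriv_deriv hχ))).sub ?_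
  refine Continuous.continuousOn (continuous_finsetSum _ fun i _ => ?_)
  exact ((hA.smooth_B.continuous.comp (hA.contDiff_τ ε).continuous).mul
    ((hA.smooth_γp i).continuous.add (hA.smooth_γm i).continuous)).mul
    (hχ.continuous.comp (hA.contDiff_φ i ε).continuous)

/-- Only the boundary terms of `q̌` survive: for Dirichlet conditions `q̂` and `e` vanish at the
ends, for Neumann conditions the derivative of `χ` does. -/
theorem integral_deriv_qeI {ε t : ℝ} (hε : ε ∈ Ioo 0 A.ε₀) (ht : t ∈ Icc 0 A.t₁) {χ : ℝ → ℝ}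
    (hχ : ContDiff ℝ ∞ χ)
    (hN : bc = BoundaryCondition.neumann → deriv χ A.l₁ = 0 ∧ deriv χ A.l₂ = 0) :
    ∫ x in A.l₁..A.l₂, deriv (A.qeI ε t) x * deriv χ x
      = (∫ x in A.l₁..A.l₂, deriv (A.qc ε t) x * deriv χ x)
        - ∫ x in A.l₁..A.l₂, (A.qeI ε t x - A.qc ε t x) * deriv (deriv χ) x := by
  have h1 := hA.absCont_qeI hq hε ht
  have h2 := absolutelyContinuousOnInterval_of_contDiff
    ((contDiff_infty_iff_deriv.1 hχ).2.of_le (by exact_mod_cast le_top)) A.l₁ A.l₂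
  have h3 := h1.integral_mul_deriv_eq_deriv_mul h2
  have hc := continuous_deriv_deriv hχ
  have hi1 : IntervalIntegrable (fun x => A.qeI ε t x * deriv (deriv χ) x) volume A.l₁ A.l₂ :=
    (h1.continuousOn.mul hc.continuousOn).intervalIntegrable
  have hi2 : IntervalIntegrable (fun x => A.qc ε t x * deriv (deriv χ) x) volume A.l₁ A.l₂ :=
    ((hA.smooth_qc ε hε t ht).continuous.mul hc).intervalIntegrable _ _
  have hb : ∀ y ∈ ({A.l₁, A.l₂} : Set ℝ), A.qeI ε t y * deriv χ y = A.qc ε t y * deriv χ y := by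
    intro y hy
    have he : A.e y = 0 := by
      rcases hy with rfl | rfl
      · exact hA.test_e.left
      · exact hA.test_e.right
    cases bc with
    | dirichlet =>
      have hb := hq.boundary rfl ε hε t ht
      have hy0 : A.qh ε t y = 0 := by
        rcases hy with rfl | rfl
        · exact hb.1
        · exact hb.2
      simp [qeI, he, hy0]
    | neumann =>
      have hb := hN rfl
      have hy0 : deriv χ y = 0 := by
        rcases hy with rfl | rfl
        · exact hb.1
        · exact hb.2
      simp [hy0]
  have e1 := hb A.l₁ (by simp)
  have e2 := hb A.l₂ (by simp)
  simp_rw [sub_mul]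
  rw [intervalIntegral.integral_sub hi1 hi2, hA.integral_deriv_qc hε ht hχ]
  linarith

theorem continuousOn_excess_x {ε t : ℝ} (hε : ε ∈ Ioo 0 A.ε₀) (ht : t ∈ Icc 0 A.t₁) :
    ContinuousOn (A.excess ε t) (Icc A.l₁ A.l₂) :=
  (hA.continuousOn_excess hq hε).comp (by fun_prop : ContinuousOn (fun x : ℝ => (t, x)) _)
    fun _ hx => ⟨ht, hx⟩

theorem integral_θ_mul {ε t : ℝ} (hε : ε ∈ Ioo 0 A.ε₀) (ht : t ∈ Icc 0 A.t₁) {χ : ℝ → ℝ}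
    (hχ : Continuous χ) : ∫ x in A.l₁..A.l₂, A.θ ε t x * χ x
      = (∫ x in A.l₁..A.l₂, A.excess ε t x * χ x) + ∫ x in A.l₁..A.l₂, A.qc ε t x * χ x := by
  have h1 : IntervalIntegrable (fun x => A.qc ε t x * χ x) volume A.l₁ A.l₂ :=
    ((hA.smooth_qc ε hε t ht).continuous.mul hχ).intervalIntegrable _ _
  have h2 : IntervalIntegrable (fun x => A.excess ε t x * χ x) volume A.l₁ A.l₂ := by
    refine ContinuousOn.intervalIntegrable ?_
    rw [uIcc_of_le hA.l₁_lt_l₂.le]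
    exact (hA.continuousOn_excess_x hq hε ht).mul hχ.continuousOn
  rw [← intervalIntegral.integral_add h2 h1]
  refine intervalIntegral.integral_congr fun x _ => ?_
  simp only [θ_eq]; ring

/-- The heat equation for the whole temperature, tested against a smooth function that obeys the
boundary conditions. -/
theorem integral_heatRate {ε t : ℝ} (hε : ε ∈ Ioo 0 A.ε₀) (ht : t ∈ Icc 0 A.t₁) {χ : ℝ → ℝ}
    (hχ : ContDiff ℝ ∞ χ)
    (hD : bc = BoundaryCondition.dirichlet → χ A.l₁ = 0 ∧ χ A.l₂ = 0)
    (hN : bc = BoundaryCondition.neumann → deriv χ A.l₁ = 0 ∧ deriv χ A.l₂ = 0) :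
    (∫ x in A.l₁..A.l₂, A.θ ε t x * χ x) - (∫ x in A.l₁..A.l₂, A.θ ε 0 x * χ x)
      = ∫ s in (0 : ℝ)..t, A.heatRate χ ε s := by
  have h0 : (0 : ℝ) ∈ Icc 0 A.t₁ := left_mem_Icc.2 hA.t₁_pos.le
  have hsub : uIcc 0 t ⊆ Icc 0 A.t₁ := by
    rw [uIcc_of_le ht.1]; exact Icc_subset_Icc_right ht.2
  obtain ⟨C, hC⟩ := hA.exists_lipschitz_integral_S ε hχ.continuous
  have hM := (hC.mono hsub).absolutelyContinuousOnInterval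
  have hsplit : ∀ s ∈ Icc 0 A.t₁, ∫ x in A.l₁..A.l₂, A.θ ε s x * χ x
      = (∫ x in A.l₁..A.l₂, A.e x * A.S ε s x * χ x) + ∫ x in A.l₁..A.l₂, A.qeI ε s x * χ x := by
    intro s hs
    rw [← intervalIntegral.integral_add]
    · refine intervalIntegral.integral_congr fun x _ => ?_
      simp only [θ_eq, excess_eq]; ring
    · exact (((hA.test_e.1.continuous.mul (hA.continuous_S_x ε s))).mul
        hχ.continuous).intervalIntegrable _ _
    · exact ((hA.absCont_qeI hq hε hs).continuousOn.mul
        hχ.continuous.continuousOn).intervalIntegrable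
  -- The strong form of the source holds only when `ψ ≠ 0`. The excluded times are countable, hence
  -- negligible under the time integral.
  have hrate : ∀ᵐ s : ℝ, s ∈ uIoc 0 t →
      deriv (A.qc ε s) A.l₂ * χ A.l₂ - deriv (A.qc ε s) A.l₁ * χ A.l₁
            - (∫ x in A.l₁..A.l₂, deriv (A.qeI ε s) x * deriv χ x)
            + ∫ x in A.l₁..A.l₂, A.rhs ε s x * χ x
      = A.heatRate χ ε s - deriv (fun s => ∫ x in A.l₁..A.l₂, A.e x * A.S ε s x * χ x) s := by
    filter_upwards [(hA.zeros_ψ ε hε).ae_notMem volume] with s hs hst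
    have hs' : s ∈ Icc 0 A.t₁ := hsub (uIoc_subset_uIcc hst)
    have hψ : A.ψ ε s ≠ 0 := fun h => hs ⟨hs', h⟩
    rw [integral_rhs hA hε hs' hψ hχ, hA.integral_deriv_qeI hq hε hs' hχ hN, heatRate, fluxQc]
    have e1 : ∫ x in A.l₁..A.l₂, A.excess ε s x * deriv (deriv χ) x
        = (∫ x in A.l₁..A.l₂, A.e x * A.S ε s x * deriv (deriv χ) x)
          + ∫ x in A.l₁..A.l₂, (A.qeI ε s x - A.qc ε s x) * deriv (deriv χ) x := by
      have hc := continuous_deriv_deriv hχ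
      rw [← intervalIntegral.integral_add]
      · refine intervalIntegral.integral_congr fun x _ => ?_
        simp only [excess_eq]; ring
      · exact (((hA.test_e.1.continuous.mul (hA.continuous_S_x ε s))).mul
          hc).intervalIntegrable _ _
      · exact (((hA.absCont_qeI hq hε hs').continuousOn.sub
          (hA.smooth_qc ε hε s hs').continuous.continuousOn).mul
          hc.continuousOn).intervalIntegrable
    rw [e1]
    ring
  have heq := hq.equation ε hε χ hχ hD t ht
  -- The pairing with `e S` is absolutely continuous in time, so its derivative integrates to its
  -- increment; moved to the left-hand side, it completes `q + e I` to the temperature.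
  rw [intervalIntegral.integral_congr_ae hrate, intervalIntegral.integral_sub
    ((hA.continuousOn_heatRate hq hε hχ).mono hsub).intervalIntegrable
    hM.intervalIntegrable_deriv, hM.integral_deriv_eq_sub] at heq
  rw [hsplit t ht, hsplit 0 h0]
  linarith

/-- The time derivative of the temperature as a distribution. -/
theorem hasDerivWithinAt_θ {ε t : ℝ} (hε : ε ∈ Ioo 0 A.ε₀) (ht : t ∈ Icc 0 A.t₁) {ζ : ℝ → ℝ}
    (hζ : IsTest A.l₁ A.l₂ ζ) :
    HasDerivWithinAt (fun s => ∫ x in A.l₁..A.l₂, A.θ ε s x * ζ x) (A.heatRate ζ ε t)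
      (Icc 0 A.t₁) t := by
  have hc := hA.continuousOn_heatRate hq hε hζ.1
  -- The rate is continued by constants beyond `[0, t₁]`, so that its primitive has a two-sided
  -- derivative at the endpoints too.
  have hce := hc.domRestrict.Icc_extend' (h := hA.t₁_pos.le)
  have h1 : HasDerivAt (fun s => ∫ r in (0 : ℝ)..s,
      IccExtend hA.t₁_pos.le ((Icc 0 A.t₁).domRestrict (A.heatRate ζ ε)) r)
      (IccExtend hA.t₁_pos.le ((Icc 0 A.t₁).domRestrict (A.heatRate ζ ε)) t) t :=
    (hce.integral_hasStrictDerivAt 0 t).hasDerivAt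
  have hv : ∀ s ∈ Icc 0 A.t₁, IccExtend hA.t₁_pos.le ((Icc 0 A.t₁).domRestrict (A.heatRate ζ ε)) s
      = A.heatRate ζ ε s := fun s hs => by rw [IccExtend_of_mem _ _ hs]; rfl
  have hθ : ∀ s ∈ Icc 0 A.t₁, ∫ x in A.l₁..A.l₂, A.θ ε s x * ζ x
      = (∫ x in A.l₁..A.l₂, A.θ ε 0 x * ζ x) + ∫ r in (0 : ℝ)..s,
        IccExtend hA.t₁_pos.le ((Icc 0 A.t₁).domRestrict (A.heatRate ζ ε)) r := by
    intro s hs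
    have h := hA.integral_heatRate hq hε hs hζ.1 (fun _ => ⟨hζ.left, hζ.right⟩)
      (fun _ => ⟨hζ.deriv.left, hζ.deriv.right⟩)
    have h2 : ∫ r in (0 : ℝ)..s, IccExtend hA.t₁_pos.le
        ((Icc 0 A.t₁).domRestrict (A.heatRate ζ ε)) r = ∫ r in (0 : ℝ)..s, A.heatRate ζ ε r := by
      refine intervalIntegral.integral_congr fun r hr => hv r ?_
      rw [uIcc_of_le hs.1] at hr
      exact Icc_subset_Icc_right hs.2 hr
    rw [h2, ← h]; ring
  rw [hv t ht] at h1
  exact (h1.const_add _).hasDerivWithinAt.congr hθ (hθ t ht)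

/-- The temperature solves the heat equation with sources at the free boundaries. -/
theorem derivWithin_θ_add {ε t : ℝ} (hε : ε ∈ Ioo 0 A.ε₀) (ht : t ∈ Icc 0 A.t₁) {ζ : ℝ → ℝ}
    (hζ : IsTest A.l₁ A.l₂ ζ) :
    derivWithin (fun s => ∫ x in A.l₁..A.l₂, A.θ ε s x * ζ x) (Icc 0 A.t₁) t
      + ∫ x in A.l₁..A.l₂, deriv (A.θ ε t) x * deriv ζ x
      = -∑ i : Fin 2, A.kinkMass i ε t * ζ (A.φ i ε t) := by
  rw [(hA.hasDerivWithinAt_θ hq hε ht hζ).derivWithin (uniqueDiffOn_Icc hA.t₁_pos t ht)]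
  have h1 := hA.absCont_θ hq hε ht
  have h2 := absolutelyContinuousOnInterval_of_contDiff
    (hζ.deriv.1.of_le (by exact_mod_cast le_top)) A.l₁ A.l₂
  have h3 := h1.integral_mul_deriv_eq_deriv_mul h2
  rw [hζ.deriv.left, hζ.deriv.right] at h3
  have h4 := hA.integral_deriv_qc hε ht hζ.1
  rw [hζ.deriv.left, hζ.deriv.right] at h4
  have hc := continuous_deriv_deriv hζ.1
  have h5 : ∫ x in A.l₁..A.l₂, A.θ ε t x * deriv (deriv ζ) x
      = (∫ x in A.l₁..A.l₂, A.excess ε t x * deriv (deriv ζ) x)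
        + ∫ x in A.l₁..A.l₂, A.qc ε t x * deriv (deriv ζ) x := hA.integral_θ_mul hq hε ht hc
  rw [heatRate, fluxQc, hζ.left, hζ.right]
  linarith

end IsAdmissible

end Ansatz

/-! ### A comparison principle -/

/-- Integrated form of `y' + λ y ≤ M` for a merely continuous `y`. If `y t > c`, let `s` be the last
time before `t` with `y ≤ c`. On `(s, t]` one has `y ≥ c`, so the damping is at least `λ c (t - s) ≥
M (t - s)` and `y t ≤ y s ≤ c`. -/
theorem le_of_forall_add_integral_le {y : ℝ → ℝ} {T lam M c : ℝ} (hy : ContinuousOn y (Icc 0 T))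
    (hlam : 0 ≤ lam) (h0 : y 0 ≤ c) (hc : M ≤ lam * c)
    (h : ∀ s ∈ Icc 0 T, ∀ t ∈ Icc 0 T, s ≤ t →
      y t - y s + lam * (∫ r in s..t, y r) ≤ M * (t - s)) :
    ∀ t ∈ Icc 0 T, y t ≤ c := by
  intro t ht
  by_contra! hct
  have hsub : Icc 0 t ⊆ Icc 0 T := Icc_subset_Icc_right ht.2
  have hcl : IsCompact (Icc 0 t ∩ y ⁻¹' Iic c) :=
    isCompact_Icc.of_isClosed_subset
      ((hy.mono hsub).preimage_isClosed_of_isClosed isClosed_Icc isClosed_Iic) inter_subset_left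
  obtain ⟨s, ⟨hs, hsc⟩, hmax⟩ := hcl.exists_isGreatest ⟨0, ⟨le_rfl, ht.1⟩, h0⟩
  have hbig : ∀ r ∈ Ioc s t, c ≤ y r := by
    intro r hr
    by_contra! hrc
    exact absurd (hmax ⟨⟨hs.1.trans hr.1.le, hr.2⟩, hrc.le⟩) (not_le.2 hr.1)
  have hint : c * (t - s) ≤ ∫ r in s..t, y r := by
    have h1 : ∫ _ in s..t, c = c * (t - s) := by simp [mul_comm]
    rw [← h1]
    refine intervalIntegral.integral_mono_on_of_le_Ioo hs.2 intervalIntegrable_const ?_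
      fun r hr => hbig r ⟨hr.1, hr.2.le⟩
    refine ((hy.mono hsub).mono ?_).intervalIntegrable
    rw [uIcc_of_le hs.2]
    exact Icc_subset_Icc_left hs.1
  have h2 := h s (hsub hs) t ht hs.2
  have h3 : 0 ≤ t - s := sub_nonneg.2 hs.2
  have h4 : y s ≤ c := hsc
  nlinarith [mul_le_mul_of_nonneg_left hint hlam, mul_le_mul_of_nonneg_right hc h3]

/-- The threshold dominates the initial value and satisfies `M ≤ λ c`; the comparison is applied to
`y` and to `-y`. -/
theorem abs_le_of_forall_abs_add_integral_le {y : ℝ → ℝ} {T lam M : ℝ}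
    (hy : ContinuousOn y (Icc 0 T)) (hlam : 0 < lam) (hM : 0 ≤ M)
    (h : ∀ s ∈ Icc 0 T, ∀ t ∈ Icc 0 T, s ≤ t →
      |y t - y s + lam * ∫ r in s..t, y r| ≤ M * (t - s)) :
    ∀ t ∈ Icc 0 T, |y t| ≤ |y 0| + M / lam := by
  intro t ht
  have hc : M ≤ lam * (|y 0| + M / lam) := by
    rw [mul_add, mul_div_cancel₀ _ hlam.ne']
    have := abs_nonneg (y 0)
    nlinarith
  have hp : 0 ≤ M / lam := by positivity
  rw [abs_le]
  constructor
  · have := le_of_forall_add_integral_le (y := fun r => -y r) hy.neg hlam.le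
      (c := |y 0| + M / lam) (by linarith [neg_abs_le (y 0)]) hc (fun s hs t ht hst => by
        rw [intervalIntegral.integral_neg]
        linarith [(abs_le.1 (h s hs t ht hst)).1]) t ht
    linarith
  · exact le_of_forall_add_integral_le hy hlam.le (by linarith [le_abs_self (y 0)]) hc
      (fun s hs t ht hst => (abs_le.1 (h s hs t ht hst)).2) t ht

/-! ### Hölder continuity from the decay of sine or cosine coefficients -/

namespace Ansatz.BoundaryCondition

/-- The parity of the extension of a function that obeys the boundary condition. -/
noncomputable def parity : BoundaryCondition → ℝ
  | dirichlet => -1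
  | neumann => 1

/-- The eigenfunctions of `∂_x²` under the boundary condition, up to scaling. -/
noncomputable def trig : BoundaryCondition → ℝ → ℝ
  | dirichlet => Real.sin
  | neumann => Real.cos

end Ansatz.BoundaryCondition

open Ansatz (BoundaryCondition)

/-- Decay of the coefficients of a function with a bounded second derivative. -/
noncomputable def coeffDecay (n : ℕ) : ℝ := if n = 0 then 1 else ((n : ℝ) ^ 2)⁻¹

theorem coeffDecay_nonneg (n : ℕ) : 0 ≤ coeffDecay n := by
  unfold coeffDecay; split_ifs <;> positivity

/-- The terms are `|n|^{-3/2}` for `n ≠ 0`. -/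
theorem summable_coeffDecay_mul_sqrt :
    Summable fun n : ℤ => coeffDecay n.natAbs * √(|n| : ℝ) := by
  have h := Real.summable_abs_int_rpow (b := 3 / 2) (by norm_num)
  refine h.congr fun n => ?_
  rcases eq_or_ne n 0 with rfl | hn
  · simp
  · have hp : (0 : ℝ) < |(n : ℝ)| := by positivity
    have h1 : ((n.natAbs : ℕ) : ℝ) = |(n : ℝ)| := by rw [Nat.cast_natAbs, Int.cast_abs]
    rw [coeffDecay, if_neg (by simpa using hn), h1, Real.sqrt_eq_rpow, ← Real.rpow_natCast,
      ← Real.rpow_neg hp.le, ← Real.rpow_add hp]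
    norm_num

theorem summable_coeffDecay : Summable fun n : ℤ => coeffDecay n.natAbs := by
  have h := Real.summable_abs_int_rpow (b := 2) (by norm_num)
  have h2 : Summable fun n : ℤ => if n = 0 then (1 : ℝ) else 0 :=
    summable_of_ne_finset_zero (s := {0}) fun n hn => by simpa using hn
  refine (h.add h2).congr fun n => ?_
  rcases eq_or_ne n 0 with rfl | hn
  · simp [coeffDecay]
  · have hp : (0 : ℝ) < |(n : ℝ)| := by positivity
    have h1 : ((n.natAbs : ℕ) : ℝ) = |(n : ℝ)| := by rw [Nat.cast_natAbs, Int.cast_abs]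
    have h3 : ¬ n.natAbs = 0 := by simpa using hn
    rw [coeffDecay, if_neg h3, h1, if_neg hn, add_zero, Real.rpow_neg hp.le]
    norm_num

/-- Interpolation between the bounds `|a - b|` and `2`. -/
theorem norm_exp_sub_exp_le (a b : ℝ) :
    ‖Complex.exp (Complex.I * a) - Complex.exp (Complex.I * b)‖ ≤ 2 * √|a - b| := by
  have h1 : Complex.exp (Complex.I * a) - Complex.exp (Complex.I * b)
      = Complex.exp (Complex.I * b) * (Complex.exp (Complex.I * (a - b : ℝ)) - 1) := by
    rw [mul_sub, ← Complex.exp_add, mul_one]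
    congr 2
    push_cast; ring
  rw [h1, norm_mul, Complex.norm_exp_I_mul_ofReal, one_mul]
  have h2 := Real.norm_exp_I_mul_ofReal_sub_one_le (x := a - b)
  have h3 : ‖Complex.exp (Complex.I * (a - b : ℝ)) - 1‖ ≤ 2 := by
    refine (norm_sub_le _ _).trans ?_
    rw [Complex.norm_exp_I_mul_ofReal, norm_one]
    norm_num
  rw [Real.norm_eq_abs] at h2
  have h4 := Real.sqrt_nonneg |a - b|
  have h5 := Real.sq_sqrt (abs_nonneg (a - b))
  rcases le_total (√|a - b|) 1 with h | h
  · nlinarith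
  · linarith

/-- The extension of a function on `[0, L]` to `[-L, L]` of the parity given by the boundary
condition. -/
noncomputable def reflection (bc : BoundaryCondition) (w : ℝ → ℝ) (y : ℝ) : ℝ :=
  w (max y 0) + bc.parity * (w (max (-y) 0) - w 0)

theorem reflection_of_nonneg (bc : BoundaryCondition) (w : ℝ → ℝ) {y : ℝ} (hy : 0 ≤ y) :
    reflection bc w y = w y := by
  rw [reflection, max_eq_left hy, max_eq_right (by linarith)]; ring

theorem reflection_of_nonpos {bc : BoundaryCondition} {w : ℝ → ℝ}
    (hw : bc = BoundaryCondition.dirichlet → w 0 = 0) {y : ℝ} (hy : y ≤ 0) :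
    reflection bc w y = bc.parity * w (-y) := by
  rw [reflection, max_eq_right hy, max_eq_left (by linarith)]
  cases bc with
  | dirichlet => simp [hw rfl]
  | neumann => simp [BoundaryCondition.parity]

/-- Clamped arguments make the reflection a single formula, continuous at `0` without gluing. -/
theorem continuousOn_reflection (bc : BoundaryCondition) {w : ℝ → ℝ} {L : ℝ} (hL : 0 ≤ L)
    (hw : ContinuousOn w (Icc 0 L)) : ContinuousOn (reflection bc w) (Icc (-L) L) := by
  have h1 : ContinuousOn (fun y : ℝ => w (max y 0)) (Icc (-L) L) :=
    hw.comp (by fun_prop) fun y hy => ⟨le_max_right _ _, max_le hy.2 hL⟩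
  have h2 : ContinuousOn (fun y : ℝ => w (max (-y) 0)) (Icc (-L) L) :=
    hw.comp (by fun_prop) fun y hy => ⟨le_max_right _ _, max_le (by linarith [hy.1]) hL⟩
  exact h1.add (continuousOn_const.mul (h2.sub continuousOn_const))

/-- In the even case `c = 2`, in the odd case `c = ∓2i` according to the sign of `n`. -/
theorem norm_exp_add_parity (bc : BoundaryCondition) (n : ℤ) :
    ∃ c : ℂ, ‖c‖ = 2 ∧ ∀ a : ℝ, Complex.exp (-(Complex.I * (n * a : ℝ)))
      + bc.parity * Complex.exp (Complex.I * (n * a : ℝ)) = c * (bc.trig (n.natAbs * a) : ℝ) := by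
  have hcos : ∀ a : ℝ, Complex.exp (-(Complex.I * (n * a : ℝ)))
      + Complex.exp (Complex.I * (n * a : ℝ)) = 2 * (Real.cos (n * a) : ℝ) := by
    intro a
    rw [Complex.ofReal_cos, Complex.cos, mul_comm Complex.I]
    ring_nf
  have hsin : ∀ a : ℝ, Complex.exp (-(Complex.I * (n * a : ℝ)))
      - Complex.exp (Complex.I * (n * a : ℝ)) = -(2 * Complex.I) * (Real.sin (n * a) : ℝ) := by
    intro a
    rw [Complex.ofReal_sin, Complex.sin, mul_comm Complex.I]
    have := Complex.I_mul_I
    rw [neg_mul ((n * a : ℝ) : ℂ)]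
    linear_combination (Complex.exp (-((n * a : ℝ) * Complex.I))
      - Complex.exp ((n * a : ℝ) * Complex.I)) * this
  have hn : ((n.natAbs : ℕ) : ℝ) = |(n : ℝ)| := by rw [Nat.cast_natAbs, Int.cast_abs]
  cases bc with
  | neumann =>
    refine ⟨2, by norm_num, fun a => ?_⟩
    simp only [BoundaryCondition.parity, BoundaryCondition.trig, Complex.ofReal_one, one_mul]
    rw [hcos, hn]
    rcases abs_choice (n : ℝ) with h | h <;> rw [h]
    rw [neg_mul, Real.cos_neg]
  | dirichlet =>
    simp only [BoundaryCondition.parity, BoundaryCondition.trig, Complex.ofReal_neg,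
      Complex.ofReal_one, neg_one_mul, ← sub_eq_add_neg, hsin, hn]
    rcases abs_choice (n : ℝ) with h | h
    · exact ⟨-(2 * Complex.I), by simp, fun a => by rw [h]⟩
    · exact ⟨2 * Complex.I, by simp, fun a => by rw [h, neg_mul (n : ℝ), Real.sin_neg]; push_cast; ring⟩

/-- Folding `[-L, 0]` onto `[0, L]` pairs each exponential with its reflection, and the pair is a
sine or a cosine. -/
theorem norm_fourierCoeffOn_reflection {bc : BoundaryCondition} {w : ℝ → ℝ} {L : ℝ} (hL : 0 < L)
    (hw : ContinuousOn w (Icc 0 L)) (hb : bc = BoundaryCondition.dirichlet → w 0 = 0) (n : ℤ) :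
    ‖fourierCoeffOn (show -L < -L + 2 * L by linarith) (fun y => (reflection bc w y : ℂ)) n‖
      = 1 / L * |∫ y in (0 : ℝ)..L, w y * bc.trig (n.natAbs * (Real.pi * y / L))| := by
  obtain ⟨c, hc, hcs⟩ := norm_exp_add_parity bc n
  have hr := continuousOn_reflection bc hL.le hw
  have hexp : ∀ y : ℝ, (fourier (-n) (y : AddCircle (L - -L)) : ℂ)
      = Complex.exp (-(Complex.I * (n * (Real.pi * y / L) : ℝ))) := by
    intro y
    rw [fourier_coe_apply]
    congr 1
    have : (L : ℂ) ≠ 0 := by exact_mod_cast hL.ne'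
    push_cast
    field_simp
    ring_nf
  have hce : ∀ y : ℝ → ℝ, Continuous y → Continuous fun x : ℝ =>
      Complex.exp (-(Complex.I * (n * (Real.pi * y x / L) : ℝ))) := by
    intro y hy
    fun_prop
  rw [fourierCoeffOn_eq_integral, show -L + 2 * L = L by ring]
  simp only [hexp, smul_eq_mul]
  have hF : ContinuousOn (fun y : ℝ => Complex.exp (-(Complex.I * (n * (Real.pi * y / L) : ℝ)))
      * (reflection bc w y : ℂ)) (Icc (-L) L) :=
    (hce id continuous_id).continuousOn.mul (Complex.continuous_ofReal.comp_continuousOn hr)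
  have hi1 : IntervalIntegrable (fun y : ℝ => Complex.exp (-(Complex.I * (n * (Real.pi * y / L) : ℝ)))
      * (reflection bc w y : ℂ)) volume (-L) 0 := by
    refine (hF.mono ?_).intervalIntegrable
    rw [uIcc_of_le (by linarith)]; exact Icc_subset_Icc_right hL.le
  have hi2 : IntervalIntegrable (fun y : ℝ => Complex.exp (-(Complex.I * (n * (Real.pi * y / L) : ℝ)))
      * (reflection bc w y : ℂ)) volume 0 L := by
    refine (hF.mono ?_).intervalIntegrable
    rw [uIcc_of_le hL.le]; exact Icc_subset_Icc_left (by linarith)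
  have hneg := intervalIntegral.integral_comp_neg (a := 0) (b := L)
    (fun y : ℝ => Complex.exp (-(Complex.I * (n * (Real.pi * y / L) : ℝ))) * (reflection bc w y : ℂ))
  rw [neg_zero] at hneg
  have hi1' : IntervalIntegrable (fun y : ℝ =>
      Complex.exp (-(Complex.I * (n * (Real.pi * (-y) / L) : ℝ)))
      * (reflection bc w (-y) : ℂ)) volume 0 L := by
    have := hi1.comp_sub_left 0
    simpa using this.symm
  have hint : ∫ y in (-L)..L, Complex.exp (-(Complex.I * (n * (Real.pi * y / L) : ℝ)))
      * (reflection bc w y : ℂ)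
      = c * ((∫ y in (0 : ℝ)..L, w y * bc.trig (n.natAbs * (Real.pi * y / L)) : ℝ) : ℂ) := by
    rw [← intervalIntegral.integral_add_adjacent_intervals hi1 hi2, ← hneg,
      ← intervalIntegral.integral_add hi1' hi2, ← intervalIntegral.integral_ofReal,
      ← intervalIntegral.integral_const_mul]
    refine intervalIntegral.integral_congr fun y hy => ?_
    rw [uIcc_of_le hL.le] at hy
    rw [reflection_of_nonneg bc w hy.1, reflection_of_nonpos hb (by linarith [hy.1] : -y ≤ 0),
      neg_neg, Complex.ofReal_mul bc.parity, Complex.ofReal_mul (w y)]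
    have h1 := hcs (Real.pi * y / L)
    have h2 : -(Complex.I * ((n * (Real.pi * (-y) / L) : ℝ) : ℂ))
        = Complex.I * ((n * (Real.pi * y / L) : ℝ) : ℂ) := by push_cast; ring
    rw [h2]
    linear_combination (w y : ℂ) * h1
  rw [hint, norm_smul, norm_mul, hc, Complex.norm_real, Real.norm_eq_abs, Real.norm_eq_abs,
    abs_of_pos (by rw [sub_neg_eq_add]; positivity)]
  field_simp
  ring

/-- The reflection is continuous and periodic with summable Fourier coefficients, so its series
represents it pointwise and can be estimated term by term. An increment of the `n`th exponential
costs a multiple of `√|n| √|x - y|`, which decay `n⁻²` can afford. -/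
theorem holder_of_coeff {bc : BoundaryCondition} {w : ℝ → ℝ} {L C : ℝ} (hL : 0 < L)
    (hw : ContinuousOn w (Icc 0 L))
    (hb : bc = BoundaryCondition.dirichlet → w 0 = 0 ∧ w L = 0)
    (hC : ∀ n : ℕ, |∫ y in (0 : ℝ)..L, w y * bc.trig (n * (Real.pi * y / L))| ≤ C * coeffDecay n) :
    (∀ x ∈ Icc 0 L, |w x| ≤ C * (1 / L * ∑' n : ℤ, coeffDecay n.natAbs)) ∧
    ∀ x ∈ Icc 0 L, ∀ y ∈ Icc 0 L, |w x - w y| ≤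
      C * (1 / L * (2 * √(Real.pi / L) * ∑' n : ℤ, coeffDecay n.natAbs * √(|n| : ℝ))) * √|x - y| := by
  have : Fact (0 < 2 * L) := ⟨by positivity⟩
  set W : ℝ → ℂ := fun y => (reflection bc w y : ℂ) with hW
  have hend : W (-L) = W (-L + 2 * L) := by
    simp only [hW]
    rw [show -L + 2 * L = L by ring, reflection_of_nonneg bc w hL.le,
      reflection_of_nonpos (fun h => (hb h).1) (by linarith), neg_neg]
    cases bc with
    | dirichlet => simp [(hb rfl).2]
    | neumann => simp [BoundaryCondition.parity]
  have hWc : ContinuousOn W (Icc (-L) (-L + 2 * L)) := by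
    rw [show -L + 2 * L = L by ring]
    exact Complex.continuous_ofReal.comp_continuousOn (continuousOn_reflection bc hL.le hw)
  let f : C(AddCircle (2 * L), ℂ) :=
    ⟨AddCircle.liftIco (2 * L) (-L) W, AddCircle.liftIco_continuous hend hWc⟩
  have hco : ∀ n, ‖fourierCoeff f n‖ ≤ C * (1 / L * coeffDecay n.natAbs) := by
    intro n
    have h1 : fourierCoeff f n = _ := fourierCoeff_liftIco_eq (T := 2 * L) (a := -L) W n
    rw [h1, norm_fourierCoeffOn_reflection hL hw (fun h => (hb h).1)]
    have := mul_le_mul_of_nonneg_left (hC n.natAbs) (by positivity : 0 ≤ 1 / L)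
    linarith
  have hval : ∀ x ∈ Icc 0 L, f (x : AddCircle (2 * L)) = (w x : ℂ) := by
    intro x hx
    change AddCircle.liftIco (2 * L) (-L) W x = _
    rcases hx.2.eq_or_lt with rfl | h
    -- The fundamental domain is `[-L, L)`, so the value at the endpoint `L` is read off at `-L`.
    · have h1 : ((x : ℝ) : AddCircle (2 * x)) = ((-x : ℝ) : AddCircle (2 * x)) := by
        rw [← AddCircle.coe_add_period (2 * x) (-x)]
        congr 1; ring
      rw [h1, AddCircle.liftIco_coe_apply ⟨le_rfl, by linarith⟩, hend, hW]
      simp only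
      rw [show -x + 2 * x = x by ring, reflection_of_nonneg bc w hL.le]
    · rw [AddCircle.liftIco_coe_apply ⟨by linarith [hx.1], by linarith⟩, hW]
      simp only
      rw [reflection_of_nonneg bc w hx.1]
  have hsum : Summable (fourierCoeff f) :=
    Summable.of_norm_bounded ((summable_coeffDecay.mul_left (1 / L)).mul_left C) hco
  have hser := has_pointwise_sum_fourier_series_of_summable hsum
  have hfour : ∀ (n : ℤ) (x : ℝ), (fourier n (x : AddCircle (2 * L)) : ℂ)
      = Complex.exp (Complex.I * (n * (Real.pi * x / L) : ℝ)) := by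
    intro n x
    rw [fourier_coe_apply]
    congr 1
    have : (L : ℂ) ≠ 0 := by exact_mod_cast hL.ne'
    push_cast
    field_simp
  constructor
  · intro x hx
    have h1 := hser (x : AddCircle (2 * L))
    rw [hval x hx] at h1
    have h2 := h1.norm_le_of_bounded
      ((summable_coeffDecay.mul_left (1 / L)).mul_left C).hasSum fun n => by
        rw [norm_smul, hfour, Complex.norm_exp_I_mul_ofReal, mul_one]
        exact hco n
    rwa [Complex.norm_real, Real.norm_eq_abs, tsum_mul_left, tsum_mul_left] at h2
  · intro x hx y hy
    have h1 := (hser (x : AddCircle (2 * L))).sub (hser (y : AddCircle (2 * L)))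
    rw [hval x hx, hval y hy, ← Complex.ofReal_sub] at h1
    have h2 := h1.norm_le_of_bounded
      ((summable_coeffDecay_mul_sqrt.mul_left
        (1 / L * (2 * √(Real.pi / L) * √|x - y|))).mul_left C).hasSum fun n => by
        rw [← smul_sub, norm_smul, hfour, hfour]
        have h3 := norm_exp_sub_exp_le (n * (Real.pi * x / L)) (n * (Real.pi * y / L))
        have h4 : |(n : ℝ) * (Real.pi * x / L) - n * (Real.pi * y / L)|
            = Real.pi / L * |x - y| * |(n : ℝ)| := by
          rw [show (n : ℝ) * (Real.pi * x / L) - n * (Real.pi * y / L)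
            = Real.pi / L * (x - y) * n by ring, abs_mul, abs_mul,
            abs_of_pos (by positivity : 0 < Real.pi / L)]
        rw [h4, Real.sqrt_mul (by positivity), Real.sqrt_mul (by positivity)] at h3
        have h5 := mul_le_mul (hco n) h3 (norm_nonneg _) ((norm_nonneg _).trans (hco n))
        refine h5.trans (le_of_eq ?_)
        ring
    rw [Complex.norm_real, Real.norm_eq_abs, tsum_mul_left, tsum_mul_left] at h2
    refine h2.trans (le_of_eq ?_)
    ring

namespace Ansatz

variable {A : Ansatz} {K : ℝ}

/-! ### The evolution of the coefficients of the temperature -/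

namespace IsAdmissible

variable (hA : A.IsAdmissible)

include hA

/-- Integration by parts turns the flux into `∫ (∂²q̌/∂x²) χ`, with a second derivative that exists
almost everywhere and is bounded by the Lipschitz constant of `∂q̌/∂x`. The bound is thus free of
derivatives of `χ`, hence uniform over all modes. -/
theorem abs_fluxQc_le {Z ε s : ℝ}
    (hZ : ∀ x ∈ Icc A.l₁ A.l₂, ∀ y ∈ Icc A.l₁ A.l₂,
      |deriv (A.qc ε s) x - deriv (A.qc ε s) y| ≤ Z * |x - y|) (hZ0 : 0 ≤ Z)
    {χ : ℝ → ℝ} (hχ : ContDiff ℝ ∞ χ) (hb : ∀ x, |χ x| ≤ 1) :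
    |A.fluxQc χ ε s| ≤ Z * (A.l₂ - A.l₁) := by
  have hl := hA.l₁_lt_l₂.le
  have hlip : LipschitzOnWith (Real.toNNReal Z) (deriv (A.qc ε s)) (Icc A.l₁ A.l₂) := by
    refine LipschitzOnWith.of_dist_le_mul fun x hx y hy => ?_
    rw [Real.dist_eq, Real.dist_eq, Real.coe_toNNReal _ hZ0]
    exact hZ x hx y hy
  have h1 : AbsolutelyContinuousOnInterval (deriv (A.qc ε s)) A.l₁ A.l₂ := by
    rw [← uIcc_of_le hl] at hlip
    exact hlip.absolutelyContinuousOnInterval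
  have h2 := absolutelyContinuousOnInterval_of_contDiff
    (hχ.of_le (by exact_mod_cast le_top)) A.l₁ A.l₂
  have h3 := h1.integral_mul_deriv_eq_deriv_mul h2
  have h4 : A.fluxQc χ ε s = ∫ x in A.l₁..A.l₂, deriv (deriv (A.qc ε s)) x * χ x := by
    rw [fluxQc]; linarith
  rw [h4]
  have h5 := intervalIntegral.norm_integral_le_of_norm_le_const_ae (a := A.l₁) (b := A.l₂)
    (f := fun x => deriv (deriv (A.qc ε s)) x * χ x) (C := Z) ?_
  · rwa [Real.norm_eq_abs, abs_of_nonneg (sub_nonneg.2 hl)] at h5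
  · have : ∀ᵐ x : ℝ, x ≠ A.l₂ := (measure_eq_zero_iff_ae_notMem.1 (measure_singleton A.l₂))
    filter_upwards [this] with x hx hx'
    rw [uIoc_of_le hl] at hx'
    have h6 := norm_deriv_le_of_lipschitzOn (Icc_mem_nhds hx'.1 (hx'.2.lt_of_ne hx)) hlip
    rw [Real.coe_toNNReal _ hZ0] at h6
    rw [norm_mul]
    calc _ ≤ Z * 1 := mul_le_mul h6 (hb x) (abs_nonneg _) hZ0
      _ = Z := mul_one Z

omit hA in
theorem abs_sum_kinkMass_le (hK : A.UniformBounds K) {ε t : ℝ} (ht : t ∈ Icc 0 A.t₁) {χ : ℝ → ℝ}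
    (hb : ∀ x, |χ x| ≤ 1) :
    |∑ i : Fin 2, A.kinkMass i ε t * χ (A.φ i ε t)| ≤ 4 * (K * K) := by
  have h : ∀ i, |A.kinkMass i ε t * χ (A.φ i ε t)| ≤ 2 * (K * K) := by
    intro i
    have h1 : |A.γp i t + A.γm i t| ≤ 2 * K :=
      (abs_add_le _ _).trans (by linarith [hK.γp i t ht, hK.γm i t ht])
    rw [kinkMass, abs_mul, abs_mul]
    calc _ ≤ K * (2 * K) * 1 := by
          have := hK.nonneg
          exact mul_le_mul (mul_le_mul (hK.B _) h1 (abs_nonneg _) hK.nonneg) (hb _) (abs_nonneg _)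
            (by positivity)
      _ = _ := by ring
  rw [Fin.sum_univ_two]
  exact (abs_add_le _ _).trans (by linarith [h 0, h 1])

variable {bc : BoundaryCondition} (hq : A.SolvesHeat bc)

include hq

/-- The coefficients of the temperature with respect to the eigenfunctions of `∂_x²` stay bounded,
with a gain of the eigenvalue. -/
theorem exists_abs_coeff_le : ∃ M, 0 ≤ M ∧ ∀ ε ∈ Ioo 0 A.ε₀, ∀ χ : ℝ → ℝ, ContDiff ℝ ∞ χ →
    (∀ x, |χ x| ≤ 1) →
    (bc = BoundaryCondition.dirichlet → χ A.l₁ = 0 ∧ χ A.l₂ = 0) →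
    (bc = BoundaryCondition.neumann → deriv χ A.l₁ = 0 ∧ deriv χ A.l₂ = 0) →
    ∀ lam, 0 ≤ lam → (∀ x, deriv (deriv χ) x = -lam * χ x) → ∀ t ∈ Icc 0 A.t₁,
    |∫ x in A.l₁..A.l₂, A.excess ε t x * χ x|
      ≤ |∫ x in A.l₁..A.l₂, A.excess ε 0 x * χ x| + M * (if lam = 0 then 1 else lam⁻¹) := by
  obtain ⟨K, hK⟩ := hA.exists_uniformBounds
  obtain ⟨Z, hZ⟩ := hA.bounds_qc
  have hK0 := hK.nonneg
  have hl := hA.l₁_lt_l₂.le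
  have hl0 := sub_nonneg.2 hl
  have ht₁ := hA.t₁_pos.le
  have hZ0 : 0 ≤ Z := (abs_nonneg _).trans (hZ (A.ε₀ / 2) ⟨by linarith [hA.ε₀_pos],
    by linarith [hA.ε₀_pos]⟩ 0 (left_mem_Icc.2 ht₁) A.l₁ (left_mem_Icc.2 hl)).1
  -- The three sources: the flux of `q̌`, the kinks, and the change of `q̌` in time.
  set M := Z * (A.l₂ - A.l₁) + 4 * (K * K) + Z * (A.l₂ - A.l₁) with hM
  have hM0 : 0 ≤ M := by positivity
  -- `M` serves `λ > 0`; `M t₁` is the linear growth in time that is possible when `λ = 0`.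
  refine ⟨M + M * A.t₁, by positivity, fun ε hε χ hχ hb hD hN lam hlam hev t ht => ?_⟩
  set c : ℝ → ℝ := fun s => ∫ x in A.l₁..A.l₂, A.excess ε s x * χ x with hc
  have hcc : ContinuousOn c (Icc 0 A.t₁) :=
    continuousOn_integral_mul ht₁ hl (hA.continuousOn_excess hq hε) hχ.continuous
  have hheat : ∀ s, A.heatRate χ ε s = (A.fluxQc χ ε s
      - ∑ i : Fin 2, A.kinkMass i ε s * χ (A.φ i ε s)) - lam * c s := by
    intro s
    have : ∫ x in A.l₁..A.l₂, A.excess ε s x * deriv (deriv χ) x = -lam * c s := by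
      rw [hc, ← intervalIntegral.integral_const_mul]
      refine intervalIntegral.integral_congr fun x _ => ?_
      simp only [hev x]; ring
    rw [heatRate, this]; ring
  have hrc := hA.continuousOn_heatRate hq hε hχ
  have hkey : ∀ s ∈ Icc 0 A.t₁, ∀ t ∈ Icc 0 A.t₁, s ≤ t →
      |c t - c s + lam * ∫ r in s..t, c r| ≤ M * (t - s) := by
    intro s hs t ht hst
    have hsub : ∀ {a b : ℝ}, a ∈ Icc 0 A.t₁ → b ∈ Icc 0 A.t₁ → uIcc a b ⊆ Icc 0 A.t₁ :=
      fun ha hb => uIcc_subset_Icc ha hb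
    have h0 : (0 : ℝ) ∈ Icc 0 A.t₁ := left_mem_Icc.2 ht₁
    have e1 := hA.integral_heatRate hq hε hs hχ hD hN
    have e2 := hA.integral_heatRate hq hε ht hχ hD hN
    have e3 := hA.integral_θ_mul hq hε hs hχ.continuous
    have e4 := hA.integral_θ_mul hq hε ht hχ.continuous
    have e5 := intervalIntegral.integral_add_adjacent_intervals
      ((hrc.mono (hsub h0 hs)).intervalIntegrable (μ := volume))
      ((hrc.mono (hsub hs ht)).intervalIntegrable (μ := volume))
    have hci : IntervalIntegrable (fun r => lam * c r) volume s t :=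
      ((hcc.mono (hsub hs ht)).intervalIntegrable).const_mul lam
    have e6 : (∫ r in s..t, A.heatRate χ ε r) + lam * ∫ r in s..t, c r
        = ∫ r in s..t, (A.fluxQc χ ε r - ∑ i : Fin 2, A.kinkMass i ε r * χ (A.φ i ε r)) := by
      rw [← intervalIntegral.integral_const_mul, ← intervalIntegral.integral_add
        (hrc.mono (hsub hs ht)).intervalIntegrable hci]
      refine intervalIntegral.integral_congr fun r _ => ?_
      simp only [hheat]; ring
    have hqi : ∀ r ∈ Icc 0 A.t₁, IntervalIntegrable (fun x => A.qc ε r x * χ x) volume A.l₁ A.l₂ :=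
      fun r hr => ((hA.smooth_qc ε hε r hr).continuous.mul hχ.continuous).intervalIntegrable _ _
    have e7 : (∫ x in A.l₁..A.l₂, A.qc ε t x * χ x) - ∫ x in A.l₁..A.l₂, A.qc ε s x * χ x
        = ∫ x in A.l₁..A.l₂, (A.qc ε t x - A.qc ε s x) * χ x := by
      rw [← intervalIntegral.integral_sub (hqi t ht) (hqi s hs)]
      refine intervalIntegral.integral_congr fun x _ => ?_
      ring
    have e8 : c t - c s + lam * (∫ r in s..t, c r)
        = (∫ r in s..t, (A.fluxQc χ ε r - ∑ i : Fin 2, A.kinkMass i ε r * χ (A.φ i ε r)))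
          - ∫ x in A.l₁..A.l₂, (A.qc ε t x - A.qc ε s x) * χ x := by
      rw [← e6, ← e7]
      simp only [hc]
      linarith
    have b1 := intervalIntegral.norm_integral_le_of_norm_le_const (a := s) (b := t)
      (f := fun r => A.fluxQc χ ε r - ∑ i : Fin 2, A.kinkMass i ε r * χ (A.φ i ε r))
      (C := Z * (A.l₂ - A.l₁) + 4 * (K * K)) fun r hr => by
        rw [uIoc_of_le hst] at hr
        have hr' : r ∈ Icc 0 A.t₁ := ⟨hs.1.trans hr.1.le, hr.2.trans ht.2⟩
        exact (abs_sub _ _).trans (add_le_add (hA.abs_fluxQc_le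
          (fun x hx y hy => (hZ ε hε r hr' x hx).2.2.2 y hy) hZ0 hχ hb)
          (abs_sum_kinkMass_le hK hr' hb))
    have b2 := intervalIntegral.norm_integral_le_of_norm_le_const (a := A.l₁) (b := A.l₂)
      (f := fun x => (A.qc ε t x - A.qc ε s x) * χ x) (C := Z * (t - s)) fun x hx => by
        rw [uIoc_of_le hl] at hx
        have h1 := (hZ ε hε t ht x (Ioc_subset_Icc_self hx)).2.2.1 s hs
        rw [abs_of_nonneg (sub_nonneg.2 hst)] at h1
        rw [norm_mul]
        calc _ ≤ Z * (t - s) * 1 := mul_le_mul h1 (hb x) (abs_nonneg _)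
              (mul_nonneg hZ0 (sub_nonneg.2 hst))
          _ = _ := mul_one _
    rw [Real.norm_eq_abs, abs_of_nonneg (sub_nonneg.2 hst)] at b1
    rw [Real.norm_eq_abs, abs_of_nonneg hl0] at b2
    rw [e8, hM]
    refine (abs_sub _ _).trans ?_
    linarith
  change |c t| ≤ |c 0| + _
  split_ifs with h
  · have h1 := hkey 0 (left_mem_Icc.2 ht₁) t ht ht.1
    rw [h, zero_mul, add_zero, sub_zero] at h1
    have h2 := abs_sub_abs_le_abs_sub (c t) (c 0)
    have h3 := mul_le_mul_of_nonneg_left ht.2 hM0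
    linarith
  · have h1 := abs_le_of_forall_abs_add_integral_le hcc (hlam.lt_of_ne' h) hM0 hkey t ht
    rw [div_eq_mul_inv] at h1
    have : M * lam⁻¹ ≤ (M + M * A.t₁) * lam⁻¹ := by
      refine mul_le_mul_of_nonneg_right ?_ (by positivity)
      linarith [mul_nonneg hM0 ht₁]
    linarith

end IsAdmissible

/-- The eigenfunctions of `∂_x²` on `[l₁, l₂]` under the boundary condition. -/
noncomputable def mode (A : Ansatz) (bc : BoundaryCondition) (n : ℕ) (x : ℝ) : ℝ :=
  bc.trig (n * (Real.pi * (x - A.l₁) / (A.l₂ - A.l₁)))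

theorem abs_mode_le (A : Ansatz) (bc : BoundaryCondition) (n : ℕ) (x : ℝ) : |A.mode bc n x| ≤ 1 := by
  cases bc
  · exact Real.abs_sin_le_one _
  · exact Real.abs_cos_le_one _

theorem contDiff_mode (A : Ansatz) (bc : BoundaryCondition) (n : ℕ) :
    ContDiff ℝ ∞ (A.mode bc n) := by
  have h : ContDiff ℝ ∞ fun x : ℝ => (n : ℝ) * (Real.pi * (x - A.l₁) / (A.l₂ - A.l₁)) := by
    fun_prop
  cases bc
  · exact Real.contDiff_sin.comp h
  · exact Real.contDiff_cos.comp h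

theorem hasDerivAt_mode (A : Ansatz) (n : ℕ) (x : ℝ) :
    HasDerivAt (A.mode BoundaryCondition.dirichlet n)
      (n * (Real.pi / (A.l₂ - A.l₁)) * A.mode BoundaryCondition.neumann n x) x ∧
    HasDerivAt (A.mode BoundaryCondition.neumann n)
      (-(n * (Real.pi / (A.l₂ - A.l₁)) * A.mode BoundaryCondition.dirichlet n x)) x := by
  have h : HasDerivAt (fun x : ℝ => (n : ℝ) * (Real.pi * (x - A.l₁) / (A.l₂ - A.l₁)))
      (n * (Real.pi / (A.l₂ - A.l₁))) x :=
    (((((hasDerivAt_id x).sub_const A.l₁).const_mul Real.pi).div_const _).const_mul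
      (n : ℝ)).congr_deriv (by simp)
  exact ⟨h.sin.congr_deriv (mul_comm _ _), h.cos.congr_deriv
    (by rw [neg_mul, mul_comm]; rfl)⟩

theorem deriv_deriv_mode (A : Ansatz) (bc : BoundaryCondition) (n : ℕ) (x : ℝ) :
    deriv (deriv (A.mode bc n)) x
      = -(n * (Real.pi / (A.l₂ - A.l₁))) ^ 2 * A.mode bc n x := by
  cases bc
  · rw [funext fun y => (A.hasDerivAt_mode n y).1.deriv,
      ((A.hasDerivAt_mode n x).2.const_mul _).deriv]
    ring
  · rw [funext fun y => (A.hasDerivAt_mode n y).2.deriv,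
      ((A.hasDerivAt_mode n x).1.const_mul _).fun_neg.deriv]
    ring

theorem mode_dirichlet_ends (hA : A.IsAdmissible) (n : ℕ) :
    A.mode BoundaryCondition.dirichlet n A.l₁ = 0 ∧
      A.mode BoundaryCondition.dirichlet n A.l₂ = 0 := by
  have := (sub_pos.2 hA.l₁_lt_l₂).ne'
  simp only [mode, BoundaryCondition.trig]
  refine ⟨by simp, ?_⟩
  rw [mul_div_cancel_right₀ _ this, Real.sin_nat_mul_pi]

theorem deriv_mode_neumann_ends (hA : A.IsAdmissible) (n : ℕ) :
    deriv (A.mode BoundaryCondition.neumann n) A.l₁ = 0 ∧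
      deriv (A.mode BoundaryCondition.neumann n) A.l₂ = 0 := by
  rw [(A.hasDerivAt_mode n _).2.deriv, (A.hasDerivAt_mode n _).2.deriv,
    (mode_dirichlet_ends hA n).1, (mode_dirichlet_ends hA n).2]
  simp

end Ansatz

/-! ### The initial temperature -/

/-- Compactness of the set of triples `(p, q, x)` with `q - p ≥ r`. -/
theorem exists_abs_bump_le (c d l₁ l₂ : ℝ) {r : ℝ} (hr : 0 < r) : ∃ C, 0 ≤ C ∧
    ∀ p ∈ Icc l₁ l₂, ∀ q ∈ Icc l₁ l₂, ∀ x ∈ Icc l₁ l₂, r ≤ q - p →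
      |bump c d p q x| ≤ C ∧ |deriv (bump c d p q) x| ≤ C ∧
        |deriv (deriv (bump c d p q)) x| ≤ C := by
  have hcl : IsClosed {z : ℝ × ℝ × ℝ | r ≤ z.2.1 - z.1} :=
    isClosed_le (by fun_prop) (by fun_prop)
  have hcpt : IsCompact ((Icc l₁ l₂ ×ˢ Icc l₁ l₂ ×ˢ Icc l₁ l₂) ∩
      {z : ℝ × ℝ × ℝ | r ≤ z.2.1 - z.1}) :=
    (isCompact_Icc.prod (isCompact_Icc.prod isCompact_Icc)).inter_right hcl
  have hne : ∀ z ∈ (Icc l₁ l₂ ×ˢ Icc l₁ l₂ ×ˢ Icc l₁ l₂) ∩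
      {z : ℝ × ℝ × ℝ | r ≤ z.2.1 - z.1}, z.2.1 - z.1 ≠ 0 := fun z hz =>
    (hr.trans_le hz.2).ne'
  have h1 := hcpt.exists_bound_of_continuousOn (f := fun z : ℝ × ℝ × ℝ => bump c d z.1 z.2.1 z.2.2)
    (by unfold bump; fun_prop (disch := exact hne))
  have h2 := hcpt.exists_bound_of_continuousOn
    (f := fun z : ℝ × ℝ × ℝ => deriv (bump c d z.1 z.2.1) z.2.2)
    (by simp only [(hasDerivAt_bump _ _ _ _ _).deriv]; fun_prop (disch := exact hne))
  have h3 := hcpt.exists_bound_of_continuousOn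
    (f := fun z : ℝ × ℝ × ℝ => deriv (deriv (bump c d z.1 z.2.1)) z.2.2)
    (by simp only [(hasDerivAt_deriv_bump _ _ _ _ _).deriv]; fun_prop (disch := exact hne))
  obtain ⟨C1, h1⟩ := h1
  obtain ⟨C2, h2⟩ := h2
  obtain ⟨C3, h3⟩ := h3
  refine ⟨max (max C1 C2) (max C3 0), le_max_of_le_right (le_max_right _ _),
    fun p hp q hq x hx hpq => ?_⟩
  have hm : (p, q, x) ∈ (Icc l₁ l₂ ×ˢ Icc l₁ l₂ ×ˢ Icc l₁ l₂) ∩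
      {z : ℝ × ℝ × ℝ | r ≤ z.2.1 - z.1} := ⟨⟨hp, hq, hx⟩, hpq⟩
  exact ⟨(h1 _ hm).trans (le_max_of_le_left (le_max_left _ _)),
    (h2 _ hm).trans (le_max_of_le_left (le_max_right _ _)),
    (h3 _ hm).trans (le_max_of_le_right (le_max_left _ _))⟩

theorem abs_heav_sub_heav_le (a b : ℝ) : |heav a - heav b| ≤ 1 := by
  unfold heav; split_ifs <;> simp

theorem abs_heav_le (a : ℝ) : |heav a| ≤ 1 := by
  unfold heav; split_ifs <;> simp

theorem abs_kinked_le (p q : ℝ) (f₁ f₂ f₃ : ℝ → ℝ) (x : ℝ) :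
    |kinked p q f₁ f₂ f₃ x| ≤ |f₁ x| + |f₂ x| + |f₃ x| := by
  have h : ∀ a b : ℝ, |b| ≤ 1 → |a * b| ≤ |a| := fun a b hb => by
    rw [abs_mul]; exact mul_le_of_le_one_right (abs_nonneg _) hb
  exact (abs_add_three _ _ _).trans (add_le_add_three (h _ _ (abs_heav_le _))
    (h _ _ (abs_heav_le _)) (h _ _ (abs_heav_sub_heav_le _ _)))

/-- A bound for a function and its first two derivatives at a point. -/
structure C2Bound (f : ℝ → ℝ) (x C : ℝ) : Prop where
  zero : |f x| ≤ C
  one : |deriv f x| ≤ C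
  two : |deriv (deriv f) x| ≤ C

theorem C2Bound.mul {f g : ℝ → ℝ} {x C D : ℝ} (hf : C2Bound f x C) (hg : C2Bound g x D)
    (hfs : ContDiff ℝ ∞ f) (hgs : ContDiff ℝ ∞ g) :
    |f x * g x| ≤ 4 * (C * D) ∧ |deriv (deriv fun y => f y * g y) x| ≤ 4 * (C * D) := by
  have hC : 0 ≤ C := (abs_nonneg _).trans hf.zero
  have hD : 0 ≤ D := (abs_nonneg _).trans hg.zero
  have h : ∀ a b : ℝ, |a| ≤ C → |b| ≤ D → |a * b| ≤ C * D := fun a b ha hb => by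
    rw [abs_mul]; exact mul_le_mul ha hb (abs_nonneg _) hC
  have h0 := h _ _ hf.zero hg.zero
  have h1 := h _ _ hf.two hg.zero
  have h2 := h _ _ hf.one hg.one
  have h3 := h _ _ hf.zero hg.two
  refine ⟨by linarith [mul_nonneg hC hD], ?_⟩
  rw [Ansatz.deriv_deriv_mul hfs hgs]
  rw [abs_le] at *
  constructor <;> linarith [h1.1, h1.2, h2.1, h2.2, h3.1, h3.2]

theorem IsTest.exists_C2Bound {l₁ l₂ : ℝ} {e : ℝ → ℝ} (he : IsTest l₁ l₂ e) :
    ∃ E, 0 ≤ E ∧ ∀ x, C2Bound e x E := by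
  obtain ⟨E0, h00, h0⟩ := he.exists_abs_le
  obtain ⟨E1, h10, h1⟩ := he.deriv.exists_abs_le
  obtain ⟨E2, h20, h2⟩ := he.deriv.deriv.exists_abs_le
  exact ⟨E0 + E1 + E2, by positivity, fun x => ⟨(h0 x).trans (by linarith),
    (h1 x).trans (by linarith), (h2 x).trans (by linarith)⟩⟩

theorem C2Bound.of_affine {a b x C : ℝ} (h0 : |a + b * x| ≤ C) (h1 : |b| ≤ C) :
    C2Bound (fun y => a + b * y) x C := by
  have hd : deriv (fun y => a + b * y) = fun _ => b := funext fun y =>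
    (((hasDerivAt_id y).const_mul b).const_add a).deriv.trans (mul_one b)
  refine ⟨h0, by rwa [hd], ?_⟩
  rw [hd, deriv_const, abs_zero]
  exact (abs_nonneg _).trans h1

namespace Ansatz

variable {A : Ansatz} {K : ℝ}

namespace IsAdmissible

variable (hA : A.IsAdmissible)

include hA

/-- The free boundaries stay apart at the initial time, uniformly in the small parameter. -/
theorem exists_le_ψ_zero : ∃ r ε₁, 0 < r ∧ 0 < ε₁ ∧ ε₁ ≤ A.ε₀ ∧ ∀ ε ∈ Ioo 0 ε₁, r ≤ A.ψ ε 0 := by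
  obtain ⟨Z, φl, hZ⟩ := hA.decay_φ1
  have hd : 0 < A.ψ0 0 := sub_pos.2 hA.apart
  have hm : 0 < 4 * (|Z| + 1) := by positivity
  -- For such `ε` the initial `τ` is at least `4 (|Z| + 1)`, so each `|φ_{i1}| ≤ 1/4` and `ψ ≥
  -- ψ₀/2`.
  refine ⟨A.ψ0 0 / 2, min A.ε₀ (A.ψ0 0 / (4 * (|Z| + 1))), by positivity,
    lt_min hA.ε₀_pos (by positivity), min_le_left _ _, fun ε hε => ?_⟩
  have hε0 := hε.1
  have h1 : ε < A.ψ0 0 / (4 * (|Z| + 1)) := hε.2.trans_le (min_le_right _ _)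
  rw [lt_div_iff₀ hm] at h1
  have hτ : A.τ ε 0 * ε = A.ψ0 0 := div_mul_cancel₀ _ hε0.ne'
  have h2 : 4 * (|Z| + 1) ≤ A.τ ε 0 := by
    rw [τ, le_div_iff₀ hε0]; linarith
  have hb : ∀ i, |A.φ1 i (A.τ ε 0) 0| ≤ 1 / 4 := by
    intro i
    refine ((hZ i 0 (left_mem_Icc.2 hA.t₁_pos.le) _).1 (by linarith [abs_nonneg Z])).trans ?_
    rw [div_le_iff₀ (by linarith)]
    linarith [le_abs_self Z]
  have e : A.ψ ε 0 = A.ψ0 0 * (1 + A.φ1 1 (A.τ ε 0) 0 - A.φ1 0 (A.τ ε 0) 0) := by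
    simp only [ψ, φ, ψ0]; ring
  have b0 := (abs_le.1 (hb 0)).2
  have b1 := (abs_le.1 (hb 1)).1
  rw [e]
  nlinarith

variable {bc : BoundaryCondition} (hq : A.SolvesHeat bc)

include hq

/-- The initial temperature without `q̌` and its second derivative as a functional on bounded
functions are bounded uniformly in the small parameter. -/
theorem exists_initial_bound : ∃ C ε₁, 0 ≤ C ∧ 0 < ε₁ ∧ ε₁ ≤ A.ε₀ ∧ ∀ ε ∈ Ioo 0 ε₁,
    (∀ x ∈ Icc A.l₁ A.l₂, |A.excess ε 0 x| ≤ C) ∧ ∀ χ : ℝ → ℝ, ContDiff ℝ ∞ χ →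
      (∀ x, |χ x| ≤ 1) → |∫ x in A.l₁..A.l₂, A.excess ε 0 x * deriv (deriv χ) x| ≤ C := by
  obtain ⟨K, hK⟩ := hA.exists_uniformBounds
  obtain ⟨r, ε₁, hr, hε₁, hε₁₀, hψ⟩ := hA.exists_le_ψ_zero
  obtain ⟨E, hE0, hE⟩ := hA.test_e.exists_C2Bound
  obtain ⟨P, hP0, hP⟩ := exists_abs_bump_le (A.γp 0 0) (A.γm 1 0) A.l₁ A.l₂ hr
  obtain ⟨Q, hQ0, hQ⟩ := exists_abs_bump_le (A.γm 0 0) (A.γp 1 0) A.l₁ A.l₂ hr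
  have hK0 := hK.nonneg
  have hl := hA.l₁_lt_l₂.le
  set L := A.l₂ - A.l₁ with hL
  have hL0 : 0 ≤ L := sub_nonneg.2 hl
  have h0 : (0 : ℝ) ∈ Icc 0 A.t₁ := left_mem_Icc.2 hA.t₁_pos.le
  -- One common bound, up to second derivatives, for the outer pieces, the middle cubic and `I`.
  set D := K * (L + 1) + (K * P + (1 + K) * Q) + (K + (L + 1) * (2 * K / r)) with hD
  have hD0 : 0 ≤ D := by positivity
  have hD1 : K * (L + 1) ≤ D := by
    have : 0 ≤ (K * P + (1 + K) * Q) + (K + (L + 1) * (2 * K / r)) := by positivity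
    linarith
  have hD2 : K * P + (1 + K) * Q ≤ D := by
    have : 0 ≤ K * (L + 1) + (K + (L + 1) * (2 * K / r)) := by positivity
    linarith
  have hD3 : K + (L + 1) * (2 * K / r) ≤ D := by
    have : 0 ≤ K * (L + 1) + (K * P + (1 + K) * Q) := by positivity
    linarith
  refine ⟨16 * (E * D) + 16 * (E * D) * L + 4 * (K * K), ε₁, by positivity, hε₁, hε₁₀,
    fun ε hε => ?_⟩
  have hε' : ε ∈ Ioo 0 A.ε₀ := ⟨hε.1, hε.2.trans_le hε₁₀⟩
  have hψε := hψ ε hε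
  have hφ : ∀ i, A.φ i ε 0 ∈ Icc A.l₁ A.l₂ := fun i => Ioo_subset_Icc_self (hA.φ_mem hε' h0 i)
  have hdist : ∀ {x y}, x ∈ Icc A.l₁ A.l₂ → y ∈ Icc A.l₁ A.l₂ → |x - y| ≤ L := fun hx hy =>
    abs_sub_le_of_le_of_le hx.1 hx.2 hy.1 hy.2
  have hmul : ∀ {a b c d : ℝ}, |a| ≤ c → |b| ≤ d → |a * b| ≤ c * d := fun {a b c d} h h' => by
    rw [abs_mul]; exact mul_le_mul h h' (abs_nonneg _) ((abs_nonneg _).trans h)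
  have c1 : ∀ x ∈ Icc A.l₁ A.l₂, C2Bound (fun y => A.γm 0 0 * (A.φ 0 ε 0 - y)) x D := by
    intro x hx
    have e1 : (fun y => A.γm 0 0 * (A.φ 0 ε 0 - y))
        = fun y => A.γm 0 0 * A.φ 0 ε 0 + -A.γm 0 0 * y := funext fun y => by ring
    rw [e1]
    refine C2Bound.of_affine ?_ ?_
    · rw [show A.γm 0 0 * A.φ 0 ε 0 + -A.γm 0 0 * x = A.γm 0 0 * (A.φ 0 ε 0 - x) by ring]
      exact (hmul (hK.γm 0 0 h0) (hdist (hφ 0) hx)).trans (by linarith)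
    · rw [abs_neg]
      exact (hK.γm 0 0 h0).trans (by nlinarith)
  have c2 : ∀ x ∈ Icc A.l₁ A.l₂, C2Bound (fun y => A.γp 1 0 * (y - A.φ 1 ε 0)) x D := by
    intro x hx
    have e1 : (fun y => A.γp 1 0 * (y - A.φ 1 ε 0))
        = fun y => -(A.γp 1 0 * A.φ 1 ε 0) + A.γp 1 0 * y := funext fun y => by ring
    rw [e1]
    refine C2Bound.of_affine ?_ ?_
    · rw [show -(A.γp 1 0 * A.φ 1 ε 0) + A.γp 1 0 * x = A.γp 1 0 * (x - A.φ 1 ε 0) by ring]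
      exact (hmul (hK.γp 1 0 h0) (hdist hx (hφ 1))).trans (by linarith)
    · exact (hK.γp 1 0 h0).trans (by nlinarith)
  have c3 : ∀ x ∈ Icc A.l₁ A.l₂, C2Bound (fun y =>
      A.B (A.τ ε 0) * A.Pin ε 0 y - (1 - A.B (A.τ ε 0)) * A.Phat ε 0 y) x D := by
    intro x hx
    have hB := hK.B (A.τ ε 0)
    have hB' : |1 - A.B (A.τ ε 0)| ≤ 1 + K := (abs_sub _ _).trans (by simpa using hB)
    have p := hP _ (hφ 0) _ (hφ 1) x hx hψε
    have q := hQ _ (hφ 0) _ (hφ 1) x hx hψε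
    have hs : ∀ {a b : ℝ}, |a| ≤ P → |b| ≤ Q →
        |A.B (A.τ ε 0) * a - (1 - A.B (A.τ ε 0)) * b| ≤ D := fun ha hb =>
      ((abs_sub _ _).trans (add_le_add (hmul hB ha) (hmul hB' hb))).trans hD2
    refine ⟨hs p.1 q.1, ?_, ?_⟩
    · rw [deriv_mixed]; exact hs p.2.1 q.2.1
    · rw [deriv_deriv_mixed]; exact hs p.2.2 q.2.2
  -- Only the separation `ψ ≥ r` at the initial time controls `κ`.
  have hκ : |A.κ ε 0| ≤ 2 * K / r := by
    rw [le_div_iff₀ hr]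
    have h1 := hA.slope_I ε hε' 0 h0
    have h2 : |A.ψ ε 0 * A.κ ε 0| ≤ 2 * K := by
      rw [h1]
      exact (abs_add_le _ _).trans (by linarith [hK.φt 0 ε 0 h0, hK.φt 1 ε 0 h0])
    rw [abs_mul, abs_of_pos (hr.trans_le hψε)] at h2
    nlinarith [abs_nonneg (A.κ ε 0)]
  have hr2 : 0 ≤ 2 * K / r := by positivity
  have c4 : ∀ x ∈ Icc A.l₁ A.l₂, C2Bound (A.I ε 0) x D := by
    intro x hx
    have e1 : A.I ε 0 = fun y => ((A.φt 0 ε 0 - A.φt 1 ε 0) / 2 + A.mid ε 0 * A.κ ε 0)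
        + -A.κ ε 0 * y := funext fun y => by unfold I; ring
    have hmid : A.mid ε 0 ∈ Icc A.l₁ A.l₂ := by
      have m0 := hφ 0
      have m1 := hφ 1
      simp only [mid]
      constructor <;> linarith [m0.1, m0.2, m1.1, m1.2]
    rw [e1]
    refine C2Bound.of_affine ?_ ?_
    · rw [show ((A.φt 0 ε 0 - A.φt 1 ε 0) / 2 + A.mid ε 0 * A.κ ε 0) + -A.κ ε 0 * x
        = (A.φt 0 ε 0 - A.φt 1 ε 0) / 2 - (x - A.mid ε 0) * A.κ ε 0 by ring]
      have h1 : |(A.φt 0 ε 0 - A.φt 1 ε 0) / 2| ≤ K := by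
        have f0 := abs_le.1 (hK.φt 0 ε 0 h0)
        have f1 := abs_le.1 (hK.φt 1 ε 0 h0)
        rw [abs_le]
        constructor <;> linarith [f0.1, f0.2, f1.1, f1.2]
      refine ((abs_sub _ _).trans (add_le_add h1 (hmul (hdist hx hmid) hκ))).trans ?_
      linarith
    · rw [abs_neg]
      exact hκ.trans (by nlinarith)
  have s1 := A.contDiff_outer_left ε 0
  have s2 := A.contDiff_outer_right ε 0
  have s3 := A.contDiff_mixed ε 0
  have s4 := contDiff_I_x (A := A) ε 0
  have hexc : ∀ x ∈ Icc A.l₁ A.l₂,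
      A.excess ε 0 x = A.e x * A.S ε 0 x + A.e x * A.I ε 0 x := by
    intro x hx
    rw [excess, hq.initial ε hε' x hx, T]; ring
  constructor
  · intro x hx
    have b1 := ((hE x).mul (c1 x hx) hA.test_e.1 s1).1
    have b2 := ((hE x).mul (c2 x hx) hA.test_e.1 s2).1
    have b3 := ((hE x).mul (c3 x hx) hA.test_e.1 s3).1
    have b4 := ((hE x).mul (c4 x hx) hA.test_e.1 s4).1
    have b5 := abs_kinked_le (A.φ 0 ε 0) (A.φ 1 ε 0)
      (fun y => A.e x * (A.γm 0 0 * (A.φ 0 ε 0 - y)))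
      (fun y => A.e x * (A.γp 1 0 * (y - A.φ 1 ε 0))) (fun y => A.e x *
        (A.B (A.τ ε 0) * A.Pin ε 0 y - (1 - A.B (A.τ ε 0)) * A.Phat ε 0 y)) x
    have e5 : A.e x * A.S ε 0 x = kinked (A.φ 0 ε 0) (A.φ 1 ε 0)
        (fun y => A.e x * (A.γm 0 0 * (A.φ 0 ε 0 - y)))
        (fun y => A.e x * (A.γp 1 0 * (y - A.φ 1 ε 0))) (fun y => A.e x *
          (A.B (A.τ ε 0) * A.Pin ε 0 y - (1 - A.B (A.τ ε 0)) * A.Phat ε 0 y)) x := by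
      rw [S_eq_kinked]; simp only [kinked]; ring
    rw [hexc x hx, e5]
    refine (abs_add_le _ _).trans ?_
    have : 0 ≤ 16 * (E * D) * L + 4 * (K * K) := by positivity
    linarith
  · intro χ hχ hb
    have hψ0 : A.ψ ε 0 ≠ 0 := (hr.trans_le hψε).ne'
    have hc := continuous_deriv_deriv hχ
    have i1 : IntervalIntegrable (fun x => A.e x * A.S ε 0 x * deriv (deriv χ) x) volume
        A.l₁ A.l₂ := (((hA.test_e.1.continuous.mul (hA.continuous_S_x ε 0))).mul
          hc).intervalIntegrable _ _
    have i2 : IntervalIntegrable (fun x => A.e x * A.I ε 0 x * deriv (deriv χ) x) volume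
        A.l₁ A.l₂ := (((hA.test_e.1.continuous.mul s4.continuous)).mul hc).intervalIntegrable _ _
    have e1 : ∫ x in A.l₁..A.l₂, A.excess ε 0 x * deriv (deriv χ) x
        = (∫ x in A.l₁..A.l₂, A.e x * A.S ε 0 x * deriv (deriv χ) x)
          + ∫ x in A.l₁..A.l₂, A.e x * A.I ε 0 x * deriv (deriv χ) x := by
      rw [← intervalIntegral.integral_add i1 i2]
      refine intervalIntegral.integral_congr fun x hx => ?_
      rw [uIcc_of_le hl] at hx
      simp only [hexc x hx]; ring
    have e2 := integral_regPart hA hε' h0 hψ0 hχ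
    have e3 := integral_deriv_deriv_mul (hA.test_e.1.mul s4) hχ A.l₁ A.l₂
    have hdl : ∀ x, x ∉ Ioo A.l₁ A.l₂ → deriv (fun y => A.e y * A.I ε 0 y) x = 0 := by
      intro x hx
      rw [deriv_fun_mul (hA.test_e.1.differentiable (by norm_num) x)
        (s4.differentiable (by norm_num) x), hA.test_e.eq_zero hx, hA.test_e.deriv.eq_zero hx]
      ring
    rw [hdl _ fun h => lt_irrefl _ h.1, hdl _ fun h => lt_irrefl _ h.2, hA.test_e.left,
      hA.test_e.right] at e3
    have b1 := intervalIntegral.norm_integral_le_of_norm_le_const (a := A.l₁) (b := A.l₂)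
      (f := fun x => A.regPart ε 0 x * χ x) (C := 12 * (E * D)) fun x hx => by
        rw [uIoc_of_le hl] at hx
        have hx' := Ioc_subset_Icc_self hx
        have b1 := ((hE x).mul (c1 x hx') hA.test_e.1 s1).2
        have b2 := ((hE x).mul (c2 x hx') hA.test_e.1 s2).2
        have b3 := ((hE x).mul (c3 x hx') hA.test_e.1 s3).2
        have b5 : |A.regPart ε 0 x| ≤ 12 * (E * D) := (abs_kinked_le _ _ _ _ _ _).trans
          (by linarith)
        exact (hmul b5 (hb x)).trans (by linarith)
    have b2 := intervalIntegral.norm_integral_le_of_norm_le_const (a := A.l₁) (b := A.l₂)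
      (f := fun x => deriv (deriv fun y => A.e y * A.I ε 0 y) x * χ x) (C := 4 * (E * D))
      fun x hx => by
        rw [uIoc_of_le hl] at hx
        exact (hmul ((hE x).mul (c4 x (Ioc_subset_Icc_self hx)) hA.test_e.1 s4).2 (hb x)).trans
          (by linarith)
    rw [Real.norm_eq_abs, abs_of_nonneg hL0] at b1 b2
    have b3 := abs_sum_kinkMass_le hK (ε := ε) h0 hb
    -- Both derivatives are moved back from `χ` to the temperature, whose second derivative is a
    -- bounded function plus point masses at the kinks.
    have e4 : ∫ x in A.l₁..A.l₂, A.excess ε 0 x * deriv (deriv χ) x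
        = (∫ x in A.l₁..A.l₂, A.regPart ε 0 x * χ x)
          + (∑ i : Fin 2, A.kinkMass i ε 0 * χ (A.φ i ε 0))
          + ∫ x in A.l₁..A.l₂, deriv (deriv fun y => A.e y * A.I ε 0 y) x * χ x := by
      rw [e1]; linarith
    rw [e4]
    refine (abs_add_three _ _ _).trans ?_
    have : 0 ≤ 16 * (E * D) := by positivity
    linarith

end IsAdmissible

end Ansatz

/-! ### Uniform Hölder continuity of the temperature -/

namespace Ansatz.IsAdmissible

variable {A : Ansatz} (hA : A.IsAdmissible) {bc : BoundaryCondition} (hq : A.SolvesHeat bc)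

include hA hq

/-- Since `χ'' = -λ χ` for a mode, the bound on the initial second derivative gives initial
coefficients of order `1/λ`, matching the gain of `exists_abs_coeff_le`. For `n = 0` the sup bound
replaces it. -/
theorem exists_abs_coeff_mode_le : ∃ C ε₁, 0 ≤ C ∧ 0 < ε₁ ∧ ε₁ ≤ A.ε₀ ∧ ∀ ε ∈ Ioo 0 ε₁,
    ∀ t ∈ Icc 0 A.t₁, ∀ n : ℕ,
      |∫ x in A.l₁..A.l₂, A.excess ε t x * A.mode bc n x| ≤ C * coeffDecay n := by
  obtain ⟨M, hM0, hM⟩ := hA.exists_abs_coeff_le hq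
  obtain ⟨C, ε₁, hC0, hε₁, hε₁₀, hC⟩ := hA.exists_initial_bound hq
  have hl := hA.l₁_lt_l₂.le
  set L := A.l₂ - A.l₁ with hL
  have hL0 : 0 < L := sub_pos.2 hA.l₁_lt_l₂
  have hk : 0 < Real.pi / L := by positivity
  set R := ((Real.pi / L) ^ 2)⁻¹ with hR
  have hR0 : 0 < R := by positivity
  refine ⟨(C * L + M) + (C + M) * R, ε₁, by positivity, hε₁, hε₁₀, fun ε hε t ht n => ?_⟩
  have hε' : ε ∈ Ioo 0 A.ε₀ := ⟨hε.1, hε.2.trans_le hε₁₀⟩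
  have hχ := A.contDiff_mode bc n
  have hb := A.abs_mode_le bc n
  have hD : bc = BoundaryCondition.dirichlet → A.mode bc n A.l₁ = 0 ∧ A.mode bc n A.l₂ = 0 := by
    rintro rfl; exact mode_dirichlet_ends hA n
  have hN : bc = BoundaryCondition.neumann →
      deriv (A.mode bc n) A.l₁ = 0 ∧ deriv (A.mode bc n) A.l₂ = 0 := by
    rintro rfl; exact deriv_mode_neumann_ends hA n
  have hev := A.deriv_deriv_mode bc n
  rw [← hL] at hev
  have h1 := hM ε hε' (A.mode bc n) hχ hb hD hN ((n * (Real.pi / L)) ^ 2) (by positivity) hev t ht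
  rcases eq_or_ne n 0 with rfl | hn
  · have h2 := intervalIntegral.norm_integral_le_of_norm_le_const (a := A.l₁) (b := A.l₂)
      (f := fun x => A.excess ε 0 x * A.mode bc 0 x) (C := C) fun x hx => by
        rw [uIoc_of_le hl] at hx
        rw [norm_mul]
        calc _ ≤ C * 1 := mul_le_mul ((hC ε hε).1 x (Ioc_subset_Icc_self hx)) (hb x)
              (abs_nonneg _) hC0
          _ = C := mul_one C
    rw [Real.norm_eq_abs, abs_of_pos hL0] at h2
    rw [if_pos (by simp)] at h1
    rw [coeffDecay, if_pos rfl]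
    have : 0 ≤ (C + M) * R := by positivity
    linarith
  · have hn0 : (0 : ℝ) < n := by exact_mod_cast hn.bot_lt
    have hlam : 0 < (n * (Real.pi / L)) ^ 2 := by positivity
    have h2 := (hC ε hε).2 _ hχ hb
    have h3 : ∫ x in A.l₁..A.l₂, A.excess ε 0 x * deriv (deriv (A.mode bc n)) x
        = -(n * (Real.pi / L)) ^ 2 * ∫ x in A.l₁..A.l₂, A.excess ε 0 x * A.mode bc n x := by
      rw [← intervalIntegral.integral_const_mul]
      refine intervalIntegral.integral_congr fun x _ => ?_
      simp only [hev x]; ring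
    rw [h3, abs_mul, abs_neg, abs_of_pos hlam, ← le_div_iff₀' hlam, div_eq_mul_inv] at h2
    rw [if_neg hlam.ne'] at h1
    have h4 : ((n * (Real.pi / L)) ^ 2)⁻¹ = R * coeffDecay n := by
      rw [coeffDecay, if_neg hn, hR, mul_pow, mul_inv, mul_comm]
    rw [h4] at h1 h2
    have h5 := mul_nonneg (by positivity : 0 ≤ C * L + M) (coeffDecay_nonneg n)
    linarith

/-- The temperature without `q̌` is bounded and Hölder continuous in `x` with exponent `1/2`,
uniformly in the small parameter and in time. -/
theorem exists_holder_excess : ∃ C ε₁, 0 ≤ C ∧ 0 < ε₁ ∧ ε₁ ≤ A.ε₀ ∧ ∀ ε ∈ Ioo 0 ε₁,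
    ∀ t ∈ Icc 0 A.t₁, ∀ x ∈ Icc A.l₁ A.l₂, |A.excess ε t x| ≤ C ∧
      ∀ y ∈ Icc A.l₁ A.l₂, |A.excess ε t x - A.excess ε t y| ≤ C * √|x - y| := by
  obtain ⟨C, ε₁, hC0, hε₁, hε₁₀, hC⟩ := hA.exists_abs_coeff_mode_le hq
  set L := A.l₂ - A.l₁ with hL
  have hL0 : 0 < L := sub_pos.2 hA.l₁_lt_l₂
  set C1 := C * (1 / L * ∑' n : ℤ, coeffDecay n.natAbs) with hC1
  set C2 := C * (1 / L * (2 * √(Real.pi / L) * ∑' n : ℤ, coeffDecay n.natAbs * √(|n| : ℝ)))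
    with hC2
  have hC10 : 0 ≤ C1 := mul_nonneg hC0 (mul_nonneg (by positivity)
    (tsum_nonneg fun n => coeffDecay_nonneg _))
  have hC20 : 0 ≤ C2 := mul_nonneg hC0 (mul_nonneg (by positivity) (mul_nonneg (by positivity)
    (tsum_nonneg fun n => mul_nonneg (coeffDecay_nonneg _) (Real.sqrt_nonneg _))))
  refine ⟨C1 + C2, ε₁, by positivity, hε₁, hε₁₀, fun ε hε t ht => ?_⟩
  have hε' : ε ∈ Ioo 0 A.ε₀ := ⟨hε.1, hε.2.trans_le hε₁₀⟩
  have hcont : ContinuousOn (fun y => A.excess ε t (A.l₁ + y)) (Icc 0 L) :=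
    (hA.continuousOn_excess_x hq hε' ht).comp (by fun_prop) fun y hy =>
      ⟨by linarith [hy.1], by linarith [hy.2]⟩
  have hend : bc = BoundaryCondition.dirichlet →
      A.excess ε t (A.l₁ + 0) = 0 ∧ A.excess ε t (A.l₁ + L) = 0 := by
    intro h
    have hb := hq.boundary h ε hε' t ht
    rw [add_zero, hL, add_sub_cancel]
    simp [excess, hA.test_e.left, hA.test_e.right, hb.1, hb.2]
  have hcoef : ∀ n : ℕ, |∫ y in (0 : ℝ)..L, A.excess ε t (A.l₁ + y)
      * bc.trig (n * (Real.pi * y / L))| ≤ C * coeffDecay n := by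
    intro n
    have h1 := intervalIntegral.integral_comp_add_left (a := 0) (b := L)
      (fun x => A.excess ε t x * A.mode bc n x) A.l₁
    simp only [mode, add_sub_cancel_left] at h1
    rw [← hL] at h1
    rw [h1, add_zero, hL, add_sub_cancel]
    exact hC ε hε t ht n
  obtain ⟨h1, h2⟩ := holder_of_coeff hL0 hcont hend hcoef
  have hmem : ∀ x ∈ Icc A.l₁ A.l₂, x - A.l₁ ∈ Icc 0 L := fun x hx =>
    ⟨sub_nonneg.2 hx.1, sub_le_sub_right hx.2 _⟩
  refine fun x hx => ⟨?_, fun y hy => ?_⟩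
  · have := h1 _ (hmem x hx)
    rw [add_sub_cancel] at this
    linarith
  · have := h2 _ (hmem x hx) _ (hmem y hy)
    rw [add_sub_cancel, add_sub_cancel, sub_sub_sub_cancel_right] at this
    refine this.trans (mul_le_mul_of_nonneg_right ?_ (Real.sqrt_nonneg _))
    linarith

/-- The temperature is bounded and Hölder continuous in `x` with exponent `1/2`, uniformly in the
small parameter and in time. -/
theorem exists_holder_θ : ∃ C ε₁, 0 ≤ C ∧ 0 < ε₁ ∧ ε₁ ≤ A.ε₀ ∧ ∀ ε ∈ Ioo 0 ε₁,
    ∀ t ∈ Icc 0 A.t₁, ∀ x ∈ Icc A.l₁ A.l₂, |A.θ ε t x| ≤ C ∧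
      ∀ y ∈ Icc A.l₁ A.l₂, |A.θ ε t x - A.θ ε t y| ≤ C * √|x - y| := by
  obtain ⟨C, ε₁, hC0, hε₁, hε₁₀, hC⟩ := hA.exists_holder_excess hq
  obtain ⟨Z, hZ⟩ := hA.bounds_qc
  refine ⟨C + |Z| + |Z| * √(A.l₂ - A.l₁), ε₁, by positivity, hε₁, hε₁₀,
    fun ε hε t ht x hx => ⟨?_, fun y hy => ?_⟩⟩
  all_goals have hε' : ε ∈ Ioo 0 A.ε₀ := ⟨hε.1, hε.2.trans_le hε₁₀⟩
  · rw [θ_eq]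
    have h1 := (hC ε hε t ht x hx).1
    have h2 := (hZ ε hε' t ht x hx).1
    have h3 : 0 ≤ |Z| * √(A.l₂ - A.l₁) := by positivity
    exact (abs_add_le _ _).trans (by linarith [le_abs_self Z])
  · rw [θ_eq, θ_eq, add_sub_add_comm]
    have h1 := (hC ε hε t ht x hx).2 y hy
    have h2 : |A.qc ε t x - A.qc ε t y| ≤ Z * |x - y| :=
      Convex.norm_image_sub_le_of_norm_deriv_le (s := Icc A.l₁ A.l₂)
        (fun z _ => (hA.smooth_qc ε hε' t ht).differentiable (by norm_num) z)
        (fun z hz => (hZ ε hε' t ht z hz).2.1) (convex_Icc _ _) hy hx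
    have h3 : √|x - y| ≤ √(A.l₂ - A.l₁) :=
      Real.sqrt_le_sqrt (abs_sub_le_of_le_of_le hx.1 hx.2 hy.1 hy.2)
    have h4 := Real.sqrt_nonneg |x - y|
    have h5 : Z * |x - y| ≤ |Z| * √(A.l₂ - A.l₁) * √|x - y| := by
      calc Z * |x - y| ≤ |Z| * |x - y| := by gcongr; exact le_abs_self Z
        _ = |Z| * (√|x - y| * √|x - y|) := by rw [Real.mul_self_sqrt (abs_nonneg _)]
        _ ≤ |Z| * (√(A.l₂ - A.l₁) * √|x - y|) := by gcongr
        _ = _ := by ring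
    have h6 : 0 ≤ |Z| * √|x - y| := by positivity
    refine (abs_add_le _ _).trans ?_
    linarith

end Ansatz.IsAdmissible

/-! ### Calculus of uniform estimates in the small parameter -/

theorem UnifO.of_le {t₁ ν C ε₁ : ℝ} {R : ℝ → ℝ → ℝ} (hν1 : ν ≤ 1) (hε₁ : 0 < ε₁)
    (h : ∀ ε ∈ Ioo 0 ε₁, ∀ t ∈ Icc 0 t₁, |R ε t| ≤ C * ε) : UnifO t₁ ν R := by
  refine ⟨|C|, min ε₁ 1, lt_min hε₁ one_pos, fun ε hε t ht => ?_⟩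
  have h1 := h ε ⟨hε.1, hε.2.trans_le (min_le_left _ _)⟩ t ht
  have h2 : ε ≤ ε ^ ν := by
    simpa using Real.rpow_le_rpow_of_exponent_ge hε.1 (hε.2.le.trans (min_le_right _ _)) hν1
  have := hε.1
  calc _ ≤ C * ε := h1
    _ ≤ |C| * ε := by gcongr; exact le_abs_self C
    _ ≤ _ := by gcongr

theorem UnifO.add {t₁ ν : ℝ} {R R' : ℝ → ℝ → ℝ} (h : UnifO t₁ ν R) (h' : UnifO t₁ ν R') :
    UnifO t₁ ν fun ε t => R ε t + R' ε t := by
  obtain ⟨C, ε₁, h1, h⟩ := h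
  obtain ⟨C', ε₂, h2, h'⟩ := h'
  refine ⟨C + C', min ε₁ ε₂, lt_min h1 h2, fun ε hε t ht => ?_⟩
  have b := h ε ⟨hε.1, hε.2.trans_le (min_le_left _ _)⟩ t ht
  have b' := h' ε ⟨hε.1, hε.2.trans_le (min_le_right _ _)⟩ t ht
  rw [add_mul]
  exact (abs_add_le _ _).trans (add_le_add b b')

theorem UnifO.mono {t₁ ν ν' : ℝ} {R : ℝ → ℝ → ℝ} (h : UnifO t₁ ν R) (hν : ν' ≤ ν) :
    UnifO t₁ ν' R := by
  obtain ⟨C, ε₁, h1, h⟩ := h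
  refine ⟨|C|, min ε₁ 1, lt_min h1 one_pos, fun ε hε t ht => ?_⟩
  have b := h ε ⟨hε.1, hε.2.trans_le (min_le_left _ _)⟩ t ht
  have h2 := Real.rpow_le_rpow_of_exponent_ge hε.1 (hε.2.le.trans (min_le_right _ _)) hν
  have h3 := Real.rpow_nonneg hε.1.le ν
  calc _ ≤ C * ε ^ ν := b
    _ ≤ |C| * ε ^ ν := by gcongr; exact le_abs_self C
    _ ≤ _ := by gcongr

theorem UnifO.congr {t₁ ν ε₀ : ℝ} {R R' : ℝ → ℝ → ℝ} (h : UnifO t₁ ν R) (hε₀ : 0 < ε₀)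
    (hR : ∀ ε ∈ Ioo 0 ε₀, ∀ t ∈ Icc 0 t₁, R' ε t = R ε t) : UnifO t₁ ν R' := by
  obtain ⟨C, ε₁, h1, h⟩ := h
  refine ⟨C, min ε₁ ε₀, lt_min h1 hε₀, fun ε hε t ht => ?_⟩
  rw [hR ε ⟨hε.1, hε.2.trans_le (min_le_right _ _)⟩ t ht]
  exact h ε ⟨hε.1, hε.2.trans_le (min_le_left _ _)⟩ t ht

theorem UnifO.const_mul {t₁ ν : ℝ} {R : ℝ → ℝ → ℝ} (h : UnifO t₁ ν R) (c : ℝ) :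
    UnifO t₁ ν fun ε t => c * R ε t := by
  obtain ⟨C, ε₁, h1, h⟩ := h
  refine ⟨|c| * C, ε₁, h1, fun ε hε t ht => ?_⟩
  rw [abs_mul, mul_assoc]
  exact mul_le_mul_of_nonneg_left (h ε hε t ht) (abs_nonneg _)

/-! ### Interaction of the layers with the temperature -/

namespace Ansatz

variable {A : Ansatz} {K : ℝ}

theorem wedge_zero_left (b : ℝ) : wedge 0 b = 0 := by simp [wedge, cone_zero_left]

theorem wedge_zero_right (a : ℝ) : wedge a 0 = 0 := by simp [wedge, cone_zero_right]

/-- The temperature model at the free boundaries is negligible against the width of the layers. -/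
theorem UniformBounds.abs_COm_mul_S_le (hK : A.UniformBounds K) (hA : A.IsAdmissible) {ε t : ℝ}
    (hε : 0 < ε) (ht : t ∈ Icc 0 A.t₁) (i : Fin 2) :
    |COm (A.η ε t) * A.S ε t (A.φ i ε t)| ≤ K * (20 * expMass * (K * ε)) := by
  have hK0 := hK.nonneg
  have hM := expMass_nonneg
  -- At a free boundary both wedges vanish and only the outer ramp of the opposite boundary can
  -- survive, namely when the order is reversed.
  have hS : ∃ c, |c| ≤ K ∧ A.S ε t (A.φ i ε t) = c * max (A.φ 0 ε t - A.φ 1 ε t) 0 := by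
    fin_cases i
    · refine ⟨_, hK.γp 1 t ht, ?_⟩
      simp [S_eq_wedge, wedge_zero_left, wedge_zero_right]
    · refine ⟨_, hK.γm 0 t ht, ?_⟩
      simp [S_eq_wedge, wedge_zero_left, wedge_zero_right]
  obtain ⟨c, hc, hS⟩ := hS
  have hw := hA.width_pos hε t
  -- After a crossing the overlap is `|η|` times the width, and `|η|` times the mass is bounded,
  -- which leaves `O(ε)`.
  have key : |COm (A.η ε t) * max (A.φ 0 ε t - A.φ 1 ε t) 0| ≤ 20 * expMass * (K * ε) := by
    rcases le_total (A.φ 0 ε t - A.φ 1 ε t) 0 with h | h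
    · rw [max_eq_right h, mul_zero, abs_zero]
      positivity
    · have h1 : A.φ 0 ε t - A.φ 1 ε t = -(A.η ε t * A.width ε t) := by
        rw [hA.η_eq, div_mul_cancel₀ _ hw.ne']; ring
      have h2 : A.η ε t ≤ 0 := by
        rw [hA.η_eq]; exact div_nonpos_of_nonpos_of_nonneg (by linarith) hw.le
      rw [max_eq_left h, h1, COm_eq, show mass dU (A.η ε t) * -(A.η ε t * A.width ε t)
        = -(A.η ε t * mass dU (A.η ε t) * A.width ε t) by ring, abs_neg, abs_mul, abs_of_pos hw]
      exact mul_le_mul (abs_mul_mass_dU_le h2) (hK.width_le hε.le t) hw.le (by positivity)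
  rw [hS, mul_left_comm, abs_mul]
  exact mul_le_mul hc key (abs_nonneg _) hK0

namespace IsAdmissible

variable (hA : A.IsAdmissible) {bc : BoundaryCondition} (hq : A.SolvesHeat bc)

include hA

theorem θ_φ {ε t : ℝ} (hε : ε ∈ Ioo 0 A.ε₀) (ht : t ∈ Icc 0 A.t₁) (i : Fin 2) :
    A.θ ε t (A.φ i ε t) = A.S ε t (A.φ i ε t) + A.qeI ε t (A.φ i ε t) := by
  rw [θ_eq, excess_eq, hA.e_eq_one_at hε ht]; ring

include hq

theorem integral_u_mul_deriv {ε t : ℝ} (hε : ε ∈ Ioo 0 A.ε₀) (ht : t ∈ Icc 0 A.t₁) {ξ : ℝ → ℝ}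
    (hξ : IsTest A.l₁ A.l₂ ξ) :
    ∫ x in A.l₁..A.l₂, A.u ε t x * deriv (fun y => A.θ ε t y * ξ y) x
      = -∫ x, deriv (A.u ε t) x * (A.θ ε t x * ξ x) := by
  have hu : ContDiff ℝ ∞ (A.u ε t) :=
    (hA.contDiff_u ε).comp (f := fun x : ℝ => (t, x)) (by fun_prop)
  have h1 := absolutelyContinuousOnInterval_of_contDiff
    (hu.of_le (by exact_mod_cast le_top)) A.l₁ A.l₂
  have h2 := (hA.absCont_θ hq hε ht).fun_mul (absolutelyContinuousOnInterval_of_contDiff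
    (hξ.1.of_le (by exact_mod_cast le_top)) A.l₁ A.l₂)
  rw [h1.integral_mul_deriv_eq_deriv_mul h2, hξ.left, hξ.right]
  have h3 := hξ.integral_eq hA.l₁_lt_l₂.le fun x => deriv (A.u ε t) x * A.θ ε t x
  simp only [mul_assoc] at h3
  rw [h3]
  ring

/-- The product of the temperature and a test function is bounded and Hölder continuous. -/
theorem exists_holder_θ_mul {ξ : ℝ → ℝ} (hξ : IsTest A.l₁ A.l₂ ξ) :
    ∃ D ε₁, 0 ≤ D ∧ 0 < ε₁ ∧ ε₁ ≤ A.ε₀ ∧ ∀ ε ∈ Ioo 0 ε₁, ∀ t ∈ Icc 0 A.t₁,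
      (Measurable fun x => A.θ ε t x * ξ x) ∧ (∀ x, |A.θ ε t x * ξ x| ≤ D) ∧
      ∀ p ∈ Icc A.l₁ A.l₂, ∀ x,
        |A.θ ε t x * ξ x - A.θ ε t p * ξ p| ≤ D * |x - p| ^ (1 / 2 : ℝ) := by
  obtain ⟨C, ε₁, hC0, hε₁, hε₁₀, hC⟩ := hA.exists_holder_θ hq
  obtain ⟨Z, hZ0, hZ⟩ := hξ.exists_abs_le
  obtain ⟨Y, hY0, hY⟩ := hξ.exists_lipschitz
  have hl := hA.l₁_lt_l₂.le
  refine ⟨C * Z + C * Y * √(A.l₂ - A.l₁), ε₁, by positivity, hε₁, hε₁₀, fun ε hε t ht => ?_⟩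
  have hε' : ε ∈ Ioo 0 A.ε₀ := ⟨hε.1, hε.2.trans_le hε₁₀⟩
  have hCZ : 0 ≤ C * Y * √(A.l₂ - A.l₁) := by positivity
  have hCY : 0 ≤ C * Z := by positivity
  -- `ξ` vanishes off the interval, so the product factors through the nonexpansive projection onto
  -- `[l₁, l₂]`. This extends the bounds to the whole line, although the temperature is controlled
  -- only on the interval.
  have hproj : ∀ x, A.θ ε t x * ξ x
      = A.θ ε t (projIcc A.l₁ A.l₂ hl x) * ξ (projIcc A.l₁ A.l₂ hl x) := by
    intro x
    by_cases hx : x ∈ Icc A.l₁ A.l₂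
    · rw [projIcc_of_mem hl hx]
    · rw [hξ.eq_zero fun h => hx (Ioo_subset_Icc_self h)]
      rcases le_total x A.l₁ with h | h
      · rw [projIcc_of_le_left hl h, hξ.left]; simp
      · rw [projIcc_of_right_le hl (not_lt.1 fun h' => hx ⟨h, h'.le⟩), hξ.right]; simp
  have hcont : Continuous fun x => A.θ ε t x * ξ x := by
    have hc : ContinuousOn (fun x => A.θ ε t x * ξ x) (Icc A.l₁ A.l₂) :=
      (uIcc_of_le hl ▸ (hA.absCont_θ hq hε' ht).continuousOn).mul hξ.1.continuous.continuousOn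
    rw [funext hproj]
    exact hc.comp_continuous (continuous_subtype_val.comp continuous_projIcc)
      fun x => Subtype.coe_prop _
  refine ⟨hcont.measurable, fun x => ?_, fun p hp x => ?_⟩
  · rw [hproj, abs_mul]
    have := mul_le_mul (hC ε hε t ht _ (projIcc A.l₁ A.l₂ hl x).2).1
      (hZ (projIcc A.l₁ A.l₂ hl x)) (abs_nonneg _) hC0
    linarith
  · rw [hproj x, ← Real.sqrt_eq_rpow]
    set y : ℝ := (projIcc A.l₁ A.l₂ hl x : ℝ) with hy
    have hyI : y ∈ Icc A.l₁ A.l₂ := (projIcc A.l₁ A.l₂ hl x).2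
    have hyp : |y - p| ≤ |x - p| := by
      have h1 := abs_projIcc_sub_projIcc (c := x) (d := p) hl
      rwa [projIcc_of_mem hl hp] at h1
    have h1 := hC ε hε t ht y hyI
    have h2 := mul_le_mul (h1.2 p hp) (hZ p) (abs_nonneg _) (by positivity)
    have h3 := mul_le_mul h1.1 (hY y p) (abs_nonneg _) hC0
    have h4 : √|y - p| ≤ √(A.l₂ - A.l₁) :=
      Real.sqrt_le_sqrt (abs_sub_le_of_le_of_le hyI.1 hyI.2 hp.1 hp.2)
    have h5 : |y - p| ≤ √(A.l₂ - A.l₁) * √|y - p| := by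
      calc |y - p| = √|y - p| * √|y - p| := (Real.mul_self_sqrt (abs_nonneg _)).symm
        _ ≤ _ := by gcongr
    have h6 : √|y - p| ≤ √|x - p| := Real.sqrt_le_sqrt hyp
    rw [show A.θ ε t y * ξ y - A.θ ε t p * ξ p
      = (A.θ ε t y - A.θ ε t p) * ξ p + A.θ ε t y * (ξ y - ξ p) by ring]
    refine (abs_add_le _ _).trans ?_
    rw [abs_mul, abs_mul]
    calc _ ≤ C * √|y - p| * Z + C * (Y * (√(A.l₂ - A.l₁) * √|y - p|)) := by
          refine add_le_add h2 (h3.trans ?_)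
          gcongr
      _ = (C * Z + C * Y * √(A.l₂ - A.l₁)) * √|y - p| := by ring
      _ ≤ _ := by gcongr

/-- The interaction of the order function with the temperature. -/
theorem pairing_u_θ {ξ : ℝ → ℝ} (hξ : IsTest A.l₁ A.l₂ ξ) : UnifO A.t₁ (1 / 2) fun ε t =>
    (∫ x in A.l₁..A.l₂, A.u ε t x * deriv (fun y => A.θ ε t y * ξ y) x)
      - COm (A.η ε t) * (A.qeI ε t (A.φ 0 ε t) * ξ (A.φ 0 ε t)
        - A.qeI ε t (A.φ 1 ε t) * ξ (A.φ 1 ε t)) := by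
  obtain ⟨K, hK⟩ := hA.exists_uniformBounds
  obtain ⟨Z, hZ0, hZ⟩ := hξ.exists_abs_le
  obtain ⟨D, ε₁, hD0, hε₁, hε₁₀, hD⟩ := hA.exists_holder_θ_mul hq hξ
  have h1 : UnifO A.t₁ (1 / 2) fun ε t => (∫ x, deriv (A.u ε t) x * (A.θ ε t x * ξ x))
      + COm (A.η ε t) * (A.θ ε t (A.φ 0 ε t) * ξ (A.φ 0 ε t)
        - A.θ ε t (A.φ 1 ε t) * ξ (A.φ 1 ε t)) := by
    refine ⟨8 * D * expMass * K, ε₁, hε₁, fun ε hε t ht => ?_⟩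
    have hε' : ε ∈ Ioo 0 A.ε₀ := ⟨hε.1, hε.2.trans_le hε₁₀⟩
    obtain ⟨hm, hb, hh⟩ := hD ε hε t ht
    exact hK.pairing_u_x hA hε' hm hb hD0 fun i x =>
      hh _ (Ioo_subset_Icc_self (hA.φ_mem hε' ht i)) x
  -- Lets `θ̌` at the free boundaries be replaced by `q + e I`, the quantity in `coefV`.
  have h2 : ∀ i, UnifO A.t₁ (1 / 2) fun ε t =>
      COm (A.η ε t) * A.S ε t (A.φ i ε t) * ξ (A.φ i ε t) := fun i => by
    refine UnifO.of_le (C := K * (20 * expMass * K) * Z) (by norm_num) hε₁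
      fun ε hε t ht => ?_
    rw [abs_mul]
    have h3 := hK.abs_COm_mul_S_le hA hε.1 ht i
    calc _ ≤ K * (20 * expMass * (K * ε)) * Z :=
          mul_le_mul h3 (hZ _) (abs_nonneg _) ((abs_nonneg _).trans h3)
      _ = _ := by ring
  refine ((h1.const_mul (-1)).add ((h2 0).add ((h2 1).const_mul (-1)))).congr hA.ε₀_pos
    fun ε hε t ht => ?_
  rw [hA.integral_u_mul_deriv hq hε ht hξ, hA.θ_φ hε ht, hA.θ_φ hε ht]
  ring

end IsAdmissible

end Ansatz

end PhaseField

/-! ### Assembly of the two relations -/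

theorem theorem2 (A : PhaseField.Ansatz) (ϰ : ℝ) (bc : PhaseField.Ansatz.BoundaryCondition)
    (hA : A.IsAdmissible)
    (hq : A.SolvesHeat bc)
    (hδ : ∀ ζ : ℝ → ℝ, PhaseField.IsTest A.l₁ A.l₂ ζ →
      PhaseField.UnifO A.t₁ 1 (fun ε t => ∑ i : Fin 2,
        (A.B (A.τ ε t) * (A.γp i t + A.γm i t) - A.coefA i ε t) * ζ (A.φ i ε t)))
    (hβ : ∀ ε ∈ Set.Ioo 0 A.ε₀, ∀ t ∈ Set.Icc 0 A.t₁,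
      A.β (A.τ ε t) ^ 2 = PhaseField.Dhat (A.η ε t) / PhaseField.Chat (A.η ε t))
    (hV : ∀ ζ : ℝ → ℝ, PhaseField.IsTest A.l₁ A.l₂ ζ →
      PhaseField.UnifO A.t₁ 1 (fun ε t => ∑ i : Fin 2,
        A.coefV ϰ i ε t * ζ (A.φ i ε t))) :
    PhaseField.IsWeakAsymptoticSolution A.l₁ A.l₂ A.t₁ A.ε₀ ϰ A.u A.θ := by
  refine ⟨fun ε _ => (hA.contDiff_u ε).contDiffOn, fun ε hε => hA.continuousOn_θ hq hε,
    fun ε hε t ht => hA.absCont_θ hq hε ht,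
    fun ζ hζ ε hε t ht => (hA.hasDerivWithinAt_θ hq hε ht hζ).differentiableWithinAt,
    fun ζ hζ => ?_, fun ξ hξ μ hμ => ?_⟩
  · obtain ⟨C, hC0, hC⟩ := hA.pairing_u_t hζ
    have h1 := PhaseField.UnifO.of_le le_rfl hA.ε₀_pos hC
    -- The order function gives `Σ A_i ζ(φ_i) + O(ε)` and the temperature exactly `-Σ B (γ⁺ + γ⁻)
    -- ζ(φ_i)`, so the sum is minus the expression of condition 2, up to `O(ε)`.
    refine (h1.add ((hδ ζ hζ).const_mul (-1))).congr hA.ε₀_pos fun ε hε t ht => ?_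
    have h2 := hA.derivWithin_θ_add hq hε ht hζ
    simp only [Fin.sum_univ_two, PhaseField.Ansatz.kinkMass] at h2 ⊢
    linarith
  · obtain ⟨C, hC0, hC⟩ := hA.pairing_u_t_mul_u_x hξ
    -- The energy terms are tested with the derivative of `ξ`.
    obtain ⟨C', hC0', hC'⟩ := hA.pairing_energy hξ.deriv hβ
    have h1 := PhaseField.UnifO.of_le (ν := 1 / 2) (by norm_num) hA.ε₀_pos hC
    have h2 := PhaseField.UnifO.of_le (ν := 1 / 2) (by norm_num) hA.ε₀_pos hC'
    have h3 := ((hA.pairing_u_θ hq hξ).const_mul ϰ)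
    have h4 := (hV ξ hξ).mono (ν' := 1 / 2) (by norm_num)
    -- The remainder is `O(ε^{1/2})`, the loss coming only from the Hölder exponent of the
    -- temperature; every `μ < 1/2` follows.
    refine (((h1.add h2).add (h3.add h4)).mono hμ.2.le).congr hA.ε₀_pos fun ε hε t ht => ?_
    simp only [Fin.sum_univ_two, PhaseField.Ansatz.coefV, PhaseField.Ansatz.rate, Fin.val_zero,
      Fin.val_one, pow_zero, pow_one]
    ring
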